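/- **Setting.** Let $\mathbb K=\mathbb C$ (resp. $\mathbb K=\mathbb R$), and let $f(x,y)=\sum a_{p,q}x^py^q$ be holomorphic (resp. real analytic) in a neighbourhood of $0\in\mathbb K^2$, with $f(0,0)=0$ and $f\not\equiv 0$ near $0$. * The critical integrability index is $c_0(f)=\sup\{c>0:\exists\,\epsilon>0,\ \int_{B_\epsilon(0)}|f|^{-c}<+\infty\}$. * The Newton polyhedron $NP(f)\subset\mathbb R^2_{\ge 0}$ is the convex hull of the union of the sets $(p,q)+\mathbb R_{\ge 0}^2$ with $a_{p,q}\neq 0$. The Newton distance $\delta_{NP}(f)$ is given by $\delta_{NP}(f)^{-1}=\inf\{t\ge 0:(t,t)\in NP(f)\}$. The main face is the face or vertex of $\partial NP(f)$ which meets the diagonal, i.e. the smallest face containing $(\delta_{NP}^{-1},\delta_{NP}^{-1})$. * Write $f=(\text{unit})\cdot x^\alpha y^\beta P(x,y)$, where $P$ is a Weierstrass polynomial in $y$ with $P(x,0)\not\equiv 0$, and $P=\prod_{\nu}(y-\phi_\nu(x))$ with complex Puiseux series $\phi_\nu(x)=b_\nu x^{a_\nu}+\cdots$, $b_\nu\neq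 0$, $a_\nu\in\mathbb Q_{>0}$. Let $a_1<\dots<a_k$ be the distinct leading exponents. Each $a_i$ corresponds to the edge $F_i$ of $NP(f)$ of slope $-1/a_i$. For each leading coefficient $b_{i\ell}$ occurring with the exponent $a_i$, let $m_{i\ell}$ be the number of $\nu$, counted with multiplicity, such that $\phi_\nu=b_{i\ell}x^{a_i}+\cdots$. **Proposition.** 1. If the edge $F_i$ is not the main face of $NP(f)$, then $m_{i\ell}\le\delta_{NP}(f)^{-1}$ for all $\ell$. 2. Suppose $m_{i\ell}>\delta_{NP}(f)^{-1}$ for some $i,\ell$, and write $a_i=p/q$ in lowest terms. Then $p=1$ or $q=1$. Moreover, at least one of the following holds: * $q=1$ and there is a holomorphic (resp. real analytic) function $Q$ near $0\in\mathbb K$ with $Q(0)=0$ such that, in the coordinates $(\tilde x,\tilde y)=(x,\,y-Q(x))$, the function $\tilde f(\tilde x,\tilde y)=f(\tilde x,\tilde y+Q(\tilde x))$ satisfies $c_0(f)=2\,\delta_{NP}(\tilde f)$ (resp. $c_0(f)=\delta_{NP}(\tilde f)$); * $p=1$ and there is a holomorphic (resp. real analytic) function $Q$ near $0\in\mathbb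 K$ with $Q(0)=0$ such that, in the coordinates $(\tilde x,\tilde y)=(x-Q(y),\,y)$, the function $\tilde f(\tilde x,\tilde y)=f(\tilde x+Q(\tilde y),\tilde y)$ satisfies $c_0(f)=2\,\delta_{NP}(\tilde f)$ (resp. $c_0(f)=\delta_{NP}(\tilde f)$). -/

import Mathlib

open Filter Topology
open scoped ENNReal

namespace PlaneGerm

noncomputable section

/-! ### Taylor coefficients and the Newton polyhedron -/

/-- The coefficient `a_{p,q}` of `x ^ p * y ^ q` in the Taylor series of `f` at the origin. -/
def taylorCoeff {𝕜 : Type*} [RCLike 𝕜] (f : 𝕜 × 𝕜 → 𝕜) (p q : ℕ) : 𝕜 :=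
  iteratedDeriv p (fun x => iteratedDeriv q (fun y => f (x, y)) 0) 0
    / ((p.factorial : 𝕜) * (q.factorial : 𝕜))

/-- The Newton polyhedron: the convex hull of the union of the orthants `(p, q) + ℝ²_{≥ 0}` over all
monomials `x ^ p * y ^ q` with `a_{p,q} ≠ 0`. -/
def newtonPolyhedron {𝕜 : Type*} [RCLike 𝕜] (f : 𝕜 × 𝕜 → 𝕜) : Set (ℝ × ℝ) :=
  convexHull ℝ {v | ∃ p q : ℕ, taylorCoeff f p q ≠ 0 ∧ (p : ℝ) ≤ v.1 ∧ (q : ℝ) ≤ v.2}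

/-- The inverse `δ_NP⁻¹` of the Newton distance: the least `t ≥ 0` with `(t, t)` in the Newton
polyhedron. -/
def newtonDistInv {𝕜 : Type*} [RCLike 𝕜] (f : 𝕜 × 𝕜 → 𝕜) : ℝ :=
  sInf {t : ℝ | 0 ≤ t ∧ (t, t) ∈ newtonPolyhedron f}

/-- The Newton distance `δ_NP`. -/
def newtonDist {𝕜 : Type*} [RCLike 𝕜] (f : 𝕜 × 𝕜 → 𝕜) : ℝ :=
  (newtonDistInv f)⁻¹

/-- The face of the Newton polyhedron of slope `-1 / a`, that is, the set of points at which the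
linear form `p + a * q` attains its minimum over the Newton polyhedron. It is an edge when `a` is
the leading exponent of a root of `f`, and a vertex for every other `a > 0`. -/
def newtonFace {𝕜 : Type*} [RCLike 𝕜] (f : 𝕜 × 𝕜 → 𝕜) (a : ℝ) : Set (ℝ × ℝ) :=
  {v | v ∈ newtonPolyhedron f ∧ ∀ w ∈ newtonPolyhedron f, v.1 + a * v.2 ≤ w.1 + a * w.2}

/-- The main face: the face or vertex of the Newton polyhedron which meets the diagonal, that is,
its smallest face containing the diagonal boundary point `(δ_NP⁻¹, δ_NP⁻¹)`. A point `v` of a convex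
set lies in the smallest face containing `z` exactly if `z` lies in an open segment from `v` to
another point of the set, or `v = z` (the open segment from `z` to `z` is `{z}`). -/
def mainFace {𝕜 : Type*} [RCLike 𝕜] (f : 𝕜 × 𝕜 → 𝕜) : Set (ℝ × ℝ) :=
  {v | v ∈ newtonPolyhedron f ∧
    ∃ w ∈ newtonPolyhedron f, (newtonDistInv f, newtonDistInv f) ∈ openSegment ℝ v w}

/-! ### Roots -/

instance isAdicComplete_powerSeries {K : Type*} [Field K] :
    IsAdicComplete (IsLocalRing.maximalIdeal (PowerSeries K)) (PowerSeries K) := by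
  rw [PowerSeries.maximalIdeal_eq_span_X]
  infer_instance

/-- The exponent `α` of the largest power of `x` dividing the Taylor series of `f`. -/
def xOrder {𝕜 : Type*} [RCLike 𝕜] (f : 𝕜 × 𝕜 → 𝕜) : ℕ :=
  sInf {p : ℕ | ∃ q : ℕ, taylorCoeff f p q ≠ 0}

/-- The Taylor series of `f`, divided by `x ^ α`, as a power series in `y` over the ring of power
series in `x`. -/
def reducedTaylor {𝕜 : Type*} [RCLike 𝕜] (f : 𝕜 × 𝕜 → 𝕜) : PowerSeries (PowerSeries 𝕜) :=
  PowerSeries.mk fun q => PowerSeries.mk fun p => taylorCoeff f (p + xOrder f) q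

open Classical in
/-- The Weierstrass polynomial in `y` in the factorization `f = x ^ α * (unit) * W` given by the
Weierstrass preparation theorem; in the notation `f = (unit) * x ^ α * y ^ β * P` with
`P(x, 0) ≢ 0` it is `W = y ^ β * P`. The condition (that `f / x ^ α` does not vanish identically at
`x = 0`) holds whenever the Taylor series of `f` is non-zero, so the second branch only serves
`f ≡ 0`. -/
def weierstrassPoly {𝕜 : Type*} [RCLike 𝕜] (f : 𝕜 × 𝕜 → 𝕜) : Polynomial (PowerSeries 𝕜) :=
  if h : (reducedTaylor f).map (IsLocalRing.residue (PowerSeries 𝕜)) ≠ 0 then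
    (reducedTaylor f).weierstrassDistinguished h
  else 1

/-- The canonical embedding into `ℂ` of the field `𝕜`, which is `ℝ` or `ℂ`. -/
def toComplex (𝕜 : Type*) [RCLike 𝕜] : 𝕜 →+* ℂ where
  toFun z := ⟨RCLike.re z, RCLike.im z⟩
  map_one' := by apply Complex.ext <;> simp
  map_mul' z w := by apply Complex.ext <;> simp
  map_zero' := by apply Complex.ext <;> simp
  map_add' z w := by apply Complex.ext <;> simp

/-- Power series in `x` over `𝕜` as series with complex coefficients and rational exponents. -/
def toFractionalSeries (𝕜 : Type*) [RCLike 𝕜] : PowerSeries 𝕜 →+* HahnSeries ℚ ℂ :=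
  (HahnSeries.ofPowerSeries ℚ ℂ).comp (PowerSeries.map (toComplex 𝕜))

/-- The roots `y = φ(x)` of `f`, with multiplicity. By Newton and Puiseux, all roots of the
Weierstrass polynomial in the field of series in `x` with complex coefficients and rational
exponents are (convergent) Puiseux series, and they are as many as its degree. The root `0` is
listed `β` times; all the others are the `φ_ν` with `P(x, y) = ∏ (y - φ_ν(x))`. -/
def puiseuxRoots {𝕜 : Type*} [RCLike 𝕜] (f : 𝕜 × 𝕜 → 𝕜) : Multiset (HahnSeries ℚ ℂ) :=
  ((weierstrassPoly f).map (toFractionalSeries 𝕜)).roots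

open Classical in
/-- For `b ≠ 0`: the number, with multiplicity, of roots of the form `φ = b x ^ a + ⋯`. If `a = a_i`
is a leading exponent of `f` and `b = b_{iℓ}` a leading coefficient that occurs with it, this is the
number `m_{iℓ}`. For all other pairs it is zero. -/
def rootCount {𝕜 : Type*} [RCLike 𝕜] (f : 𝕜 × 𝕜 → 𝕜) (a : ℚ) (b : ℂ) : ℕ :=
  (puiseuxRoots f).countP fun φ => φ.order = a ∧ φ.leadingCoeff = b

/-! ### The critical integrability index -/

/-- The critical integrability index `c_0(f)`: the supremum of the `c > 0` such that `|f| ^ (-c)` is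
integrable on some ball about the origin. Haar measure on `𝕜 × 𝕜` is Lebesgue measure up to a
positive constant, which does not affect the finiteness of the integral. -/
def criticalIndex {𝕜 : Type*} [RCLike 𝕜] (f : 𝕜 × 𝕜 → 𝕜) : ℝ≥0∞ :=
  ⨆ c ∈ {c : ℝ | 0 < c ∧ ∃ ε > 0,
    ∫⁻ v in Metric.ball (0 : 𝕜 × 𝕜) ε, ‖f v‖ₑ ^ (-c) ∂MeasureTheory.Measure.addHaar < ∞},
    ENNReal.ofReal c

/-- The index `c_0(f)` is computed by the Newton distance of `g` (in the theorem, `g` is `f` written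
in other coordinates): `c_0(f) = 2 δ_NP(g)` over `ℂ`, and `c_0(f) = δ_NP(g)` over `ℝ`. -/
def IndexComputedBy {𝕜 : Type*} [RCLike 𝕜] (f g : 𝕜 × 𝕜 → 𝕜) : Prop :=
  criticalIndex f = ENNReal.ofReal (Module.finrank ℝ 𝕜 * newtonDist g)

/-- `f` in the coordinates `(x', y') = (x, y - Q(x))`. -/
def inShearY {𝕜 : Type*} [RCLike 𝕜] (Q : 𝕜 → 𝕜) (f : 𝕜 × 𝕜 → 𝕜) : 𝕜 × 𝕜 → 𝕜 :=
  fun v => f (v.1, v.2 + Q v.1)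

/-- `f` in the coordinates `(x', y') = (x - Q(y), y)`. -/
def inShearX {𝕜 : Type*} [RCLike 𝕜] (Q : 𝕜 → 𝕜) (f : 𝕜 × 𝕜 → 𝕜) : 𝕜 × 𝕜 → 𝕜 :=
  fun v => f (v.1 + Q v.2, v.2)

end

end PlaneGerm

/-! Write d for the inverse Newton distance and K for the real dimension of 𝕜. For a weight a > 0
let N be the minimum of i + a j over the monomials of f, and let P(X) = Σ a_{ij} X^j over i + a j =
N be the edge polynomial.

Roots and edges. Substitute y = X x^a in the Weierstrass polynomial and take the lowest coefficient
in x. This is multiplicative and sends y - φ to X - b when φ = b x^a + ⋯, so b is a root of P of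
multiplicity at least m (`pow_rootCount_dvd`). If a = p/q, then P = X^{B'} G(X^q) and b^q is a root
of G of multiplicity at least m. Hence the edge has height at least qm and width at least pm. If m >
d, its upper end lies above height d and its lower end to the right of abscissa d; since (d, d) is
not below the line, the edge crosses the diagonal in its relative interior. It is then the main
face, which is part 1. Also pm ≤ N = (1 + a) d, so p < 1 + p/q, which forces p = 1 or q = 1
(`edge_of_lt_multiplicity`).

The index. Testing on boxes gives c_0 ≤ K/d for every f (`criticalIndex_le`). Equality holds if some
supporting line of negative slope carries monomials with i ≤ d and with j ≤ d and if its edge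
polynomial has only nonzero roots of multiplicity at most d in 𝕜 (`indexComputedBy_self`). There
weighted dilations reduce the integral to one compact annulus, on which f is close to its edge part,
and a divided difference bounded below controls the sublevel sets.

The shear. Exchanging variables reduces to q = 1, and over ℝ a non-real root is impossible, since
its conjugate would make the edge too long. The function f(x, x^p (b + y)) is x^N g, and the
implicit function theorem gives a shear killing all terms of degree M - 1 in y, where M is the
multiplicity of b. If the sheared function still has a root of too large multiplicity, its edge has
an integral exponent larger than p and degree at most M, and the missing terms exclude multiplicity
M. So the multiplicity drops, and induction on it ends the proof (`exists_shear_indexComputedBy`).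
-/

namespace PlaneGerm

/-! ### Convergent double series and Taylor coefficients -/

section DoubleSeries

variable {𝕜 : Type*} [RCLike 𝕜]

/-- `f` is given near the origin by the absolutely convergent double series with coefficients
`A i j`. -/
def HasDoubleSeriesOn (f : 𝕜 × 𝕜 → 𝕜) (A : ℕ → ℕ → 𝕜) (ρ C : ℝ) : Prop :=
  (∀ i j, ‖A i j‖ * ρ ^ (i + j) ≤ C) ∧ ∀ x y, ‖x‖ < ρ → ‖y‖ < ρ →
    HasSum (fun p : ℕ × ℕ => A p.1 p.2 * x ^ p.1 * y ^ p.2) (f (x, y))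

/-- `f` is given by a convergent double series on some neighbourhood of the origin. -/
def HasDoubleSeries (f : 𝕜 × 𝕜 → 𝕜) (A : ℕ → ℕ → 𝕜) : Prop :=
  ∃ ρ > 0, ∃ C, HasDoubleSeriesOn f A ρ C

theorem summable_double_geometric {r s : ℝ} (hr : 0 ≤ r) (hr1 : r < 1) (hs : 0 ≤ s) (hs1 : s < 1) :
    Summable fun p : ℕ × ℕ => r ^ p.1 * s ^ p.2 :=
  (summable_geometric_of_lt_one hr hr1).mul_of_nonneg (summable_geometric_of_lt_one hs hs1)
    (fun _ => pow_nonneg hr _) (fun _ => pow_nonneg hs _)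

theorem norm_term_le {A : ℕ → ℕ → 𝕜} {ρ C : ℝ} (hρ : 0 < ρ)
    (hA : ∀ i j, ‖A i j‖ * ρ ^ (i + j) ≤ C) {x y : 𝕜} {r s : ℝ} (hx : ‖x‖ ≤ r) (hy : ‖y‖ ≤ s)
    (i j : ℕ) : ‖A i j * x ^ i * y ^ j‖ ≤ C * ((r / ρ) ^ i * (s / ρ) ^ j) := by
  have h1 : ‖A i j‖ ≤ C / ρ ^ (i + j) := by
    rw [le_div_iff₀ (by positivity)]; exact hA i j
  have hr : 0 ≤ r := (norm_nonneg x).trans hx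
  have hs : 0 ≤ s := (norm_nonneg y).trans hy
  have hC : 0 ≤ C := le_trans (by positivity) (hA 0 0)
  calc ‖A i j * x ^ i * y ^ j‖ = ‖A i j‖ * ‖x‖ ^ i * ‖y‖ ^ j := by simp
    _ ≤ C / ρ ^ (i + j) * r ^ i * s ^ j := by gcongr
    _ = _ := by rw [div_pow, div_pow, pow_add]; field_simp

theorem summable_of_bound {A : ℕ → ℕ → 𝕜} {ρ C : ℝ} (hρ : 0 < ρ)
    (hA : ∀ i j, ‖A i j‖ * ρ ^ (i + j) ≤ C) {x y : 𝕜} (hx : ‖x‖ < ρ) (hy : ‖y‖ < ρ) :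
    Summable fun p : ℕ × ℕ => A p.1 p.2 * x ^ p.1 * y ^ p.2 := by
  refine Summable.of_norm_bounded (g := fun p : ℕ × ℕ => C * ((‖x‖ / ρ) ^ p.1 * (‖y‖ / ρ) ^ p.2))
    ((summable_double_geometric (by positivity) ((div_lt_one hρ).2 hx) (by positivity)
      ((div_lt_one hρ).2 hy)).mul_left _) fun p => norm_term_le hρ hA le_rfl le_rfl _ _

theorem HasDoubleSeriesOn.mono {f : 𝕜 × 𝕜 → 𝕜} {A : ℕ → ℕ → 𝕜} {ρ ρ' C : ℝ}
    (h : HasDoubleSeriesOn f A ρ C) (h0 : 0 ≤ ρ') (hle : ρ' ≤ ρ) : HasDoubleSeriesOn f A ρ' C :=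
  ⟨fun i j => le_trans (by gcongr) (h.1 i j),
    fun x y hx hy => h.2 x y (hx.trans_le hle) (hy.trans_le hle)⟩

theorem HasDoubleSeries.swap {f : 𝕜 × 𝕜 → 𝕜} {A : ℕ → ℕ → 𝕜} (h : HasDoubleSeries f A) :
    HasDoubleSeries (fun v => f (v.2, v.1)) (fun i j => A j i) := by
  obtain ⟨ρ, hρ, C, hA, hs⟩ := h
  refine ⟨ρ, hρ, C, fun i j => by rw [add_comm]; exact hA j i, fun x y hx hy => ?_⟩
  have := (Equiv.prodComm ℕ ℕ).hasSum_iff.2 (hs y x hy hx)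
  refine this.congr_fun ?_
  intro p
  simp only [Function.comp, Equiv.prodComm_apply, Prod.fst_swap, Prod.snd_swap]
  ring

/-- The sum of the values of the multilinear map `p n` at the vectors with `i` entries `(1, 0)` and
`n - i` entries `(0, 1)`. -/
noncomputable def mixedCoeff (p : FormalMultilinearSeries 𝕜 (𝕜 × 𝕜) 𝕜) (n i : ℕ) : 𝕜 :=
  ∑ s ∈ Finset.powersetCard i (Finset.univ : Finset (Fin n)),
    p n (s.piecewise (fun _ => ((1, 0) : 𝕜 × 𝕜)) (fun _ => (0, 1)))

theorem apply_eq_sum_mixedCoeff (p : FormalMultilinearSeries 𝕜 (𝕜 × 𝕜) 𝕜) (n : ℕ) (x y : 𝕜) :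
    p n (fun _ => (x, y)) =
      ∑ i ∈ Finset.range (n + 1), mixedCoeff p n i * x ^ i * y ^ (n - i) := by
  have h0 : (fun _ : Fin n => ((x, y) : 𝕜 × 𝕜)) = (fun _ => (x, 0)) + fun _ => (0, y) := by
    ext <;> simp
  rw [h0, ContinuousMultilinearMap.map_add_univ, ← Finset.powerset_univ, Finset.sum_powerset]
  simp only [Finset.card_univ, Fintype.card_fin]
  refine Finset.sum_congr rfl fun i _ => ?_
  rw [mixedCoeff, Finset.sum_mul, Finset.sum_mul]
  refine Finset.sum_congr rfl fun s hs => ?_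
  have hc : s.card = i := (Finset.mem_powersetCard.1 hs).2
  have h1 : (s.piecewise (fun _ : Fin n => ((x, 0) : 𝕜 × 𝕜)) fun _ => (0, y)) =
      fun k => (s.piecewise (fun _ => x) (fun _ => y) k) •
        (s.piecewise (fun _ : Fin n => ((1, 0) : 𝕜 × 𝕜)) fun _ => (0, 1)) k := by
    ext k <;> by_cases hk : k ∈ s <;> simp [hk]
  rw [h1, ContinuousMultilinearMap.map_smul_univ, smul_eq_mul, Finset.prod_piecewise]
  simp only [Finset.univ_inter, Finset.prod_const, hc]
  rw [Finset.card_sdiff_of_subset (Finset.subset_univ _), hc]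
  simp only [Finset.card_univ, Fintype.card_fin]
  ring

theorem norm_mixedCoeff_le (p : FormalMultilinearSeries 𝕜 (𝕜 × 𝕜) 𝕜) (n i : ℕ) :
    ‖mixedCoeff p n i‖ ≤ 2 ^ n * ‖p n‖ := by
  have h1 : ∀ s : Finset (Fin n),
      ‖p n (s.piecewise (fun _ => ((1, 0) : 𝕜 × 𝕜)) (fun _ => (0, 1)))‖ ≤ ‖p n‖ := by
    intro s
    refine (ContinuousMultilinearMap.le_opNorm _ _).trans ?_
    have : ∏ k, ‖s.piecewise (fun _ => ((1, 0) : 𝕜 × 𝕜)) (fun _ => (0, 1)) k‖ = 1 := by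
      refine Finset.prod_eq_one fun k _ => ?_
      by_cases hk : k ∈ s <;> simp [hk, Prod.norm_def]
    rw [this, mul_one]
  refine (norm_sum_le _ _).trans ((Finset.sum_le_sum fun s _ => h1 s).trans ?_)
  rw [Finset.sum_const, nsmul_eq_mul]
  gcongr
  have := Finset.card_le_card (Finset.subset_univ (Finset.powersetCard i (Finset.univ : Finset (Fin n))))
  rw [Finset.card_univ, Fintype.card_finset, Fintype.card_fin] at this
  exact_mod_cast this

/-- The homogeneous parts are expanded multilinearly over subsets of the arguments. There are at
most 2^n subsets in degree n, which halving the radius absorbs. -/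
theorem exists_hasDoubleSeries {f : 𝕜 × 𝕜 → 𝕜} (hf : AnalyticAt 𝕜 f 0) :
    ∃ A, HasDoubleSeries f A := by
  obtain ⟨p, r, hp⟩ := hf
  obtain ⟨R, hR0, hR⟩ := ENNReal.lt_iff_exists_nnreal_btwn.1 hp.r_pos
  have hR0' : 0 < (R : ℝ) := by exact_mod_cast hR0
  obtain ⟨C, hC, hb⟩ := p.norm_mul_pow_le_of_lt_radius (hR.trans_le hp.r_le)
  have hA : ∀ i j, ‖mixedCoeff p (i + j) i‖ * ((R : ℝ) / 2) ^ (i + j) ≤ C := by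
    intro i j
    calc ‖mixedCoeff p (i + j) i‖ * ((R : ℝ) / 2) ^ (i + j)
        ≤ (2 ^ (i + j) * ‖p (i + j)‖) * ((R : ℝ) / 2) ^ (i + j) := by
          gcongr; exact norm_mixedCoeff_le _ _ _
      _ = ‖p (i + j)‖ * R ^ (i + j) := by rw [div_pow]; field_simp
      _ ≤ C := hb _
  refine ⟨fun i j => mixedCoeff p (i + j) i, R / 2, by positivity, C, hA, fun x y hx hy => ?_⟩
  have hsum := summable_of_bound (by positivity) hA hx hy
  have h1 := hsum.hasSum
  rw [← Finset.HasAntidiagonal.sigmaAntidiagonalEquivProd.hasSum_iff] at h1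
  have h2 := h1.sigma (fun n => hasSum_fintype _)
  have h3 : HasSum (fun n => p n fun _ => (x, y)) (f (x, y)) := by
    have hm : ((x, y) : 𝕜 × 𝕜) ∈ Metric.eball (0 : 𝕜 × 𝕜) r := by
      rw [Metric.mem_eball, edist_zero_right]
      refine lt_of_le_of_lt ?_ hR
      rw [enorm_le_coe, ← NNReal.coe_le_coe, coe_nnnorm, Prod.norm_def]
      exact max_le (by dsimp only; linarith) (by dsimp only; linarith)
    simpa using hp.hasSum hm
  have h4 : (fun n => p n fun _ => (x, y)) = fun n => ∑ c : Finset.HasAntidiagonal.antidiagonal n,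
      ((fun q : ℕ × ℕ => mixedCoeff p (q.1 + q.2) q.1 * x ^ q.1 * y ^ q.2) ∘
        Finset.HasAntidiagonal.sigmaAntidiagonalEquivProd) ⟨n, c⟩ := by
    funext n
    rw [apply_eq_sum_mixedCoeff]
    refine Eq.trans ?_ (Finset.sum_coe_sort (Finset.HasAntidiagonal.antidiagonal n)
      (fun q : ℕ × ℕ => mixedCoeff p (q.1 + q.2) q.1 * x ^ q.1 * y ^ q.2)).symm
    rw [Finset.Nat.sum_antidiagonal_eq_sum_range_succ_mk]
    refine Finset.sum_congr rfl fun i hi => ?_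
    have : i + (n - i) = n := by have := Finset.mem_range.1 hi; omega
    rw [this]
  rw [h4] at h3
  rw [h3.unique h2]
  exact hsum.hasSum

/-- The homogeneous polynomial of degree `n` with coefficients `A i (n - i)` as a multilinear
map. -/
noncomputable def doubleSeries (A : ℕ → ℕ → 𝕜) : FormalMultilinearSeries 𝕜 (𝕜 × 𝕜) 𝕜 := fun n =>
  ∑ i ∈ Finset.range (n + 1), A i (n - i) •
    (ContinuousMultilinearMap.mkPiAlgebraFin 𝕜 n 𝕜).compContinuousLinearMap fun k =>
      if (k : ℕ) < i then ContinuousLinearMap.fst 𝕜 𝕜 𝕜 else ContinuousLinearMap.snd 𝕜 𝕜 𝕜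

theorem doubleSeries_apply (A : ℕ → ℕ → 𝕜) (n : ℕ) (x y : 𝕜) :
    doubleSeries A n (fun _ => (x, y)) =
      ∑ i ∈ Finset.range (n + 1), A i (n - i) * x ^ i * y ^ (n - i) := by
  simp only [doubleSeries, _root_.sum_apply, _root_.smul_apply,
    ContinuousMultilinearMap.compContinuousLinearMap_apply,
    ContinuousMultilinearMap.mkPiAlgebraFin_apply, smul_eq_mul]
  refine Finset.sum_congr rfl fun i hi => ?_
  have hi' : i ≤ n := by have := Finset.mem_range.1 hi; omega
  rw [mul_assoc]
  congr 1
  rw [List.prod_ofFn]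
  have h1 : ∀ k : Fin n, (if (k : ℕ) < i then ContinuousLinearMap.fst 𝕜 𝕜 𝕜
      else ContinuousLinearMap.snd 𝕜 𝕜 𝕜) (x, y) = (fun k : ℕ => if k < i then x else y) k := by
    intro k; dsimp only; split_ifs <;> simp
  rw [Finset.prod_congr rfl fun k _ => h1 k, Fin.prod_univ_eq_prod_range
    (fun k : ℕ => if k < i then x else y) n]
  obtain ⟨m, rfl⟩ := Nat.exists_eq_add_of_le hi'
  rw [Finset.prod_range_add]
  congr 1
  · rw [Finset.prod_congr rfl fun k hk => if_pos (Finset.mem_range.1 hk)]; simp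
  · rw [Finset.prod_congr rfl fun k hk => if_neg (by omega)]; simp

theorem norm_doubleSeries_le (A : ℕ → ℕ → 𝕜) (n : ℕ) :
    ‖doubleSeries A n‖ ≤ ∑ i ∈ Finset.range (n + 1), ‖A i (n - i)‖ := by
  refine (norm_sum_le _ _).trans (Finset.sum_le_sum fun i _ => ?_)
  refine (norm_smul (A i (n - i)) _).le.trans ?_
  refine mul_le_of_le_one_right (norm_nonneg _) ?_
  refine (ContinuousMultilinearMap.norm_compContinuousLinearMap_le _ _).trans ?_
  rw [ContinuousMultilinearMap.norm_mkPiAlgebraFin, one_mul]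
  refine Finset.prod_le_one (fun _ _ => norm_nonneg _) fun k _ => ?_
  split_ifs
  · exact ContinuousLinearMap.norm_fst_le ..
  · exact ContinuousLinearMap.norm_snd_le ..

theorem HasDoubleSeries.analyticAt {f : 𝕜 × 𝕜 → 𝕜} {A : ℕ → ℕ → 𝕜} (h : HasDoubleSeries f A) :
    AnalyticAt 𝕜 f 0 := by
  obtain ⟨ρ, hρ, C, hA, hs⟩ := h
  have hC : 0 ≤ C := le_trans (by positivity) (hA 0 0)
  let R : NNReal := ⟨ρ / 2, by positivity⟩
  have hR : (R : ℝ) = ρ / 2 := rfl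
  refine ⟨doubleSeries A, R, ⟨?_, ?_, ?_⟩⟩
  -- Degree n has n + 1 monomials, and n + 1 ≤ 2 * 2^n is paid for by the radius ρ / 2.
  · refine FormalMultilinearSeries.le_radius_of_bound _ (C * 2) fun n => ?_
    have h1 : ‖doubleSeries A n‖ * ρ ^ n ≤ (n + 1) * C := by
      calc ‖doubleSeries A n‖ * ρ ^ n
          ≤ (∑ i ∈ Finset.range (n + 1), ‖A i (n - i)‖) * ρ ^ n := by
            gcongr; exact norm_doubleSeries_le A n
        _ = ∑ i ∈ Finset.range (n + 1), ‖A i (n - i)‖ * ρ ^ (i + (n - i)) := by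
            rw [Finset.sum_mul]
            refine Finset.sum_congr rfl fun i hi => ?_
            have : i + (n - i) = n := by have := Finset.mem_range.1 hi; omega
            rw [this]
        _ ≤ ∑ i ∈ Finset.range (n + 1), C := Finset.sum_le_sum fun i _ => hA _ _
        _ = _ := by simp
    have h2 : ((n : ℝ) + 1) ≤ 2 * 2 ^ n := by
      have : n + 1 ≤ 2 ^ (n + 1) := (Nat.lt_two_pow_self (n := n + 1)).le
      have : ((n + 1 : ℕ) : ℝ) ≤ ((2 ^ (n + 1) : ℕ) : ℝ) := by exact_mod_cast this
      push_cast at this; rw [pow_succ] at this; linarith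
    rw [hR, div_pow, ← mul_div_assoc, div_le_iff₀ (by positivity)]
    nlinarith
  · have : 0 < R := by rw [← NNReal.coe_pos, hR]; positivity
    exact_mod_cast this
  · rintro ⟨x, y⟩ hxy
    have hn : ‖((x, y) : 𝕜 × 𝕜)‖ < ρ / 2 := by
      rw [Metric.mem_eball, edist_zero_right, enorm_lt_coe, ← NNReal.coe_lt_coe, coe_nnnorm] at hxy
      exact hxy
    rw [Prod.norm_def, max_lt_iff] at hn
    have h1 := hs x y (by dsimp only at hn; linarith) (by dsimp only at hn; linarith)
    rw [← Finset.HasAntidiagonal.sigmaAntidiagonalEquivProd.hasSum_iff] at h1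
    have h2 := h1.sigma (fun n => hasSum_fintype _)
    rw [zero_add]
    refine h2.congr_fun fun n => ?_
    rw [doubleSeries_apply]
    refine Eq.trans ?_ (Finset.sum_coe_sort (Finset.HasAntidiagonal.antidiagonal n)
      (fun q : ℕ × ℕ => A q.1 q.2 * x ^ q.1 * y ^ q.2)).symm
    rw [Finset.Nat.sum_antidiagonal_eq_sum_range_succ_mk]

theorem iteratedDeriv_of_hasSum {g : 𝕜 → 𝕜} {c : ℕ → 𝕜}
    (h : ∀ᶠ y in 𝓝 0, HasSum (fun n => c n * y ^ n) (g y)) (n : ℕ) :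
    iteratedDeriv n g 0 = n.factorial * c n := by
  have h1 : HasFPowerSeriesAt g (FormalMultilinearSeries.ofScalars 𝕜 c) 0 := by
    rw [hasFPowerSeriesAt_iff]
    filter_upwards [h] with y hy
    simp only [FormalMultilinearSeries.coeff_ofScalars, smul_eq_mul, zero_add]
    exact hy.congr_fun fun n => mul_comm _ _
  have h2 := h1.eq_formalMultilinearSeries h1.analyticAt.hasFPowerSeriesAt
  have h3 := congrArg (fun p => FormalMultilinearSeries.coeff p n) h2
  simp only [FormalMultilinearSeries.coeff_ofScalars] at h3
  have := Nat.factorial_ne_zero n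
  rw [h3, mul_div_cancel₀ _ (by exact_mod_cast this)]

theorem eventually_norm_lt {ρ : ℝ} (hρ : 0 < ρ) : ∀ᶠ x : 𝕜 in 𝓝 0, ‖x‖ < ρ := by
  filter_upwards [Metric.ball_mem_nhds (0 : 𝕜) hρ] with x hx
  simpa using hx

theorem HasDoubleSeriesOn.hasSum_rows {f : 𝕜 × 𝕜 → 𝕜} {A : ℕ → ℕ → 𝕜} {ρ C : ℝ}
    (h : HasDoubleSeriesOn f A ρ C) {x y : 𝕜} (hx : ‖x‖ < ρ) (hy : ‖y‖ < ρ) :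
    HasSum (fun j => (∑' i, A i j * x ^ i) * y ^ j) (f (x, y)) := by
  have hρ : 0 < ρ := (norm_nonneg x).trans_lt hx
  have h1 := (Equiv.prodComm ℕ ℕ).hasSum_iff.2 (h.2 x y hx hy)
  refine (h1.prod_fiberwise fun j => (h1.summable.prod_factor j).hasSum).congr_fun fun j => ?_
  rw [← tsum_mul_right]
  rfl

theorem HasDoubleSeriesOn.summable_row {f : 𝕜 × 𝕜 → 𝕜} {A : ℕ → ℕ → 𝕜} {ρ C : ℝ}
    (h : HasDoubleSeriesOn f A ρ C) {x : 𝕜} (hx : ‖x‖ < ρ) (j : ℕ) :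
    Summable fun i => A i j * x ^ i := by
  have hρ : 0 < ρ := (norm_nonneg x).trans_lt hx
  -- A nonzero auxiliary y allows the factor y ^ j to be divided out of the row.
  obtain ⟨y, hy0, hy⟩ := NormedField.exists_norm_lt 𝕜 hρ
  have h1 := (Equiv.prodComm ℕ ℕ).summable_iff.2 (h.2 x y hx hy).summable
  have h2 := h1.prod_factor j
  refine (h2.mul_right (y ^ j)⁻¹).congr fun i => ?_
  have : y ^ j ≠ 0 := pow_ne_zero _ (norm_pos_iff.1 hy0)
  simp only [Function.comp, Equiv.prodComm_apply, Prod.swap_prod_mk]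
  field_simp

/-- Uniqueness of the expansion. Taylor coefficients of transformed functions are afterwards found
by exhibiting any convergent double series. -/
theorem HasDoubleSeries.taylorCoeff_eq {f : 𝕜 × 𝕜 → 𝕜} {A : ℕ → ℕ → 𝕜} (h : HasDoubleSeries f A) :
    taylorCoeff f = A := by
  obtain ⟨ρ, hρ, C, h⟩ := h
  funext i j
  have h1 : ∀ x : 𝕜, ‖x‖ < ρ →
      iteratedDeriv j (fun y => f (x, y)) 0 = j.factorial * ∑' i, A i j * x ^ i := by
    intro x hx
    refine iteratedDeriv_of_hasSum (c := fun j => ∑' i, A i j * x ^ i) ?_ j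
    filter_upwards [eventually_norm_lt hρ] with y hy
    exact h.hasSum_rows hx hy
  have h2 : iteratedDeriv i (fun x => iteratedDeriv j (fun y => f (x, y)) 0) 0 =
      i.factorial * (j.factorial * A i j) := by
    refine iteratedDeriv_of_hasSum (c := fun i => j.factorial * A i j) ?_ i
    filter_upwards [eventually_norm_lt hρ] with x hx
    rw [h1 x hx]
    refine ((h.summable_row hx j).hasSum.mul_left _).congr_fun fun i => ?_
    ring
  rw [taylorCoeff, h2]
  have := Nat.factorial_ne_zero i
  have := Nat.factorial_ne_zero j
  field_simp

theorem hasDoubleSeries_taylorCoeff {f : 𝕜 × 𝕜 → 𝕜} (hf : AnalyticAt 𝕜 f 0) :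
    HasDoubleSeries f (taylorCoeff f) := by
  obtain ⟨A, hA⟩ := exists_hasDoubleSeries hf
  rwa [hA.taylorCoeff_eq]

theorem HasDoubleSeries.eventuallyEq {f g : 𝕜 × 𝕜 → 𝕜} {A : ℕ → ℕ → 𝕜} (h : HasDoubleSeries f A)
    (hg : ∀ᶠ v in 𝓝 0, g v = f v) : HasDoubleSeries g A := by
  obtain ⟨ρ, hρ, C, h⟩ := h
  obtain ⟨ε, hε, hε'⟩ := Metric.eventually_nhds_iff.1 hg
  refine ⟨min ρ ε, lt_min hρ hε, C, (h.mono (lt_min hρ hε).le (min_le_left _ _)).1,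
    fun x y hx hy => ?_⟩
  rw [hε' (y := (x, y))]
  · exact h.2 x y (hx.trans_le (min_le_left _ _)) (hy.trans_le (min_le_left _ _))
  · rw [dist_zero_right, Prod.norm_def]
    exact max_lt (hx.trans_le (min_le_right _ _)) (hy.trans_le (min_le_right _ _))

theorem taylorCoeff_swap {f : 𝕜 × 𝕜 → 𝕜} (hf : AnalyticAt 𝕜 f 0) (i j : ℕ) :
    taylorCoeff (fun v => f (v.2, v.1)) i j = taylorCoeff f j i := by
  rw [(hasDoubleSeries_taylorCoeff hf).swap.taylorCoeff_eq]

theorem taylorCoeff_zero_zero (f : 𝕜 × 𝕜 → 𝕜) : taylorCoeff f 0 0 = f 0 := by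
  simp [taylorCoeff]; rfl

end DoubleSeries

end PlaneGerm

namespace PlaneGerm

/-! ### The Newton polyhedron, its supporting lines and the main face -/

section NewtonPolyhedron

open scoped Pointwise

variable {𝕜 : Type*} [RCLike 𝕜] {f : 𝕜 × 𝕜 → 𝕜}

theorem mem_newtonPolyhedron_of_le {i j : ℕ} (h : taylorCoeff f i j ≠ 0) {v : ℝ × ℝ}
    (h1 : (i : ℝ) ≤ v.1) (h2 : (j : ℝ) ≤ v.2) : v ∈ newtonPolyhedron f :=
  subset_convexHull ℝ _ ⟨i, j, h, h1, h2⟩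

theorem mem_newtonPolyhedron {i j : ℕ} (h : taylorCoeff f i j ≠ 0) :
    ((i : ℝ), (j : ℝ)) ∈ newtonPolyhedron f :=
  mem_newtonPolyhedron_of_le h le_rfl le_rfl

theorem convex_newtonPolyhedron : Convex ℝ (newtonPolyhedron f) := convex_convexHull ℝ _

/-- Dickson's lemma: the minimal exponents form an antichain in ℕ × ℕ, hence a finite set.
Closedness and stability under increasing coordinates follow from this description. -/
theorem exists_finite_newtonPolyhedron_eq (f : 𝕜 × 𝕜 → 𝕜) :
    ∃ T : Set (ℝ × ℝ), T.Finite ∧ newtonPolyhedron f = convexHull ℝ T + Set.Ici 0 := by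
  let S : Set (ℕ × ℕ) := {s | taylorCoeff f s.1 s.2 ≠ 0}
  have hfin : {s | Minimal (· ∈ S) s}.Finite :=
    WellQuasiOrderedLE.finite_of_isAntichain (setOfPred_minimal_antichain _)
  refine ⟨(fun s : ℕ × ℕ => ((s.1 : ℝ), (s.2 : ℝ))) '' {s | Minimal (· ∈ S) s}, hfin.image _, ?_⟩
  have hI : Set.Ici (0 : ℝ × ℝ) = convexHull ℝ (Set.Ici 0) := (convex_Ici 0).convexHull_eq.symm
  conv_rhs => rw [hI, ← convexHull_add]
  rw [newtonPolyhedron]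
  congr 1
  ext v
  simp only [Set.mem_ofPred_eq, Set.mem_add, Set.mem_image, Set.mem_Ici]
  constructor
  · rintro ⟨p, q, hpq, hp, hq⟩
    obtain ⟨s, hs, hmin⟩ := exists_minimal_le_of_wellFoundedLT (· ∈ S) (p, q) hpq
    refine ⟨_, ⟨s, hmin, rfl⟩, v - ((s.1 : ℝ), (s.2 : ℝ)), ?_, by simp⟩
    have h1 : (s.1 : ℝ) ≤ p := by exact_mod_cast hs.1
    have h2 : (s.2 : ℝ) ≤ q := by exact_mod_cast hs.2
    refine ⟨?_, ?_⟩ <;> simp <;> linarith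
  · rintro ⟨_, ⟨s, hs, rfl⟩, w, hw, rfl⟩
    refine ⟨s.1, s.2, hs.1, ?_, ?_⟩
    · simpa using hw.1
    · simpa using hw.2

theorem isClosed_newtonPolyhedron : IsClosed (newtonPolyhedron f) := by
  obtain ⟨T, hT, h⟩ := exists_finite_newtonPolyhedron_eq f
  rw [h]
  exact isClosed_Ici.add_left_of_isCompact (hT.isCompact_convexHull ℝ)

theorem newtonPolyhedron_upward {v w : ℝ × ℝ} (hv : v ∈ newtonPolyhedron f) (h : v ≤ w) :
    w ∈ newtonPolyhedron f := by
  obtain ⟨T, hT, hN⟩ := exists_finite_newtonPolyhedron_eq f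
  rw [hN] at hv ⊢
  obtain ⟨t, ht, u, hu, rfl⟩ := hv
  refine ⟨t, ht, w - t, ?_, by simp⟩
  rw [Set.mem_Ici] at hu ⊢
  exact hu.trans (by rwa [le_sub_iff_add_le'])

theorem newtonPolyhedron_nonempty {i j : ℕ} (h : taylorCoeff f i j ≠ 0) :
    {t : ℝ | 0 ≤ t ∧ (t, t) ∈ newtonPolyhedron f}.Nonempty :=
  ⟨max i j, by positivity, mem_newtonPolyhedron_of_le h (le_max_left _ _) (le_max_right _ _)⟩

theorem diag_mem_newtonPolyhedron {i j : ℕ} (h : taylorCoeff f i j ≠ 0) :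
    0 ≤ newtonDistInv f ∧ (newtonDistInv f, newtonDistInv f) ∈ newtonPolyhedron f := by
  have hc : IsClosed {t : ℝ | 0 ≤ t ∧ (t, t) ∈ newtonPolyhedron f} :=
    (isClosed_le continuous_const continuous_id).inter
      (isClosed_newtonPolyhedron.preimage (by fun_prop : Continuous fun t : ℝ => (t, t)))
  exact hc.csInf_mem (newtonPolyhedron_nonempty h) ⟨0, fun _ ht => ht.1⟩

theorem newtonDistInv_le {t : ℝ} (h0 : 0 ≤ t) (h : (t, t) ∈ newtonPolyhedron f) :
    newtonDistInv f ≤ t :=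
  csInf_le ⟨0, fun _ ht => ht.1⟩ ⟨h0, h⟩

theorem newtonDistInv_nonneg (f : 𝕜 × 𝕜 → 𝕜) : 0 ≤ newtonDistInv f :=
  Real.sInf_nonneg fun _ ht => ht.1

theorem le_of_mem_newtonPolyhedron {α β N : ℝ} (hα : 0 ≤ α) (hβ : 0 ≤ β)
    (h : ∀ i j, taylorCoeff f i j ≠ 0 → N ≤ α * i + β * j) {v : ℝ × ℝ}
    (hv : v ∈ newtonPolyhedron f) : N ≤ α * v.1 + β * v.2 := by
  have hc : Convex ℝ {v : ℝ × ℝ | N ≤ α * v.1 + β * v.2} := by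
    intro x hx y hy a b ha hb hab
    simp only [Set.mem_ofPred_eq, Prod.fst_add, Prod.snd_add, Prod.smul_fst, Prod.smul_snd,
      smul_eq_mul] at *
    have : N = a * N + b * N := by rw [← add_mul, hab, one_mul]
    nlinarith [mul_le_mul_of_nonneg_left hx ha, mul_le_mul_of_nonneg_left hy hb]
  refine convexHull_min ?_ hc hv
  rintro w ⟨p, q, hpq, hp, hq⟩
  have := h p q hpq
  simp only [Set.mem_ofPred_eq]
  nlinarith [mul_le_mul_of_nonneg_left hp hα, mul_le_mul_of_nonneg_left hq hβ]

theorem le_newtonDistInv {α β N : ℝ} (hα : 0 ≤ α) (hβ : 0 ≤ β)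
    (h : ∀ i j, taylorCoeff f i j ≠ 0 → N ≤ α * i + β * j) {i j : ℕ} (hij : taylorCoeff f i j ≠ 0) :
    N ≤ (α + β) * newtonDistInv f := by
  have := le_of_mem_newtonPolyhedron hα hβ h (diag_mem_newtonPolyhedron hij).2
  dsimp only at this
  linarith

theorem newtonDistInv_pos (h0 : taylorCoeff f 0 0 = 0) {i j : ℕ} (hij : taylorCoeff f i j ≠ 0) :
    0 < newtonDistInv f := by
  have := le_newtonDistInv (f := f) (α := 1) (β := 1) (N := 1) one_pos.le one_pos.le ?_ hij
  · linarith
  · intro p q hpq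
    rw [one_mul, one_mul]
    have : 1 ≤ p + q := by
      by_contra hlt
      obtain ⟨rfl, rfl⟩ : p = 0 ∧ q = 0 := by omega
      exact hpq h0
    exact_mod_cast this

/-- A point of the Newton polyhedron on a supporting line lies beyond some monomial on that
line. -/
theorem exists_mem_face {α β γ δ N c : ℝ} {v : ℝ × ℝ} (hv : v ∈ newtonPolyhedron f)
    (hvN : α * v.1 + β * v.2 = N) (hvc : γ * v.1 + δ * v.2 ≤ c)
    (hmin : ∀ i j : ℕ, taylorCoeff f i j ≠ 0 → ∀ w : ℝ × ℝ, (i : ℝ) ≤ w.1 → (j : ℝ) ≤ w.2 →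
      N ≤ α * w.1 + β * w.2 ∧ (α * w.1 + β * w.2 = N → α * i + β * j = N ∧
        γ * i + δ * j ≤ γ * w.1 + δ * w.2)) :
    ∃ i j : ℕ, taylorCoeff f i j ≠ 0 ∧ α * i + β * j = N ∧ γ * i + δ * j ≤ c := by
  by_contra! H
  -- If no monomial works, this set contains every orthant generating the polyhedron. It is convex
  -- because a convex combination lies on the line only if every point of positive weight does.
  have hc : Convex ℝ {w : ℝ × ℝ | N ≤ α * w.1 + β * w.2 ∧
      (α * w.1 + β * w.2 = N → c < γ * w.1 + δ * w.2)} := by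
    intro x hx y hy a b ha hb hab
    simp only [Set.mem_ofPred_eq, Prod.fst_add, Prod.snd_add, Prod.smul_fst, Prod.smul_snd,
      smul_eq_mul] at *
    have hN : N = a * N + b * N := by rw [← add_mul, hab, one_mul]
    have e1 : α * (a * x.1 + b * y.1) + β * (a * x.2 + b * y.2) =
      a * (α * x.1 + β * x.2) + b * (α * y.1 + β * y.2) := by ring
    have e2 : γ * (a * x.1 + b * y.1) + δ * (a * x.2 + b * y.2) =
      a * (γ * x.1 + δ * x.2) + b * (γ * y.1 + δ * y.2) := by ring
    rw [e1, e2]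
    have i1 := mul_le_mul_of_nonneg_left hx.1 ha
    have i2 := mul_le_mul_of_nonneg_left hy.1 hb
    refine ⟨by linarith, fun he => ?_⟩
    have j1 : a * (α * x.1 + β * x.2) = a * N := by linarith
    have j2 : b * (α * y.1 + β * y.2) = b * N := by linarith
    have hcc : c = a * c + b * c := by rw [← add_mul, hab, one_mul]
    rcases ha.eq_or_lt with rfl | ha
    · have hb1 : b = 1 := by linarith
      subst hb1
      have := hy.2 (by linarith)
      linarith
    · have k1 := mul_lt_mul_of_pos_left (hx.2 (mul_left_cancel₀ ha.ne' j1)) ha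
      rcases hb.eq_or_lt with rfl | hb
      · linarith
      · have k2 := mul_lt_mul_of_pos_left (hy.2 (mul_left_cancel₀ hb.ne' j2)) hb
        linarith
  have := convexHull_min (s := {v : ℝ × ℝ | ∃ p q : ℕ, taylorCoeff f p q ≠ 0 ∧ (p : ℝ) ≤ v.1 ∧
    (q : ℝ) ≤ v.2}) ?_ hc hv
  · exact absurd (this.2 hvN) (not_lt.2 hvc)
  · rintro w ⟨p, q, hpq, hp, hq⟩
    obtain ⟨h1, h2⟩ := hmin p q hpq w hp hq
    exact ⟨h1, fun he => (H p q hpq (h2 he).1).trans_le (h2 he).2⟩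

/-- Hahn–Banach separates the polyhedron from the open quadrant below (d, d). Since the polyhedron
is stable under increasing coordinates, the separating form has nonnegative coefficients. -/
theorem exists_supporting_weight (h0 : taylorCoeff f 0 0 = 0) {i j : ℕ}
    (hij : taylorCoeff f i j ≠ 0) :
    ∃ α β : ℝ, 0 ≤ α ∧ 0 ≤ β ∧ α + β = 1 ∧
      ∀ i j, taylorCoeff f i j ≠ 0 → newtonDistInv f ≤ α * i + β * j := by
  set d := newtonDistInv f with hd
  have hdpos : 0 < d := newtonDistInv_pos h0 hij
  have hdmem := (diag_mem_newtonPolyhedron hij).2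
  have hdisj : Disjoint (Set.Iio d ×ˢ Set.Iio d) (newtonPolyhedron f) := by
    rw [Set.disjoint_left]
    rintro v ⟨hv1, hv2⟩ hv
    -- The infimum defining d runs over t ≥ 0 only, hence the maximum with 0 and the need for d > 0.
    have hm : max (max v.1 v.2) 0 < d := max_lt (max_lt hv1 hv2) hdpos
    refine absurd (newtonDistInv_le (f := f) (le_max_right (max v.1 v.2) 0)
      (newtonPolyhedron_upward hv ⟨?_, ?_⟩)) (not_le.2 hm)
    · exact (le_max_left _ _).trans (le_max_left _ _)
    · exact (le_max_right _ _).trans (le_max_left _ _)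
  obtain ⟨φ, u, h1, h2⟩ := geometric_hahn_banach_open ((convex_Iio d).prod (convex_Iio d))
    (isOpen_Iio.prod isOpen_Iio) convex_newtonPolyhedron hdisj
  set α := φ (1, 0)
  set β := φ (0, 1)
  have hφ : ∀ x y : ℝ, φ (x, y) = α * x + β * y := by
    intro x y
    have : ((x, y) : ℝ × ℝ) = x • (1, 0) + y • (0, 1) := by ext <;> simp
    rw [this, map_add, map_smul, map_smul, smul_eq_mul, smul_eq_mul, mul_comm, mul_comm y]
  have hle : (α + β) * d ≤ u := by
    refine le_of_forall_pos_lt_add fun ε hε => ?_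
    by_cases hs : α + β ≤ 0
    · have h3 := h1 (d - 1, d - 1) ⟨by simp, by simp⟩
      rw [hφ] at h3; nlinarith
    · push Not at hs
      have h3 := h1 (d - ε / (α + β), d - ε / (α + β))
        ⟨by simp only [Set.mem_Iio, sub_lt_self_iff]; positivity,
         by simp only [Set.mem_Iio, sub_lt_self_iff]; positivity⟩
      rw [hφ] at h3
      have : (α + β) * (ε / (α + β)) = ε := by field_simp
      nlinarith
  have hα : 0 ≤ α := by
    by_contra hlt
    push Not at hlt
    have hup : ∀ t : ℝ, 0 ≤ t → u ≤ α * (d + t) + β * d := fun t ht => by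
      rw [← hφ]; exact h2 _ (newtonPolyhedron_upward hdmem ⟨by change d ≤ d + t; linarith, le_rfl⟩)
    -- With α < 0, moving this far along the first axis brings the form below u, although the point
    -- stays in the polyhedron.
    have h3 := hup ((1 + |(α + β) * d - u|) / (-α)) (by have := neg_pos.2 hlt; positivity)
    have h4 : α * ((1 + |(α + β) * d - u|) / (-α)) = -(1 + |(α + β) * d - u|) := by
      have := hlt.ne
      field_simp
    nlinarith [le_abs_self ((α + β) * d - u)]
  have hβ : 0 ≤ β := by
    by_contra hlt
    push Not at hlt
    have hup : ∀ t : ℝ, 0 ≤ t → u ≤ α * d + β * (d + t) := fun t ht => by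
      rw [← hφ]; exact h2 _ (newtonPolyhedron_upward hdmem ⟨le_rfl, by change d ≤ d + t; linarith⟩)
    have h3 := hup ((1 + |(α + β) * d - u|) / (-β)) (by have := neg_pos.2 hlt; positivity)
    have h4 : β * ((1 + |(α + β) * d - u|) / (-β)) = -(1 + |(α + β) * d - u|) := by
      have := hlt.ne
      field_simp
    nlinarith [le_abs_self ((α + β) * d - u)]
  have hpos : 0 < α + β := by
    rcases (add_nonneg hα hβ).eq_or_lt with h | h
    · have ha : α = 0 := by linarith
      have hb : β = 0 := by linarith
      have h3 := h1 (d - 1, d - 1) ⟨by simp, by simp⟩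
      have h4 := h2 _ hdmem
      rw [hφ] at h3 h4
      rw [ha, hb] at h3 h4
      linarith
    · exact h
  refine ⟨α / (α + β), β / (α + β), by positivity, by positivity, by field_simp, fun i j hij => ?_⟩
  have h3 := h2 _ (mem_newtonPolyhedron hij)
  rw [hφ] at h3
  rw [div_mul_eq_mul_div, div_mul_eq_mul_div, ← add_div, le_div_iff₀ hpos]
  linarith

/-- Some supporting line of negative slope contains a monomial on or above the diagonal box and one
on or to the left of it. -/
theorem exists_main_weight (h0 : taylorCoeff f 0 0 = 0) {i j : ℕ} (hij : taylorCoeff f i j ≠ 0) :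
    ∃ a N : ℝ, 0 < a ∧ (∀ i j, taylorCoeff f i j ≠ 0 → N ≤ i + a * j) ∧
      (∃ A B : ℕ, taylorCoeff f A B ≠ 0 ∧ A + a * B = N ∧ (A : ℝ) ≤ newtonDistInv f) ∧
      (∃ A B : ℕ, taylorCoeff f A B ≠ 0 ∧ A + a * B = N ∧ (B : ℝ) ≤ newtonDistInv f) := by
  classical
  obtain ⟨α, β, hα, hβ, hab, h⟩ := exists_supporting_weight h0 hij
  set d := newtonDistInv f with hd
  have hdmem := (diag_mem_newtonPolyhedron hij).2
  rw [← hd] at hdmem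
  rcases hα.eq_or_lt with rfl | hα
  · obtain rfl : β = 1 := by linarith
    obtain ⟨A, B, hAB, hB, hA⟩ := exists_mem_face (f := f) (α := 0) (β := 1) (γ := 1) (δ := 0)
      (N := d) (c := d) hdmem (by simp) (by simp) (by
        intro p q hpq w hp hq
        have := h p q hpq
        refine ⟨by linarith, fun he => ⟨by linarith, by linarith⟩⟩)
    -- The supporting line is horizontal. It is tilted about the leftmost monomial (A₀, B) on it:
    -- with a = A₀ + 1, going up one row gains more than the at most A₀ that can be lost in the
    -- first coordinate.
    have hex : ∃ A, taylorCoeff f A B ≠ 0 := ⟨A, hAB⟩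
    have hle : Nat.find hex ≤ A := Nat.find_min' hex hAB
    have hle' : (Nat.find hex : ℝ) ≤ A := by exact_mod_cast hle
    have key : ∀ p q, taylorCoeff f p q ≠ 0 →
        (Nat.find hex : ℝ) + (Nat.find hex + 1) * B ≤ p + (Nat.find hex + 1) * q := by
      intro p q hpq
      have hBq : (B : ℝ) ≤ q := by have := h p q hpq; linarith
      have hBq' : B ≤ q := by exact_mod_cast hBq
      rcases hBq'.eq_or_lt with rfl | hlt
      · have : (Nat.find hex : ℝ) ≤ p := by exact_mod_cast Nat.find_min' hex hpq
        linarith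
      · have : (B : ℝ) + 1 ≤ q := by exact_mod_cast hlt
        have hp : (0 : ℝ) ≤ p := by positivity
        have hn : (0 : ℝ) ≤ Nat.find hex := by positivity
        nlinarith
    exact ⟨Nat.find hex + 1, Nat.find hex + (Nat.find hex + 1) * B, by positivity, key,
      ⟨Nat.find hex, B, Nat.find_spec hex, rfl, by linarith⟩,
      ⟨Nat.find hex, B, Nat.find_spec hex, rfl, by linarith⟩⟩
  rcases hβ.eq_or_lt with rfl | hβ
  · obtain rfl : α = 1 := by linarith
    obtain ⟨A, B, hAB, hA, hB⟩ := exists_mem_face (f := f) (α := 1) (β := 0) (γ := 0) (δ := 1)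
      (N := d) (c := d) hdmem (by simp) (by simp) (by
        intro p q hpq w hp hq
        have := h p q hpq
        refine ⟨by linarith, fun he => ⟨by linarith, by linarith⟩⟩)
    -- The vertical case: a = 1 / (B₀ + 1) makes a * B₀ at most 1, the gain from moving one column
    -- to the right.
    have hex : ∃ B, taylorCoeff f A B ≠ 0 := ⟨B, hAB⟩
    have hle : Nat.find hex ≤ B := Nat.find_min' hex hAB
    have hle' : (Nat.find hex : ℝ) ≤ B := by exact_mod_cast hle
    have hn : (0 : ℝ) ≤ Nat.find hex := by positivity
    have key : ∀ p q, taylorCoeff f p q ≠ 0 →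
        (A : ℝ) + (1 / ((Nat.find hex : ℝ) + 1)) * Nat.find hex ≤
          p + (1 / ((Nat.find hex : ℝ) + 1)) * q := by
      intro p q hpq
      have hBq : (A : ℝ) ≤ p := by have := h p q hpq; linarith
      have hBq' : A ≤ p := by exact_mod_cast hBq
      rcases hBq'.eq_or_lt with rfl | hlt
      · have : (Nat.find hex : ℝ) ≤ q := by exact_mod_cast Nat.find_min' hex hpq
        gcongr
      · have : (A : ℝ) + 1 ≤ p := by exact_mod_cast hlt
        have h1 : (1 / ((Nat.find hex : ℝ) + 1)) * Nat.find hex ≤ 1 := by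
          rw [div_mul_eq_mul_div, div_le_one (by positivity)]; linarith
        have h2 : 0 ≤ (1 / ((Nat.find hex : ℝ) + 1)) * q := by positivity
        linarith
    exact ⟨1 / ((Nat.find hex : ℝ) + 1), A + 1 / ((Nat.find hex : ℝ) + 1) * Nat.find hex,
      by positivity, key,
      ⟨A, Nat.find hex, Nat.find_spec hex, rfl, by linarith⟩,
      ⟨A, Nat.find hex, Nat.find_spec hex, rfl, by linarith⟩⟩
  have hmin : ∀ p q, taylorCoeff f p q ≠ 0 → (1 + β / α) * d ≤ p + β / α * q := by
    intro p q hpq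
    have h1 := h p q hpq
    have h2 : α * ((1 + β / α) * d) ≤ α * (p + β / α * q) := by
      have e1 : α * ((1 + β / α) * d) = d := by
        have : α * ((1 + β / α) * d) = (α + β) * d := by field_simp
        rw [this, hab, one_mul]
      have e2 : α * (p + β / α * q) = α * p + β * q := by field_simp
      rw [e1, e2]; exact h1
    exact le_of_mul_le_mul_left h2 hα
  have hapos : 0 < β / α := by positivity
  have hmin' : ∀ γ δ : ℝ, ∀ p q, taylorCoeff f p q ≠ 0 → ∀ w : ℝ × ℝ, (p : ℝ) ≤ w.1 →
      (q : ℝ) ≤ w.2 → (1 + β / α) * d ≤ 1 * w.1 + β / α * w.2 ∧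
      (1 * w.1 + β / α * w.2 = (1 + β / α) * d → 1 * p + β / α * q = (1 + β / α) * d ∧
        γ * p + δ * q ≤ γ * w.1 + δ * w.2) := by
    intro γ δ p q hpq w hp hq
    have h1 := hmin p q hpq
    have h2 := mul_le_mul_of_nonneg_left hq hapos.le
    refine ⟨by linarith, fun he => ?_⟩
    have e1 : w.1 = p := by linarith
    have e2 : w.2 = q := mul_left_cancel₀ hapos.ne' (by linarith)
    rw [e1, e2] at he ⊢
    exact ⟨he, le_rfl⟩
  refine ⟨β / α, (1 + β / α) * d, hapos, hmin, ?_, ?_⟩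
  · obtain ⟨A, B, hAB, h1, h2⟩ := exists_mem_face (γ := 1) (δ := 0) (c := d) hdmem
      (by ring) (by simp) (hmin' 1 0)
    exact ⟨A, B, hAB, by linarith, by linarith⟩
  · obtain ⟨A, B, hAB, h1, h2⟩ := exists_mem_face (γ := 0) (δ := 1) (c := d) hdmem
      (by ring) (by simp) (hmin' 0 1)
    exact ⟨A, B, hAB, by linarith, by linarith⟩

/-- If `(A, B)` and `(A', B')` are monomials on a common supporting line, on different sides of the
diagonal, then this line meets the diagonal at the boundary point of the Newton polyhedron. -/
theorem weight_eq_of_crossing {a N : ℝ} (ha : 0 < a)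
    (hmin : ∀ i j, taylorCoeff f i j ≠ 0 → N ≤ i + a * j) {A B A' B' : ℕ}
    (h1 : taylorCoeff f A B ≠ 0) (h2 : taylorCoeff f A' B' ≠ 0) (e1 : A + a * B = N)
    (e2 : A' + a * B' = N) (hA : A ≤ B) (hB : B' ≤ A') : N = (1 + a) * newtonDistInv f := by
  refine le_antisymm (le_newtonDistInv one_pos.le ha.le (by simpa using hmin) h1) ?_
  have hN : 0 ≤ N := by rw [← e1]; positivity
  have hmem : (N / (1 + a), N / (1 + a)) ∈ newtonPolyhedron f := by
    have hA' : (A : ℝ) ≤ B := by exact_mod_cast hA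
    have hB' : (B' : ℝ) ≤ A' := by exact_mod_cast hB
    set c : ℝ := N / (1 + a) with hc
    have hc' : (1 + a) * c = N := by rw [hc]; field_simp
    rcases hA'.eq_or_lt with he | hlt
    · have : c = A := by
        have : (1 + a) * c = (1 + a) * A := by rw [hc', ← e1, ← he]; ring
        exact mul_left_cancel₀ (by positivity) this
      have := mem_newtonPolyhedron h1
      rw [← he] at this
      rwa [‹c = A›]
    · refine convex_newtonPolyhedron.segment_subset (mem_newtonPolyhedron h1)
        (mem_newtonPolyhedron h2) ?_
      have hpos : 0 < (B : ℝ) - A + (A' - B') := by linarith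
      refine ⟨(A' - B') / ((B : ℝ) - A + (A' - B')), (B - A) / ((B : ℝ) - A + (A' - B')),
        div_nonneg (by linarith) hpos.le, div_nonneg (by linarith) hpos.le, ?_, ?_⟩
      · rw [← add_div, div_eq_one_iff_eq hpos.ne']; ring
      · have k1 : (1 + a) * ((A' - B') * A + (B - A) * A') = ((B : ℝ) - A + (A' - B')) * N := by
          have : N - A = a * B := by linarith
          have : N - A' = a * B' := by linarith
          rw [show (A : ℝ) = N - a * B by linarith, show (A' : ℝ) = N - a * B' by linarith]; ring
        have k2 : (1 + a) * ((A' - B') * B + (B - A) * B') = ((B : ℝ) - A + (A' - B')) * N := by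
          rw [show (A : ℝ) = N - a * B by linarith, show (A' : ℝ) = N - a * B' by linarith]; ring
        ext
        · simp only [Prod.smul_mk, smul_eq_mul, Prod.mk_add_mk, hc]
          field_simp
          linarith
        · simp only [Prod.smul_mk, smul_eq_mul, Prod.mk_add_mk, hc]
          field_simp
          linarith
  have := newtonDistInv_le (f := f) (by positivity) hmem
  rwa [le_div_iff₀ (by positivity), mul_comm] at this

/-- The diagonal point lies strictly between two points of the edge, so from any point of the edge
one can continue a little beyond it. Conversely a linear form that is minimal at an interior point
of a segment is minimal at its ends. -/
theorem newtonFace_eq_mainFace {a N : ℝ} (ha : 0 < a)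
    (hmin : ∀ i j, taylorCoeff f i j ≠ 0 → N ≤ i + a * j) {A B A' B' : ℕ}
    (h1 : taylorCoeff f A B ≠ 0) (h2 : taylorCoeff f A' B' ≠ 0) (e1 : A + a * B = N)
    (e2 : A' + a * B' = N) (hA : (A : ℝ) < newtonDistInv f) (hB : newtonDistInv f < B)
    (hA' : newtonDistInv f < A') (hB' : (B' : ℝ) < newtonDistInv f) :
    newtonFace f a = mainFace f := by
  have hN : N = (1 + a) * newtonDistInv f :=
    weight_eq_of_crossing ha hmin h1 h2 e1 e2 (by exact_mod_cast (hA.trans hB).le)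
      (by exact_mod_cast (hB'.trans hA').le)
  set d := newtonDistInv f with hd
  have hdmem := (diag_mem_newtonPolyhedron h1).2
  rw [← hd] at hdmem
  have hlow : ∀ w ∈ newtonPolyhedron f, N ≤ w.1 + a * w.2 := fun w hw => by
    have := le_of_mem_newtonPolyhedron one_pos.le ha.le (by simpa using hmin) hw
    linarith
  ext v
  constructor
  · rintro ⟨hv, hvmin⟩
    refine ⟨hv, ?_⟩
    have hvN : v.1 + a * v.2 = N := by
      refine le_antisymm ?_ (hlow v hv)
      have := hvmin _ hdmem
      dsimp only at this
      linarith
    -- the segment from `(A', B')` to `(A, B)` contains a neighbourhood of `(d, d)` in the line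
    have hseg : ∀ t : ℝ, (B' : ℝ) ≤ t → t ≤ B → (N - a * t, t) ∈ newtonPolyhedron f := by
      intro t ht ht'
      have hBB : 0 < (B : ℝ) - B' := by linarith
      refine convex_newtonPolyhedron.segment_subset (mem_newtonPolyhedron h1)
        (mem_newtonPolyhedron h2) ⟨(t - B') / (B - B'), (B - t) / (B - B'),
          div_nonneg (by linarith) hBB.le, div_nonneg (by linarith) hBB.le, ?_, ?_⟩
      · rw [← add_div, div_eq_one_iff_eq hBB.ne']; ring
      · rw [show (A : ℝ) = N - a * B by linarith, show (A' : ℝ) = N - a * B' by linarith]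
        ext
        · simp only [Prod.smul_mk, smul_eq_mul, Prod.mk_add_mk]
          field_simp
          ring
        · simp only [Prod.smul_mk, smul_eq_mul, Prod.mk_add_mk]
          field_simp
          ring
    -- The segment from v is prolonged beyond (d, d) by the factor ε, small enough for the second
    -- coordinate to stay between B' and B.
    obtain ⟨ε, hε, hεB, hεB'⟩ : ∃ ε : ℝ, 0 < ε ∧ ε * |d - v.2| ≤ B - d ∧ ε * |d - v.2| ≤ d - B' := by
      refine ⟨min (B - d) (d - B') / (|d - v.2| + 1), ?_, ?_, ?_⟩
      · have := lt_min (sub_pos.2 hB) (sub_pos.2 hB'); positivity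
      all_goals
        have h3 := (lt_min (sub_pos.2 hB) (sub_pos.2 hB')).le
        have h4 : min (B - d) (d - B') / (|d - v.2| + 1) * |d - v.2| ≤ min (B - d) (d - B') := by
          rw [div_mul_eq_mul_div, div_le_iff₀ (by positivity)]
          nlinarith [abs_nonneg (d - v.2)]
      · exact h4.trans (min_le_left _ _)
      · exact h4.trans (min_le_right _ _)
    have hεabs : -(ε * |d - v.2|) ≤ ε * (d - v.2) ∧ ε * (d - v.2) ≤ ε * |d - v.2| :=
      abs_le.1 (by rw [abs_mul, abs_of_pos hε])
    refine ⟨_, hseg (d + ε * (d - v.2)) (by linarith [hεabs.1]) (by linarith [hεabs.2]), ?_⟩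
    refine ⟨ε / (1 + ε), 1 / (1 + ε), by positivity, by positivity, by field_simp; ring, ?_⟩
    have hv1 : v.1 = N - a * v.2 := by linarith
    ext
    · simp only [Prod.smul_fst, smul_eq_mul, Prod.fst_add]
      rw [hv1, hN]
      field_simp
      ring
    · simp only [Prod.smul_snd, smul_eq_mul, Prod.snd_add]
      field_simp
      ring
  · rintro ⟨hv, w, hw, s, t, hs, ht, hst, he⟩
    refine ⟨hv, fun u hu => (le_of_mul_le_mul_left ?_ hs).trans (hlow u hu)⟩
    have g1 := congrArg Prod.fst he
    have g2 := congrArg Prod.snd he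
    simp only [Prod.smul_fst, smul_eq_mul, Prod.fst_add, Prod.smul_snd, Prod.snd_add] at g1 g2
    have hwN := mul_le_mul_of_nonneg_left (hlow w hw) ht.le
    have : s * N + t * N = N := by rw [← add_mul, hst, one_mul]
    have : s * (v.1 + a * v.2) + t * (w.1 + a * w.2) = N := by
      rw [hN, add_mul, one_mul]; linear_combination g1 + a * g2
    linarith

end NewtonPolyhedron

end PlaneGerm

namespace PlaneGerm

/-! ### Edge polynomials and the arithmetic of edges with a multiple root -/

section EdgePolynomial

open Polynomial

/-- The polynomial `∑ A i j * x ^ i * X ^ j`, the sum running over the points of the line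
`i + a * j = N`. -/
noncomputable def edgePoly {R : Type*} [Semiring R] (A : ℕ → ℕ → R) (a N : ℝ) (x : R) : R[X] :=
  open Classical in
  ∑ j ∈ Finset.range (⌊N / a⌋₊ + 1), monomial j
    -- The only candidate for the exponent of x is N - a * j; the test discards the j for which it
    -- is not a natural number.
    (if (⌊N - a * j⌋₊ : ℝ) + a * j = N then A ⌊N - a * j⌋₊ j * x ^ ⌊N - a * j⌋₊ else 0)

theorem coeff_edgePoly {R : Type*} [Semiring R] (A : ℕ → ℕ → R) {a N : ℝ} (ha : 0 < a) (x : R)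
    {i j : ℕ} (h : (i : ℝ) + a * j = N) : (edgePoly A a N x).coeff j = A i j * x ^ i := by
  have h1 : ⌊N - a * j⌋₊ = i := by
    rw [show N - a * j = i by linarith]; exact Nat.floor_natCast i
  have hi : (0 : ℝ) ≤ i := by positivity
  have h2 : j < ⌊N / a⌋₊ + 1 := by
    rw [Nat.lt_add_one_iff]
    refine Nat.le_floor ?_
    rw [le_div_iff₀ ha]
    linarith
  rw [edgePoly, finsetSum_coeff, Finset.sum_eq_single j]
  · rw [coeff_monomial, if_pos rfl, h1, if_pos h]
  · intro k _ hk
    rw [coeff_monomial, if_neg hk]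
  · intro hj
    exact absurd (Finset.mem_range.2 h2) hj

theorem exists_of_coeff_edgePoly_ne_zero {R : Type*} [Semiring R] {A : ℕ → ℕ → R} {a N : ℝ} {x : R}
    {j : ℕ} (h : (edgePoly A a N x).coeff j ≠ 0) :
    ∃ i : ℕ, (i : ℝ) + a * j = N ∧ A i j ≠ 0 := by
  classical
  rw [edgePoly, finsetSum_coeff] at h
  obtain ⟨k, hk, hne⟩ := Finset.exists_ne_zero_of_sum_ne_zero h
  rw [coeff_monomial] at hne
  split_ifs at hne with h1 h2
  · subst h1
    exact ⟨_, h2, fun h0 => hne (by rw [h0, zero_mul])⟩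
  · exact absurd rfl hne
  · exact absurd rfl hne

theorem edgePoly_ne_zero {R : Type*} [Semiring R] [NoZeroDivisors R] {A : ℕ → ℕ → R} {a N : ℝ}
    (ha : 0 < a) {x : R} (hx : x ≠ 0) {i j : ℕ} (h : (i : ℝ) + a * j = N) (hA : A i j ≠ 0) :
    edgePoly A a N x ≠ 0 := by
  intro h0
  have := coeff_edgePoly A ha x h
  rw [h0, coeff_zero] at this
  exact mul_ne_zero hA (pow_ne_zero _ hx) this.symm

section Expand

variable {K : Type*} [Field K]

/-- In characteristic zero X^q - b^q is separable for b ≠ 0. So b is at most a simple root of it,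
and the multiplicity of b must come from the power of X - b^q in G. -/
theorem pow_dvd_of_pow_dvd_expand [CharZero K] {G : K[X]} (hG : G ≠ 0) {q m : ℕ} (hq : 0 < q) {b : K}
    (hb : b ≠ 0) (h : (X - C b) ^ m ∣ expand K q G) : (X - C (b ^ q)) ^ m ∣ G := by
  classical
  obtain ⟨G₁, hG₁, hnd⟩ := exists_eq_pow_rootMultiplicity_mul_and_not_dvd G hG (b ^ q)
  have hE : expand K q G ≠ 0 := (expand_ne_zero hq).2 hG
  rw [← le_rootMultiplicity_iff hE] at h
  rw [← le_rootMultiplicity_iff hG]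
  set k := rootMultiplicity (b ^ q) G
  refine h.trans ?_
  have hE' : expand K q G = (X ^ q - C (b ^ q)) ^ k * expand K q G₁ := by
    conv_lhs => rw [hG₁]
    simp
  have hne := hE
  rw [hE'] at hne
  have h1 : rootMultiplicity b (expand K q G₁) = 0 := by
    rw [rootMultiplicity_eq_zero_iff]
    intro h
    rw [IsRoot, expand_eval, ← IsRoot, ← dvd_iff_isRoot] at h
    exact absurd h hnd
  have h2 : rootMultiplicity b (X ^ q - C (b ^ q)) ≤ 1 :=
    rootMultiplicity_le_one_of_separable
      (separable_X_pow_sub_C _ (by exact_mod_cast hq.ne') (pow_ne_zero _ hb)) b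
  rw [hE', rootMultiplicity_mul hne, h1, add_zero, ← count_roots, roots_pow, Multiset.count_nsmul,
    count_roots]
  exact (Nat.mul_le_mul_left k h2).trans_eq (mul_one k)

theorem exists_eq_X_pow_mul_expand {P : K[X]} {q : ℕ} (hq : 0 < q)
    (h : ∀ j, P.coeff j ≠ 0 → (q : ℤ) ∣ (j : ℤ) - P.natTrailingDegree) :
    ∃ G : K[X], P = X ^ P.natTrailingDegree * expand K q G := by
  obtain ⟨P₁, hP₁⟩ : X ^ P.natTrailingDegree ∣ P := by
    rw [X_pow_dvd_iff]
    exact fun j hj => coeff_eq_zero_of_lt_natTrailingDegree hj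
  refine ⟨contract q P₁, ?_⟩
  conv_lhs => rw [hP₁]
  congr 1
  ext n
  rw [coeff_expand hq]
  split_ifs with hn
  · rw [coeff_contract hq.ne', Nat.div_mul_cancel hn]
  · by_contra h0
    have h1 : P.coeff (n + P.natTrailingDegree) ≠ 0 := by
      have h2 : P.coeff (n + P.natTrailingDegree) =
          (P₁ * X ^ P.natTrailingDegree).coeff (n + P.natTrailingDegree) := by
        rw [mul_comm, ← hP₁]
      rwa [h2, coeff_mul_X_pow]
    have h2 := h _ h1
    push_cast at h2
    rw [add_sub_cancel_right] at h2
    exact hn (by exact_mod_cast h2)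

theorem pow_dvd_of_pow_dvd_X_pow_mul {P : K[X]} {k m : ℕ} {b : K} (hb : b ≠ 0)
    (h : (X - C b) ^ m ∣ X ^ k * P) : (X - C b) ^ m ∣ P := by
  refine IsCoprime.dvd_of_dvd_mul_left (IsCoprime.pow ?_) h
  have := isCoprime_X_sub_C_of_isUnit_sub (a := b) (b := 0) (by simpa using hb)
  simpa using this

theorem pow_dvd_reflect {G : K[X]} {c : K} (hc : c ≠ 0) {m : ℕ} (h : (X - C c) ^ m ∣ G) {n : ℕ}
    (hG : G ≠ 0) (hn : G.natDegree ≤ n) : (X - C c⁻¹) ^ m ∣ reflect n G := by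
  obtain ⟨H, rfl⟩ := h
  have hH : H ≠ 0 := right_ne_zero_of_mul hG
  have hdeg : ((X - C c) ^ m).natDegree = m := by simp
  have hd : ((X - C c) ^ m * H).natDegree = m + H.natDegree := by
    rw [natDegree_mul (left_ne_zero_of_mul hG) hH, hdeg]
  obtain ⟨r, rfl⟩ := Nat.exists_eq_add_of_le ((Nat.le_add_right m H.natDegree).trans (hd ▸ hn))
  rw [reflect_mul _ _ hdeg.le (by omega)]
  refine Dvd.dvd.mul_right ?_ _
  clear hn hd hdeg hG hH
  induction m with
  | zero => simp
  | succ m ih =>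
    rw [pow_succ, pow_succ, reflect_mul _ _ (by simp) (natDegree_X_sub_C c).le]
    refine mul_dvd_mul ih ?_
    have : reflect 1 (X - C c) = -C c * (X - C c⁻¹) := by
      rw [reflect_sub, reflect_C]
      have hX : reflect 1 (X : K[X]) = 1 := by simp
      rw [hX, mul_sub, neg_mul, neg_mul, ← C_mul, mul_inv_cancel₀ hc]
      simp; ring
    rw [this]
    exact dvd_mul_left _ _

end Expand

section Edge

variable {𝕜 : Type*} [RCLike 𝕜] {f : 𝕜 × 𝕜 → 𝕜} {K : Type*} [Field K] [CharZero K]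

theorem dvd_sub_of_line {p q : ℕ} (hq : 0 < q) (hpq : p.Coprime q) {N : ℝ} {i j i' j' : ℕ}
    (h : (i : ℝ) + (p / q : ℝ) * j = N) (h' : (i' : ℝ) + (p / q : ℝ) * j' = N) :
    (q : ℤ) ∣ (j : ℤ) - j' := by
  have hq' : (q : ℝ) ≠ 0 := by positivity
  have h1 : (q : ℝ) * (i' - i) = p * ((j : ℝ) - j') := by
    have : (i : ℝ) + (p / q : ℝ) * j = (i' : ℝ) + (p / q : ℝ) * j' := h.trans h'.symm
    field_simp at this
    linarith
  have h2 : (q : ℤ) * (i' - i) = p * ((j : ℤ) - j') := by exact_mod_cast h1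
  have h3 : (q : ℤ) ∣ p * ((j : ℤ) - j') := ⟨_, h2.symm⟩
  exact (Int.isCoprime_iff_gcd_eq_one.2 (by simpa [Int.gcd_natCast_natCast] using hpq.symm)
    : IsCoprime (q : ℤ) p).dvd_of_dvd_mul_left h3

/-- Lattice points on a line i + (p/q) j = N have ordinates differing by multiples of q, so P is a
polynomial in X^q up to a power of X. A root of multiplicity m then forces an edge of height at
least qm. -/
theorem exists_expand_of_line {p q : ℕ} (hq : 0 < q) (hpq : p.Coprime q) {N : ℝ} {P : K[X]}
    (hP0 : P ≠ 0) (hP : ∀ j, P.coeff j ≠ 0 → ∃ i : ℕ, (i : ℝ) + (p / q : ℝ) * j = N) {b : K}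
    (hb : b ≠ 0) {m : ℕ} (hdvd : (X - C b) ^ m ∣ P) :
    ∃ G : K[X], G ≠ 0 ∧ P = X ^ P.natTrailingDegree * expand K q G ∧ (X - C (b ^ q)) ^ m ∣ G ∧
      P.natDegree = P.natTrailingDegree + q * G.natDegree ∧ m ≤ G.natDegree := by
  obtain ⟨i', hi'⟩ := hP P.natTrailingDegree (by
    rw [← trailingCoeff]; exact trailingCoeff_nonzero_iff_nonzero.2 hP0)
  obtain ⟨G, hG⟩ := exists_eq_X_pow_mul_expand (P := P) hq fun j hj => by
    obtain ⟨i, hi⟩ := hP j hj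
    exact dvd_sub_of_line hq hpq hi hi'
  have hG0 : G ≠ 0 := by
    rintro rfl
    rw [map_zero, mul_zero] at hG
    exact hP0 hG
  have hd := hdvd
  rw [hG] at hd
  have hd' := pow_dvd_of_pow_dvd_expand hG0 hq hb (pow_dvd_of_pow_dvd_X_pow_mul hb hd)
  refine ⟨G, hG0, hG, hd', ?_, ?_⟩
  · conv_lhs => rw [hG]
    rw [natDegree_mul (pow_ne_zero _ X_ne_zero) ((expand_ne_zero hq).2 hG0), natDegree_X_pow,
      natDegree_expand, mul_comm]
  · have := natDegree_le_of_dvd hd' hG0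
    rwa [natDegree_pow, natDegree_X_sub_C, mul_one] at this

/-- If a non-zero root of an edge polynomial has multiplicity greater than `newtonDistInv f`, the
edge crosses the diagonal, and its slope or the inverse of its slope is an integer. -/
theorem edge_of_lt_multiplicity {a N : ℝ} (ha : 0 < a)
    (hmin : ∀ i j, taylorCoeff f i j ≠ 0 → N ≤ i + a * j) {P : K[X]} (hP0 : P ≠ 0)
    (hP : ∀ j, P.coeff j ≠ 0 → ∃ i : ℕ, (i : ℝ) + a * j = N ∧ taylorCoeff f i j ≠ 0) {b : K}
    (hb : b ≠ 0) {m : ℕ} (hdvd : (X - C b) ^ m ∣ P) (hm : newtonDistInv f < m) :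
    ∃ p q : ℕ, 0 < p ∧ 0 < q ∧ p.Coprime q ∧ a = p / q ∧ (p = 1 ∨ q = 1) ∧
      N = (1 + a) * newtonDistInv f ∧
      ∃ A A' : ℕ, taylorCoeff f A P.natDegree ≠ 0 ∧ A + a * P.natDegree = N ∧
        taylorCoeff f A' P.natTrailingDegree ≠ 0 ∧ A' + a * P.natTrailingDegree = N ∧
        (A : ℝ) < newtonDistInv f ∧ newtonDistInv f < P.natDegree ∧ newtonDistInv f < A' ∧
        (P.natTrailingDegree : ℝ) < newtonDistInv f := by
  set d := newtonDistInv f with hd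
  have hd0 : 0 ≤ d := newtonDistInv_nonneg f
  obtain ⟨A, eA, hA⟩ := hP P.natDegree (by simpa using hP0)
  obtain ⟨A', eA', hA'⟩ := hP P.natTrailingDegree (by
    rw [← trailingCoeff]; exact trailingCoeff_nonzero_iff_nonzero.2 hP0)
  set B := P.natDegree with hB
  set B' := P.natTrailingDegree with hB'
  have hm0 : 0 < m := by
    have : (0 : ℝ) < m := hd0.trans_lt hm
    exact_mod_cast this
  have hBB : B' < B := by
    obtain ⟨P₁, hP₁⟩ : X ^ B' ∣ P := by
      rw [X_pow_dvd_iff]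
      exact fun j hj => coeff_eq_zero_of_lt_natTrailingDegree hj
    have hP₁0 : P₁ ≠ 0 := by
      rintro rfl
      rw [mul_zero] at hP₁
      exact hP0 hP₁
    have hd := hdvd
    rw [hP₁] at hd
    have h1 := natDegree_le_of_dvd (pow_dvd_of_pow_dvd_X_pow_mul hb hd) hP₁0
    have h2 : B = B' + P₁.natDegree := by
      rw [hB]
      conv_lhs => rw [hP₁]
      rw [natDegree_mul (pow_ne_zero _ X_ne_zero) hP₁0, natDegree_X_pow]
    simp at h1
    omega
  have hBB' : (B' : ℝ) < B := by exact_mod_cast hBB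
  have hAA : (A' : ℝ) - A = a * (B - B') := by linarith
  have hAA' : A < A' := by
    have : (A : ℝ) < A' := by nlinarith
    exact_mod_cast this
  -- A nonzero root makes the edge nondegenerate, so the real weight a is the inverse slope between
  -- two lattice points, hence rational.
  let r : ℚ := ((A' - A : ℕ) : ℚ) / ((B - B' : ℕ) : ℚ)
  have hr : 0 < r := by
    have h1 : 0 < A' - A := by omega
    have h2 : 0 < B - B' := by omega
    positivity
  have har : a = (r : ℝ) := by
    simp only [r]
    push_cast [hBB.le, hAA'.le]
    rw [hAA, mul_div_cancel_right₀]
    linarith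
  obtain ⟨p, q, hp, hq, hpq, hapq⟩ : ∃ p q : ℕ, 0 < p ∧ 0 < q ∧ p.Coprime q ∧ a = p / q := by
    refine ⟨r.num.natAbs, r.den, ?_, r.den_pos, r.reduced, ?_⟩
    · have := Rat.num_pos.2 hr; omega
    · have h1 : ((r.num.natAbs : ℕ) : ℝ) = (r.num : ℝ) := by
        have : ((r.num.natAbs : ℕ) : ℤ) = r.num := by
          have := Rat.num_pos.2 hr; omega
        rw [← Int.cast_natCast, this]
      rw [har, h1, Rat.cast_def]
  have hq' : (0 : ℝ) < q := by exact_mod_cast hq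
  have hp' : (1 : ℝ) ≤ p := by exact_mod_cast hp
  have hq1 : (1 : ℝ) ≤ q := by exact_mod_cast hq
  obtain ⟨G, hG0, hG, hGd, hdeg, hmG⟩ := exists_expand_of_line hq hpq (N := N) hP0
    (fun j hj => by obtain ⟨i, hi, -⟩ := hP j hj; exact ⟨i, by rwa [← hapq]⟩) hb hdvd
  have hqm : (q : ℝ) * m ≤ B - B' := by
    have h1 : q * m ≤ q * G.natDegree := Nat.mul_le_mul_left q hmG
    have h2 : (B : ℝ) = B' + q * G.natDegree := by exact_mod_cast hdeg
    have h3 : (q : ℝ) * m ≤ q * G.natDegree := by exact_mod_cast h1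
    linarith
  have hpm : (p : ℝ) * m ≤ A' - A := by
    rw [hAA, hapq]
    calc (p : ℝ) * m = p / q * (q * m) := by field_simp
      _ ≤ _ := by gcongr
  have hB0 : (0 : ℝ) ≤ B' := by positivity
  have hA0 : (0 : ℝ) ≤ A := by positivity
  have hdB : d < B := by nlinarith
  have hdA' : d < A' := by nlinarith
  have hle : N ≤ (1 + a) * d := le_newtonDistInv one_pos.le ha.le (by simpa using hmin) hA
  -- Both ends satisfy i + a j = N ≤ (1 + a) d; since one coordinate exceeds d, the other is below
  -- d.
  have hAd : (A : ℝ) < d := by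
    by_contra! h
    nlinarith [mul_lt_mul_of_pos_left hdB ha]
  have hBd : (B' : ℝ) < d := by
    by_contra! h
    nlinarith [mul_le_mul_of_nonneg_left h ha.le]
  have hN : N = (1 + a) * d := weight_eq_of_crossing ha hmin hA hA' eA eA'
    (by exact_mod_cast (hAd.trans hdB).le) (by exact_mod_cast (hBd.trans hdA').le)
  refine ⟨p, q, hp, hq, hpq, hapq, ?_, hN, A, A', hA, eA, hA', eA', hAd, hdB, hdA', hBd⟩
  -- Here p m ≤ a B ≤ N = (1 + a) d. As d < m, this gives p < 1 + p/q, that is (p - 1)(q - 1) < 1.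
  have h1 : (p : ℝ) * m ≤ (1 + a) * d := by
    rw [← hN, ← eA, hapq]
    have : (p : ℝ) * m = p / q * (q * m) := by field_simp
    rw [this]
    have : (p : ℝ) / q * (q * m) ≤ p / q * B := by gcongr; linarith
    linarith
  have h2 : (p : ℝ) * d < (1 + a) * d := lt_of_lt_of_le (by nlinarith) h1
  have h3 : (p : ℝ) < 1 + a := lt_of_mul_lt_mul_right h2 hd0
  have h4 : (p : ℝ) * q < q + p := by
    rw [hapq] at h3
    have := mul_lt_mul_of_pos_right h3 hq'
    rw [add_mul, div_mul_cancel₀ _ hq'.ne'] at this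
    linarith
  have h5 : p * q < q + p := by exact_mod_cast h4
  by_contra! hne
  have h6 : 2 ≤ p := by omega
  have h7 : 2 ≤ q := by omega
  nlinarith

/-- Exchanging the variables inverts the roots of the edge polynomial of an edge of slope `-q`. -/
theorem pow_dvd_of_exchange {q : ℕ} (hq : 0 < q) {N N' : ℝ} (hN' : N' = q * N) {P P' : K[X]}
    (hP0 : P ≠ 0) (hP : ∀ j, P.coeff j ≠ 0 → ∃ i : ℕ, (i : ℝ) + (1 / q : ℝ) * j = N)
    (hP' : ∀ i, P'.coeff i ≠ 0 → ∃ j : ℕ, (j : ℝ) + (q : ℝ) * i = N')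
    (hPP : ∀ i j : ℕ, (i : ℝ) + (1 / q : ℝ) * j = N → P'.coeff i = P.coeff j) {b : K} (hb : b ≠ 0)
    {m : ℕ} (hdvd : (X - C b) ^ m ∣ P) : (X - C (b ^ q)⁻¹) ^ m ∣ P' := by
  have hq' : (0 : ℝ) < q := by exact_mod_cast hq
  obtain ⟨G, hG0, hG, hGd, hdeg, hmG⟩ := exists_expand_of_line (p := 1) hq (Nat.coprime_one_left q)
    (N := N) hP0 (by simpa using hP) hb hdvd
  set B' := P.natTrailingDegree with hB'
  obtain ⟨A', eA'⟩ := hP B' (by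
    rw [hB', ← trailingCoeff]; exact trailingCoeff_nonzero_iff_nonzero.2 hP0)
  obtain ⟨A, eA⟩ := hP P.natDegree (by simpa using hP0)
  have hGcoeff : ∀ k, P.coeff (B' + q * k) = G.coeff k := by
    intro k
    conv_lhs => rw [hG]
    rw [add_comm, mul_comm (X ^ B'), coeff_mul_X_pow, mul_comm, coeff_expand_mul hq]
  have hnA : G.natDegree ≤ A' := by
    rw [hdeg] at eA
    push_cast at eA
    have : (A' : ℝ) = A + G.natDegree := by
      field_simp at eA eA'
      have : (q : ℝ) * A' = q * (A + G.natDegree) := by linarith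
      exact mul_left_cancel₀ hq'.ne' this
    have : A' = A + G.natDegree := by exact_mod_cast this
    omega
  have hP'G : P' = reflect A' G := by
    ext i
    rw [coeff_reflect]
    rcases le_or_gt i A' with hi | hi
    · rw [revAt_le hi, ← hGcoeff]
      apply hPP
      push_cast [hi]
      rw [← eA']
      field_simp
      ring
    · rw [revAt_eq_self_of_lt hi, coeff_eq_zero_of_natDegree_lt (hnA.trans_lt hi)]
      by_contra h0
      obtain ⟨j, hj⟩ := hP' i h0
      have hj' : (i : ℝ) + (1 / q : ℝ) * j = N := by
        rw [hN'] at hj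
        field_simp
        linarith
      rw [hPP i j hj'] at h0
      have h1 : (B' : ℝ) ≤ j := by exact_mod_cast natTrailingDegree_le_of_ne_zero h0
      have h2 : (A' : ℝ) < i := by exact_mod_cast hi
      have h3 : (1 / q : ℝ) * B' ≤ 1 / q * j := by gcongr
      linarith
  rw [hP'G]
  exact pow_dvd_reflect (pow_ne_zero _ hb) hGd hG0 hnA

end Edge

end EdgePolynomial

end PlaneGerm

namespace PlaneGerm

/-! ### From Puiseux roots to roots of the edge polynomial -/

section PuiseuxRoots

open Polynomial

/-- The coefficientwise embedding of series over `R` into series over `R[X]`. -/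
noncomputable def constSeries (R : Type*) [CommRing R] : HahnSeries ℚ R →+* HahnSeries ℚ R[X] where
  toFun x := x.map (C : R →+* R[X])
  map_one' := HahnSeries.map_one (C : R →+* R[X]).toMonoidWithZeroHom
  map_mul' _ _ := HahnSeries.map_mul ((C : R →+* R[X]) : R →ₙ+* R[X])
  map_zero' := by ext; simp
  map_add' x y := by ext; simp

theorem coeff_constSeries {R : Type*} [CommRing R] (x : HahnSeries ℚ R) (e : ℚ) :
    (constSeries R x).coeff e = C (x.coeff e) := rfl

/-- The substitution `y = X * x ^ a` in polynomials in `y` over the field of series in `x`. -/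
noncomputable def substPow (R : Type*) [CommRing R] (a : ℚ) :
    (HahnSeries ℚ R)[X] →+* HahnSeries ℚ R[X] :=
  eval₂RingHom (constSeries R) (HahnSeries.single a X)

theorem coeff_substPow {R : Type*} [CommRing R] (a : ℚ) (P : (HahnSeries ℚ R)[X]) (e : ℚ) (j : ℕ) :
    ((substPow R a P).coeff e).coeff j = (P.coeff j).coeff (e - a * j) := by
  rw [substPow, coe_eval₂RingHom, eval₂_eq_sum_range]
  have h : ∀ k : ℕ, (constSeries R (P.coeff k) * HahnSeries.single a (X : R[X]) ^ k).coeff e =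
      C ((P.coeff k).coeff (e - a * k)) * X ^ k := by
    intro k
    rw [HahnSeries.single_pow, HahnSeries.coeff_mul_single, coeff_constSeries, nsmul_eq_mul,
      mul_comm a]
  have h2 : (∑ k ∈ Finset.range (P.natDegree + 1),
      constSeries R (P.coeff k) * HahnSeries.single a (X : R[X]) ^ k).coeff e =
      ∑ k ∈ Finset.range (P.natDegree + 1), C ((P.coeff k).coeff (e - a * k)) * X ^ k := by
    rw [HahnSeries.coeff_sum]
    exact Finset.sum_congr rfl fun k _ => h k
  rw [h2, finsetSum_coeff]
  simp only [coeff_C_mul, coeff_X_pow, mul_ite, mul_one, mul_zero]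
  rw [Finset.sum_ite_eq]
  split_ifs with hj
  · rfl
  · rw [coeff_eq_zero_of_natDegree_lt (by simpa using hj)]
    simp

theorem leadingCoeff_eq_coeff_of_forall_lt {R : Type*} [Zero R] {x : HahnSeries ℚ R} {e : ℚ}
    (he : x.coeff e ≠ 0) (h : ∀ g < e, x.coeff g = 0) : x.leadingCoeff = x.coeff e := by
  have hx : x ≠ 0 := HahnSeries.ne_zero_of_coeff_ne_zero he
  have : x.order = e := by
    refine le_antisymm (HahnSeries.order_le_of_coeff_ne_zero he) ?_
    by_contra! hlt
    exact hx (HahnSeries.coeff_order_eq_zero.1 (h _ hlt))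
  rw [HahnSeries.leadingCoeff_eq, this]

/-- After y = X x^a, the factor y - φ becomes (X - b) x^a plus terms of higher order in x. -/
theorem leadingCoeff_substPow_X_sub_C {a : ℚ} {φ : HahnSeries ℚ ℂ} {b : ℂ} (h : φ.order = a)
    (hb : φ.leadingCoeff = b) : (substPow ℂ a (X - C φ)).leadingCoeff = X - C b := by
  have hc : ∀ e, (substPow ℂ a (X - C φ)).coeff e =
      (HahnSeries.single a (X : ℂ[X])).coeff e - C (φ.coeff e) := by
    intro e
    simp [substPow, coeff_constSeries]
  have hφ : φ.coeff a = b := by rw [← h, ← HahnSeries.leadingCoeff_eq, hb]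
  have ha : (substPow ℂ a (X - C φ)).coeff a = X - C b := by
    rw [hc, HahnSeries.coeff_single_same, hφ]
  rw [leadingCoeff_eq_coeff_of_forall_lt (e := a), ha]
  · rw [ha]; exact X_sub_C_ne_zero b
  · intro g hg
    rw [hc, HahnSeries.coeff_single_of_ne hg.ne, HahnSeries.coeff_eq_zero_of_lt_order (h ▸ hg)]
    simp

theorem leadingCoeff_substPow_prod {a : ℚ} {b : ℂ} (s : Multiset (HahnSeries ℚ ℂ))
    (hs : ∀ φ ∈ s, φ.order = a ∧ φ.leadingCoeff = b) :
    (substPow ℂ a (s.map fun φ => X - C φ).prod).leadingCoeff = (X - C b) ^ s.card := by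
  induction s using Multiset.induction_on with
  | empty => simp
  | cons φ s ih =>
    rw [Multiset.map_cons, Multiset.prod_cons, map_mul, HahnSeries.leadingCoeff_mul,
      ih fun ψ hψ => hs ψ (Multiset.mem_cons_of_mem hψ), Multiset.card_cons, pow_succ',
      leadingCoeff_substPow_X_sub_C (hs φ (Multiset.mem_cons_self _ _)).1
        (hs φ (Multiset.mem_cons_self _ _)).2]

variable {𝕜 : Type*} [RCLike 𝕜]

theorem toComplex_injective : Function.Injective (toComplex 𝕜) := (toComplex 𝕜).injective

theorem coeff_toFractionalSeries_natCast (x : PowerSeries 𝕜) (n : ℕ) :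
    (toFractionalSeries 𝕜 x).coeff (n : ℚ) = toComplex 𝕜 (PowerSeries.coeff n x) := by
  rw [toFractionalSeries, RingHom.comp_apply, HahnSeries.ofPowerSeries_apply_coeff,
    PowerSeries.coeff_map]

theorem exists_of_coeff_toFractionalSeries_ne_zero {x : PowerSeries 𝕜} {e : ℚ}
    (h : (toFractionalSeries 𝕜 x).coeff e ≠ 0) : ∃ n : ℕ, (n : ℚ) = e := by
  by_contra! H
  refine h ?_
  rw [toFractionalSeries, RingHom.comp_apply, HahnSeries.ofPowerSeries_apply]
  refine HahnSeries.embDomain_of_notMem_range ?_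
  rintro ⟨n, hn⟩
  exact H n hn

/-- The coefficients of W below the leading one vanish at x = 0. If φ had order at most 0, every
lower term would have order strictly greater than that of φ^n, and nothing could cancel φ^n. -/
theorem order_pos_of_root {W : (PowerSeries 𝕜)[X]}
    (hW : W.IsDistinguishedAt (IsLocalRing.maximalIdeal (PowerSeries 𝕜))) {φ : HahnSeries ℚ ℂ}
    (hφ0 : φ ≠ 0) (hφ : (W.map (toFractionalSeries 𝕜)).IsRoot φ) : 0 < φ.order := by
  by_contra! hle
  set n := W.natDegree with hn
  rw [IsRoot, eval_map, eval₂_eq_sum_range, Finset.sum_range_succ, hW.monic.coeff_natDegree, map_one,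
    one_mul] at hφ
  have h1 := congrArg (fun x => HahnSeries.coeff x (φ ^ n).order) hφ
  simp only [HahnSeries.coeff_add, HahnSeries.coeff_zero] at h1
  have h2 : (∑ i ∈ Finset.range n, toFractionalSeries 𝕜 (W.coeff i) * φ ^ i).coeff (φ ^ n).order
      = 0 := by
    rw [HahnSeries.coeff_sum]
    refine Finset.sum_eq_zero fun i hi => ?_
    have hi' : i < n := Finset.mem_range.1 hi
    by_cases hc : toFractionalSeries 𝕜 (W.coeff i) = 0
    · rw [hc, zero_mul, HahnSeries.coeff_zero]
    refine HahnSeries.coeff_eq_zero_of_lt_order ?_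
    rw [HahnSeries.order_mul hc (pow_ne_zero _ hφ0), HahnSeries.order_pow, HahnSeries.order_pow,
      nsmul_eq_mul, nsmul_eq_mul]
    have hpos : 0 < (toFractionalSeries 𝕜 (W.coeff i)).order := by
      have hne : (toFractionalSeries 𝕜 (W.coeff i)).coeff
          (toFractionalSeries 𝕜 (W.coeff i)).order ≠ 0 :=
        fun h => hc (HahnSeries.coeff_order_eq_zero.1 h)
      obtain ⟨k, hk⟩ := exists_of_coeff_toFractionalSeries_ne_zero hne
      rw [← hk] at hne ⊢
      rw [coeff_toFractionalSeries_natCast] at hne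
      have hk0 : k ≠ 0 := by
        rintro rfl
        have hmem := hW.mem (n := i) (by simpa [hn] using hi')
        rw [PowerSeries.maximalIdeal_eq_span_X, Ideal.mem_span_singleton, PowerSeries.X_dvd_iff,
          ← PowerSeries.coeff_zero_eq_constantCoeff_apply] at hmem
        rw [hmem, map_zero] at hne
        exact hne rfl
      exact_mod_cast Nat.pos_of_ne_zero hk0
    have : (i : ℚ) ≤ n := by exact_mod_cast hi'.le
    nlinarith
  rw [h2, zero_add] at h1
  exact pow_ne_zero n hφ0 (HahnSeries.coeff_order_eq_zero.1 h1)

variable {f : 𝕜 × 𝕜 → 𝕜}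

theorem taylorCoeff_eq_zero_of_lt_xOrder {p q : ℕ} (h : p < xOrder f) : taylorCoeff f p q = 0 := by
  by_contra h0
  exact absurd (Nat.sInf_le (s := {p : ℕ | ∃ q : ℕ, taylorCoeff f p q ≠ 0}) ⟨q, h0⟩) (not_le.2 h)

/-- A leading term `b * x ^ a` of `rootCount f a b` Puiseux roots yields a root `b` of the edge
polynomial, with at least this multiplicity. -/
theorem pow_rootCount_dvd {a : ℚ} {b : ℂ} (hb : b ≠ 0) (hm : 0 < rootCount f a b) :
    0 < a ∧ ∃ N : ℝ, (∀ i j, taylorCoeff f i j ≠ 0 → N ≤ i + (a : ℝ) * j) ∧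
      (∃ i j : ℕ, (i : ℝ) + (a : ℝ) * j = N ∧ taylorCoeff f i j ≠ 0) ∧
      (X - C b) ^ rootCount f a b ∣
        (edgePoly (taylorCoeff f) (a : ℝ) N 1).map (toComplex 𝕜) := by
  classical
  set m := rootCount f a b with hmdef
  set W := weierstrassPoly f with hWdef
  -- Otherwise `weierstrassPoly` has its default value 1, which has no roots.
  have hres : (reducedTaylor f).map (IsLocalRing.residue (PowerSeries 𝕜)) ≠ 0 := by
    intro h0
    have hW1 : W = 1 := by rw [hWdef, weierstrassPoly, dif_neg (by simpa using h0)]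
    rw [hmdef, rootCount, puiseuxRoots, ← hWdef, hW1] at hm
    simp at hm
  have hWeq : W = (reducedTaylor f).weierstrassDistinguished hres := by
    rw [hWdef, weierstrassPoly, dif_pos hres]
  set U := (reducedTaylor f).weierstrassUnit hres with hU
  have hdist : W.IsDistinguishedAt (IsLocalRing.maximalIdeal (PowerSeries 𝕜)) := by
    rw [hWeq]; exact PowerSeries.isDistinguishedAt_weierstrassDistinguished hres
  have hfac : reducedTaylor f = (W : PowerSeries (PowerSeries 𝕜)) * U := by
    rw [hWeq]; exact PowerSeries.eq_weierstrassDistinguished_mul_weierstrassUnit hres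
  have hu0 : PowerSeries.coeff 0 (PowerSeries.coeff 0 U) ≠ 0 := by
    have h1 : IsUnit U := PowerSeries.isUnit_weierstrassUnit hres
    rw [PowerSeries.isUnit_iff_constantCoeff, PowerSeries.isUnit_iff_constantCoeff] at h1
    simpa using h1.ne_zero
  set u := PowerSeries.coeff 0 (PowerSeries.coeff 0 U) with hu
  set WL := W.map (toFractionalSeries 𝕜) with hWL
  have hWL0 : WL ≠ 0 := (hdist.monic.map _).ne_zero
  -- the roots with the given leading term
  set s := (puiseuxRoots f).filter fun φ => φ.order = a ∧ φ.leadingCoeff = b with hs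
  have hscard : s.card = m := by
    rw [hmdef, rootCount, Multiset.countP_eq_card_filter]
  have hsmem : ∀ φ ∈ s, φ.order = a ∧ φ.leadingCoeff = b := fun φ hφ =>
    (Multiset.mem_filter.1 hφ).2
  have hsdvd : (s.map fun φ => X - C φ).prod ∣ WL :=
    (Multiset.prod_X_sub_C_dvd_iff_le_roots hWL0 s).2 (Multiset.filter_le _ _)
  have ha : 0 < a := by
    obtain ⟨φ, hφ⟩ := Multiset.card_pos_iff_exists_mem.1 (hscard ▸ hm)
    have hr : φ ∈ WL.roots := (Multiset.mem_filter.1 hφ).1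
    have hφ0 : φ ≠ 0 := by
      rintro rfl
      have := (hsmem _ hφ).2
      rw [HahnSeries.leadingCoeff_zero] at this
      exact hb this.symm
    rw [← (hsmem _ hφ).1]
    exact order_pos_of_root hdist hφ0 (isRoot_of_mem_roots hr)
  have ha' : (0 : ℝ) < a := by exact_mod_cast ha
  set Λ := substPow ℂ a WL with hΛ
  have hΛc : ∀ e j, (Λ.coeff e).coeff j = (toFractionalSeries 𝕜 (W.coeff j)).coeff (e - a * j) := by
    intro e j
    rw [hΛ, coeff_substPow, hWL, coeff_map]
  have hΛ0 : Λ ≠ 0 := by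
    intro h0
    have := hΛc (a * W.natDegree) W.natDegree
    rw [h0, sub_self, hdist.monic.coeff_natDegree, map_one] at this
    simp at this
  -- μ is the least weight i + a j occurring in W, and F is the part of W of this weight.
  set μ := Λ.order with hμ
  set F := Λ.coeff μ with hF
  have hF0 : F ≠ 0 := fun h => hΛ0 (HahnSeries.coeff_order_eq_zero.1 h)
  have hFdvd : (X - C b) ^ m ∣ F := by
    obtain ⟨R, hR⟩ := hsdvd
    rw [hF, hμ, ← HahnSeries.leadingCoeff_eq, hΛ, hR, map_mul, HahnSeries.leadingCoeff_mul,
      leadingCoeff_substPow_prod s hsmem, hscard]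
    exact dvd_mul_right _ _
  -- the coefficients of `W` below and on the line
  have hWlow : ∀ i j : ℕ, (i : ℚ) + a * j < μ → PowerSeries.coeff i (W.coeff j) = 0 := by
    intro i j hij
    have h1 := hΛc (i + a * j) j
    rw [HahnSeries.coeff_eq_zero_of_lt_order hij, add_sub_cancel_right,
      coeff_toFractionalSeries_natCast, coeff_zero] at h1
    exact (map_eq_zero (toComplex 𝕜)).1 h1.symm
  have hWline : ∀ i j : ℕ, (i : ℚ) + a * j = μ →
      F.coeff j = toComplex 𝕜 (PowerSeries.coeff i (W.coeff j)) := by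
    intro i j hij
    rw [hF, hΛc, ← hij, add_sub_cancel_right, coeff_toFractionalSeries_natCast]
  have hFex : ∀ j, F.coeff j ≠ 0 → ∃ i : ℕ, (i : ℚ) + a * j = μ := by
    intro j hj
    rw [hF, hΛc] at hj
    obtain ⟨i, hi⟩ := exists_of_coeff_toFractionalSeries_ne_zero hj
    exact ⟨i, by linarith⟩
  -- the Taylor coefficients of `f`
  have hcoef : ∀ i j : ℕ, taylorCoeff f (i + xOrder f) j =
      ∑ x ∈ Finset.HasAntidiagonal.antidiagonal j, ∑ y ∈ Finset.HasAntidiagonal.antidiagonal i,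
        PowerSeries.coeff y.1 (W.coeff x.1) * PowerSeries.coeff y.2 (PowerSeries.coeff x.2 U) := by
    intro i j
    have h1 : PowerSeries.coeff i (PowerSeries.coeff j (reducedTaylor f)) =
        taylorCoeff f (i + xOrder f) j := by simp [reducedTaylor]
    rw [← h1, hfac, PowerSeries.coeff_mul, map_sum]
    refine Finset.sum_congr rfl fun x _ => ?_
    rw [PowerSeries.coeff_mul, Polynomial.coeff_coe]
  have hlow : ∀ i j : ℕ, (i : ℚ) + a * j < μ → taylorCoeff f (i + xOrder f) j = 0 := by
    intro i j hij
    rw [hcoef]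
    refine Finset.sum_eq_zero fun x hx => Finset.sum_eq_zero fun y hy => ?_
    rw [Finset.HasAntidiagonal.mem_antidiagonal] at hx hy
    have h1 : (y.1 : ℚ) ≤ i := by exact_mod_cast (by omega : y.1 ≤ i)
    have h2 : (x.1 : ℚ) ≤ j := by exact_mod_cast (by omega : x.1 ≤ j)
    rw [hWlow _ _ (by nlinarith), zero_mul]
  -- Nonconstant monomials of the unit U raise the weight, so only its constant term u acts on the
  -- lowest part.
  have hline : ∀ i j : ℕ, (i : ℚ) + a * j = μ →
      taylorCoeff f (i + xOrder f) j = PowerSeries.coeff i (W.coeff j) * u := by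
    intro i j hij
    rw [hcoef, Finset.sum_eq_single (j, 0), Finset.sum_eq_single (i, 0)]
    · intro y hy hne
      rw [Finset.HasAntidiagonal.mem_antidiagonal] at hy
      have h0 : y.1 < i := by
        by_contra! h
        exact hne (Prod.ext (by omega) (by dsimp only; omega))
      have h1 : (y.1 : ℚ) < i := by exact_mod_cast h0
      rw [hWlow _ _ (by dsimp only; linarith), zero_mul]
    · intro h; simp at h
    · intro x hx hne
      refine Finset.sum_eq_zero fun y hy => ?_
      rw [Finset.HasAntidiagonal.mem_antidiagonal] at hx hy
      have h0 : x.1 < j := by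
        by_contra! h
        exact hne (Prod.ext (by omega) (by dsimp only; omega))
      have h1 : (x.1 : ℚ) < j := by exact_mod_cast h0
      have h2 : (y.1 : ℚ) ≤ i := by exact_mod_cast (by omega : y.1 ≤ i)
      rw [hWlow _ _ (by nlinarith), zero_mul]
    · intro h; simp at h
  -- Restoring the factor x^α shifts the line, so N = μ + α.
  have hcast : ∀ i j : ℕ, ((i + xOrder f : ℕ) : ℝ) + (a : ℝ) * j = ((μ + xOrder f : ℚ) : ℝ) ↔
      (i : ℚ) + a * j = μ := by
    intro i j
    push_cast
    rw [add_right_comm, add_left_inj]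
    exact_mod_cast Iff.rfl
  refine ⟨ha, ((μ + xOrder f : ℚ) : ℝ), ?_, ?_, ?_⟩
  · intro p q hpq
    have hp : xOrder f ≤ p := by
      by_contra! h
      exact hpq (taylorCoeff_eq_zero_of_lt_xOrder h)
    obtain ⟨i, rfl⟩ := Nat.exists_eq_add_of_le' hp
    by_contra! hlt
    refine hpq (hlow i q ?_)
    push_cast at hlt
    have : (i : ℝ) + a * q < μ := by linarith
    exact_mod_cast this
  · obtain ⟨j, hj⟩ : ∃ j, F.coeff j ≠ 0 := by
      by_contra! h
      exact hF0 (Polynomial.ext (by simpa using h))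
    obtain ⟨i, hi⟩ := hFex j hj
    refine ⟨i + xOrder f, j, (hcast i j).2 hi, ?_⟩
    rw [hline i j hi]
    refine mul_ne_zero (fun h => hj ?_) hu0
    rw [hWline i j hi, h, map_zero]
  · have : (edgePoly (taylorCoeff f) (a : ℝ) ((μ + xOrder f : ℚ) : ℝ) 1).map (toComplex 𝕜) =
        F * C (toComplex 𝕜 u) := by
      ext j
      rw [coeff_map, coeff_mul_C]
      by_cases hex : ∃ i : ℕ, (i : ℚ) + a * j = μ
      · obtain ⟨i, hi⟩ := hex
        rw [coeff_edgePoly _ ha' _ ((hcast i j).2 hi), one_pow, mul_one, hline i j hi, map_mul,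
          hWline i j hi]
      · have h1 : F.coeff j = 0 := by
          by_contra h
          exact hex (hFex j h)
        have h2 : (edgePoly (taylorCoeff f) (a : ℝ) ((μ + xOrder f : ℚ) : ℝ) 1).coeff j = 0 := by
          by_contra h
          obtain ⟨p, hp, hp0⟩ := exists_of_coeff_edgePoly_ne_zero h
          have hpx : xOrder f ≤ p := by
            by_contra! h
            exact hp0 (taylorCoeff_eq_zero_of_lt_xOrder h)
          obtain ⟨i, rfl⟩ := Nat.exists_eq_add_of_le' hpx
          exact hex ⟨i, (hcast i j).1 hp⟩
        rw [h1, h2, map_zero, zero_mul]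
    rw [this]
    exact hFdvd.mul_right _

end PuiseuxRoots

end PlaneGerm

namespace PlaneGerm

/-! ### Invariance of the critical index and its upper bound -/

section CriticalIndex

open MeasureTheory Measure

variable {𝕜 : Type*} [RCLike 𝕜]

/-- `|f| ^ (-c)` is integrable near the origin, for the product Haar measure. -/
def NegPowIntegrable (f : 𝕜 × 𝕜 → 𝕜) (c : ℝ) : Prop :=
  ∃ ε > 0, ∫⁻ v in Metric.ball (0 : 𝕜 × 𝕜) ε, ‖f v‖ₑ ^ (-c)
    ∂((addHaar : Measure 𝕜).prod (addHaar : Measure 𝕜)) < ∞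

/-- Haar measure on the product is a positive finite multiple of the product of Haar measures, for
which iterated integration is available. -/
theorem criticalIndex_eq (f : 𝕜 × 𝕜 → 𝕜) :
    criticalIndex f = ⨆ c ∈ {c : ℝ | 0 < c ∧ NegPowIntegrable f c}, ENNReal.ofReal c := by
  obtain ⟨k, hk0, hk, hμ⟩ : ∃ k : ℝ≥0∞, k ≠ 0 ∧ k ≠ ∞ ∧ (addHaar : Measure (𝕜 × 𝕜)) =
      k • (addHaar : Measure 𝕜).prod (addHaar : Measure 𝕜) := by
    refine ⟨addHaarScalarFactor (addHaar : Measure (𝕜 × 𝕜)) ((addHaar : Measure 𝕜).prod addHaar),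
      ?_, ENNReal.coe_ne_top, isAddLeftInvariant_eq_smul _ _⟩
    exact ENNReal.coe_ne_zero.2 (addHaarScalarFactor_pos_of_isAddHaarMeasure _ _).ne'
  have h : ∀ c : ℝ, (∃ ε > 0, ∫⁻ v in Metric.ball (0 : 𝕜 × 𝕜) ε, ‖f v‖ₑ ^ (-c) ∂addHaar < ∞) ↔
      NegPowIntegrable f c := by
    intro c
    refine exists_congr fun ε => and_congr_right fun _ => ?_
    rw [hμ, Measure.restrict_smul, lintegral_smul_measure, smul_eq_mul]
    constructor
    · intro h
      by_contra! ht
      rw [top_le_iff.1 ht, ENNReal.mul_top hk0] at h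
      exact lt_irrefl _ h
    · exact fun h => ENNReal.mul_lt_top hk.lt_top h
  rw [criticalIndex]
  simp only [h]

theorem NegPowIntegrable.comp {f g : 𝕜 × 𝕜 → 𝕜} {c : ℝ} (h : NegPowIntegrable f c)
    (T : 𝕜 × 𝕜 ≃ᵐ 𝕜 × 𝕜)
    (hT : MeasurePreserving T ((addHaar : Measure 𝕜).prod addHaar)
      ((addHaar : Measure 𝕜).prod addHaar))
    (hT0 : Tendsto T (𝓝 0) (𝓝 0)) (hg : ∀ᶠ v in 𝓝 0, g v = f (T v)) : NegPowIntegrable g c := by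
  obtain ⟨ε, hε, hf⟩ := h
  obtain ⟨δ, hδ, hδ'⟩ := Metric.eventually_nhds_iff_ball.1
    ((hT0.eventually (Metric.ball_mem_nhds 0 hε)).and hg)
  refine ⟨δ, hδ, lt_of_le_of_lt ?_ hf⟩
  rw [← hT.setLIntegral_comp_preimage_emb T.measurableEmbedding (fun v => ‖f v‖ₑ ^ (-c))]
  calc ∫⁻ v in Metric.ball (0 : 𝕜 × 𝕜) δ, ‖g v‖ₑ ^ (-c) ∂((addHaar : Measure 𝕜).prod addHaar)
      = ∫⁻ v in Metric.ball (0 : 𝕜 × 𝕜) δ, ‖f (T v)‖ₑ ^ (-c)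
          ∂((addHaar : Measure 𝕜).prod addHaar) :=
        setLIntegral_congr_fun Metric.isOpen_ball.measurableSet fun v hv => by
          simp only [(hδ' v hv).2]
    _ ≤ _ := lintegral_mono_set fun v hv => (hδ' v hv).1

theorem criticalIndex_mono {f g : 𝕜 × 𝕜 → 𝕜}
    (h : ∀ c, 0 < c → NegPowIntegrable f c → NegPowIntegrable g c) :
    criticalIndex f ≤ criticalIndex g := by
  rw [criticalIndex_eq, criticalIndex_eq]
  exact biSup_mono fun c hc => ⟨hc.1, h c hc.1 hc.2⟩

theorem criticalIndex_swap_le (f : 𝕜 × 𝕜 → 𝕜) :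
    criticalIndex f ≤ criticalIndex fun v => f (v.2, v.1) :=
  criticalIndex_mono fun _ _ h => h.comp MeasurableEquiv.prodComm measurePreserving_swap
    (continuous_swap.tendsto' _ _ rfl) (Eventually.of_forall fun _ => rfl)

theorem criticalIndex_swap (f : 𝕜 × 𝕜 → 𝕜) :
    (criticalIndex fun v => f (v.2, v.1)) = criticalIndex f :=
  le_antisymm (criticalIndex_swap_le fun v => f (v.2, v.1)) (criticalIndex_swap_le f)

/-- The shear `(x, y) ↦ (x, y + Q x)`. -/
def shearEquiv (Q : 𝕜 → 𝕜) (hQ : Measurable Q) : 𝕜 × 𝕜 ≃ᵐ 𝕜 × 𝕜 where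
  toFun v := (v.1, v.2 + Q v.1)
  invFun v := (v.1, v.2 - Q v.1)
  left_inv v := by simp
  right_inv v := by simp
  measurable_toFun := by
    change Measurable fun v : 𝕜 × 𝕜 => (v.1, v.2 + Q v.1)
    fun_prop
  measurable_invFun := by
    change Measurable fun v : 𝕜 × 𝕜 => (v.1, v.2 - Q v.1)
    fun_prop

theorem criticalIndex_le_inShearY (f : 𝕜 × 𝕜 → 𝕜) {Q : 𝕜 → 𝕜} (hQ : AnalyticAt 𝕜 Q 0)
    (hQ0 : Q 0 = 0) : criticalIndex f ≤ criticalIndex (inShearY Q f) := by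
  classical
  obtain ⟨r, hr, hc⟩ := Metric.eventually_nhds_iff_ball.1 hQ.eventually_continuousAt
  -- Q is controlled only near 0. Cutting it off yields a measurable function, so that the shear is
  -- a measure-preserving equivalence of the whole plane.
  let Q₀ : 𝕜 → 𝕜 := (Metric.ball 0 r).piecewise Q fun _ => 0
  have hQ₀ : Measurable Q₀ := by
    refine ContinuousOn.measurable_piecewise (fun x hx => (hc x hx).continuousWithinAt)
      continuousOn_const Metric.isOpen_ball.measurableSet
  have heq : ∀ᶠ x in 𝓝 0, Q₀ x = Q x := by
    filter_upwards [Metric.ball_mem_nhds (0 : 𝕜) hr] with x hx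
    exact Set.piecewise_eq_of_mem _ _ _ hx
  have hcont : ContinuousAt Q₀ 0 := hQ.continuousAt.congr (heq.mono fun x hx => hx.symm)
  have hQ₀0 : Q₀ 0 = 0 := by rw [heq.self_of_nhds, hQ0]
  refine criticalIndex_mono fun c _ h => h.comp (shearEquiv Q₀ hQ₀) ?_ ?_ ?_
  · refine (MeasurePreserving.id _).skew_product (g := fun x y => y + Q₀ x) (by fun_prop) ?_
    exact ae_of_all _ fun x => map_add_right_eq_self _ _
  · have : ContinuousAt (fun v : 𝕜 × 𝕜 => (v.1, v.2 + Q₀ v.1)) 0 := by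
      have h1 : ContinuousAt (fun v : 𝕜 × 𝕜 => Q₀ v.1) 0 :=
        ContinuousAt.comp (g := Q₀) (f := Prod.fst) (x := (0 : 𝕜 × 𝕜)) hcont continuousAt_fst
      exact continuousAt_fst.prodMk (continuousAt_snd.add h1)
    have h2 := this.tendsto
    simp only [Prod.fst_zero, Prod.snd_zero, hQ₀0, add_zero] at h2
    exact h2
  · have := (continuous_fst.tendsto' (0 : 𝕜 × 𝕜) 0 rfl).eventually heq
    filter_upwards [this] with v hv
    simp only [inShearY, shearEquiv, MeasurableEquiv.coe_mk, Equiv.coe_fn_mk, hv]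

theorem criticalIndex_inShearY (f : 𝕜 × 𝕜 → 𝕜) {Q : 𝕜 → 𝕜} (hQ : AnalyticAt 𝕜 Q 0)
    (hQ0 : Q 0 = 0) : criticalIndex (inShearY Q f) = criticalIndex f := by
  refine le_antisymm ?_ (criticalIndex_le_inShearY f hQ hQ0)
  refine (criticalIndex_le_inShearY (inShearY Q f) hQ.neg (by simp [hQ0])).trans_eq ?_
  congr 1
  funext v
  simp [inShearY]

theorem addHaar_ball_pow (x : 𝕜) {r : ℝ} (hr : 0 ≤ r) :
    (addHaar : Measure 𝕜) (Metric.ball x r) =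
      ENNReal.ofReal (r ^ Module.finrank ℝ 𝕜) * (addHaar : Measure 𝕜) (Metric.ball 0 1) :=
  addHaar_ball _ _ hr

theorem norm_le_of_weights {f : 𝕜 × 𝕜 → 𝕜} {A : ℕ → ℕ → 𝕜} {ρ C α β d : ℝ} (hρ : 0 < ρ)
    (h : HasDoubleSeriesOn f A ρ C) (hw : ∀ i j, A i j ≠ 0 → d ≤ α * i + β * j) {r : ℝ}
    (hr : 0 < r) (hr1 : r ≤ 1) {x y : 𝕜} (hx : ‖x‖ ≤ ρ / 2 * r ^ α)
    (hy : ‖y‖ ≤ ρ / 2 * r ^ β) (hx' : ‖x‖ < ρ) (hy' : ‖y‖ < ρ) :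
    ‖f (x, y)‖ ≤ 4 * C * r ^ d := by
  have h1 := h.2 x y hx' hy'
  have hC : 0 ≤ C := le_trans (by positivity) (h.1 0 0)
  have hb : ∀ p : ℕ × ℕ, ‖A p.1 p.2 * x ^ p.1 * y ^ p.2‖ ≤
      C * r ^ d * ((1 / 2) ^ p.1 * (1 / 2) ^ p.2) := by
    intro p
    by_cases hp : A p.1 p.2 = 0
    · rw [hp]; simp only [zero_mul, norm_zero]; positivity
    refine (norm_term_le hρ h.1 hx hy p.1 p.2).trans ?_
    have e1 : ρ / 2 * r ^ α / ρ = 1 / 2 * r ^ α := by field_simp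
    have e2 : ρ / 2 * r ^ β / ρ = 1 / 2 * r ^ β := by field_simp
    rw [e1, e2, mul_pow, mul_pow, ← Real.rpow_natCast (r ^ α), ← Real.rpow_natCast (r ^ β),
      ← Real.rpow_mul hr.le, ← Real.rpow_mul hr.le]
    have e3 : r ^ (α * p.1) * r ^ (β * p.2) ≤ r ^ d := by
      rw [← Real.rpow_add hr]
      exact Real.rpow_le_rpow_of_exponent_ge hr hr1 (hw _ _ hp)
    calc C * ((1 / 2) ^ p.1 * r ^ (α * p.1) * ((1 / 2) ^ p.2 * r ^ (β * p.2)))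
        = C * (r ^ (α * p.1) * r ^ (β * p.2)) * ((1 / 2) ^ p.1 * (1 / 2) ^ p.2) := by ring
      _ ≤ _ := by gcongr
  have hg : HasSum (fun p : ℕ × ℕ => C * r ^ d * (((1 : ℝ) / 2) ^ p.1 * (1 / 2) ^ p.2))
      (C * r ^ d * (2 * 2)) := by
    refine HasSum.mul_left _ ?_
    exact HasSum.mul hasSum_geometric_two hasSum_geometric_two
      (summable_double_geometric (by norm_num) (by norm_num) (by norm_num) (by norm_num))
  rw [← h1.tsum_eq]
  exact (tsum_of_norm_bounded hg hb).trans_eq (by ring)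

theorem enorm_rpow_neg_ge {z : 𝕜} {M c : ℝ} (hM : 0 < M) (hc : 0 < c) (h : ‖z‖ ≤ M) :
    ENNReal.ofReal (M ^ (-c)) ≤ ‖z‖ₑ ^ (-c) := by
  rw [← ENNReal.ofReal_rpow_of_pos hM, ENNReal.rpow_neg, ENNReal.rpow_neg, ENNReal.inv_le_inv]
  refine ENNReal.rpow_le_rpow ?_ hc.le
  rw [← ofReal_norm]
  exact ENNReal.ofReal_le_ofReal h

/-- For weights with α + β = 1 supporting the polyhedron at (d, d), the box of radii of order r^α
and r^β has volume of order r^K, and |f| = O(r^d) on it. The integral is thus at least a constant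
times r^(K - c d), which is unbounded as r → 0 if c d > K. -/
theorem mul_newtonDistInv_le {f : 𝕜 × 𝕜 → 𝕜} (hf : AnalyticAt 𝕜 f 0)
    (h0 : taylorCoeff f 0 0 = 0) {i j : ℕ} (hij : taylorCoeff f i j ≠ 0) {c : ℝ} (hc : 0 < c)
    (h : NegPowIntegrable f c) : c * newtonDistInv f ≤ Module.finrank ℝ 𝕜 := by
  set d := newtonDistInv f with hd
  set K := Module.finrank ℝ 𝕜 with hK
  by_contra! hlt
  obtain ⟨ε, hε, hI⟩ := h
  set I := ∫⁻ v in Metric.ball (0 : 𝕜 × 𝕜) ε, ‖f v‖ₑ ^ (-c)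
    ∂((addHaar : Measure 𝕜).prod (addHaar : Measure 𝕜)) with hIdef
  obtain ⟨α, β, hα, hβ, hab, hw⟩ := exists_supporting_weight h0 hij
  obtain ⟨ρ', hρ', C, hs'⟩ := hasDoubleSeries_taylorCoeff hf
  set ρ := min ρ' ε with hρdef
  have hρ : 0 < ρ := lt_min hρ' hε
  have hs := hs'.mono hρ.le (min_le_left _ _)
  have hC : 0 ≤ C := le_trans (by positivity) (hs.1 0 0)
  set V := (addHaar : Measure 𝕜) (Metric.ball 0 1) with hV
  have hV0 : V ≠ 0 := (Metric.measure_ball_pos _ _ one_pos).ne'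
  have hVt : V ≠ ∞ := measure_ball_lt_top.ne
  set κ : ℝ := (ρ / 2) ^ K * (ρ / 2) ^ K * (4 * C + 1) ^ (-c) with hκ
  have hκ0 : 0 < κ := by positivity
  have key : ∀ r : ℝ, 0 < r → r ≤ 1 → ENNReal.ofReal (κ * r ^ (K - c * d)) * (V * V) ≤ I := by
    intro r hr hr1
    have hra : 0 < r ^ α := Real.rpow_pos_of_pos hr _
    have hrb : 0 < r ^ β := Real.rpow_pos_of_pos hr _
    have hra1 : r ^ α ≤ 1 := Real.rpow_le_one hr.le hr1 hα
    have hrb1 : r ^ β ≤ 1 := Real.rpow_le_one hr.le hr1 hβ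
    set B := Metric.ball (0 : 𝕜) (ρ / 2 * r ^ α) ×ˢ Metric.ball (0 : 𝕜) (ρ / 2 * r ^ β) with hB
    have hsmall : ∀ s : ℝ, 0 < s → s ≤ 1 → ρ / 2 * s < ρ := fun s hs hs1 => by nlinarith
    have hBsub : B ⊆ Metric.ball (0 : 𝕜 × 𝕜) ε := by
      rintro ⟨x, y⟩ ⟨hx, hy⟩
      rw [mem_ball_zero_iff] at *
      have h1 := hsmall _ hra hra1
      have h2 := hsmall _ hrb hrb1
      have h3 : ρ ≤ ε := min_le_right _ _
      rw [Prod.norm_def]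
      dsimp only at hx hy ⊢
      exact max_lt (by linarith) (by linarith)
    calc ENNReal.ofReal (κ * r ^ (K - c * d)) * (V * V)
        = ENNReal.ofReal (((4 * C + 1) * r ^ d) ^ (-c)) *
            ((addHaar : Measure 𝕜).prod (addHaar : Measure 𝕜)) B := by
          rw [hB, Measure.prod_prod, addHaar_ball_pow 0 (r := ρ / 2 * r ^ α) (by positivity),
            addHaar_ball_pow 0 (r := ρ / 2 * r ^ β) (by positivity), ← hV, ← hK]
          have e : κ * r ^ (K - c * d) = ((4 * C + 1) * r ^ d) ^ (-c) *
              ((ρ / 2 * r ^ α) ^ K * (ρ / 2 * r ^ β) ^ K) := by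
            rw [Real.mul_rpow (by positivity) (by positivity), ← Real.rpow_mul hr.le, mul_pow, mul_pow,
              ← Real.rpow_natCast (r ^ α), ← Real.rpow_natCast (r ^ β), ← Real.rpow_mul hr.le,
              ← Real.rpow_mul hr.le]
            have e1 : r ^ ((K : ℝ) - c * d) = r ^ (d * -c) * (r ^ (α * K) * r ^ (β * K)) := by
              rw [← Real.rpow_add hr, ← Real.rpow_add hr]
              congr 1
              rw [← add_mul, hab]; ring
            rw [e1, hκ]; ring
          rw [e, ENNReal.ofReal_mul (by positivity), ENNReal.ofReal_mul (by positivity)]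
          ring
      _ = ∫⁻ v in B, ENNReal.ofReal (((4 * C + 1) * r ^ d) ^ (-c))
            ∂((addHaar : Measure 𝕜).prod (addHaar : Measure 𝕜)) := by rw [setLIntegral_const]
      _ ≤ ∫⁻ v in B, ‖f v‖ₑ ^ (-c) ∂((addHaar : Measure 𝕜).prod (addHaar : Measure 𝕜)) := by
          refine setLIntegral_mono' (Metric.isOpen_ball.measurableSet.prod
            Metric.isOpen_ball.measurableSet) ?_
          rintro ⟨x, y⟩ ⟨hx, hy⟩
          rw [mem_ball_zero_iff] at hx hy
          dsimp only at hx hy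
          refine enorm_rpow_neg_ge (by positivity) hc ?_
          refine (norm_le_of_weights hρ hs hw hr hr1 hx.le hy.le
            (hx.trans (hsmall _ hra hra1)) (hy.trans (hsmall _ hrb hrb1))).trans ?_
          gcongr
          linarith
      _ ≤ I := lintegral_mono_set hBsub
  set e := c * d - K with he
  have he0 : 0 < e := by linarith
  have hVr : 0 < (V * V).toReal := ENNReal.toReal_pos (mul_ne_zero hV0 hV0) (ENNReal.mul_ne_top hVt hVt)
  have key2 : ∀ t : ℝ, 1 ≤ t → κ * t * (V * V).toReal ≤ I.toReal := by
    intro t ht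
    -- This r turns the bound into one linear in t; the value of t used below makes it exceed the
    -- finite integral.
    have h1 := key (t ^ (-e⁻¹)) (by positivity)
      (Real.rpow_le_one_of_one_le_of_nonpos ht (by have := inv_pos.2 he0; linarith))
    have h2 : (t ^ (-e⁻¹)) ^ ((K : ℝ) - c * d) = t := by
      rw [← Real.rpow_mul (by linarith)]
      have : -e⁻¹ * ((K : ℝ) - c * d) = 1 := by
        rw [show (K : ℝ) - c * d = -e by rw [he]; ring]; field_simp
      rw [this, Real.rpow_one]
    rw [h2] at h1
    have h3 := ENNReal.toReal_mono hI.ne h1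
    rwa [ENNReal.toReal_mul, ENNReal.toReal_ofReal (by positivity)] at h3
  have h1 := key2 (1 + I.toReal / (κ * (V * V).toReal)) (by
    have : 0 ≤ I.toReal := ENNReal.toReal_nonneg
    have : 0 ≤ I.toReal / (κ * (V * V).toReal) := by positivity
    linarith)
  have h2 : κ * (1 + I.toReal / (κ * (V * V).toReal)) * (V * V).toReal =
      κ * (V * V).toReal + I.toReal := by
    have := hκ0.ne'
    have := hVr.ne'
    field_simp
  have h3 : 0 < κ * (V * V).toReal := by positivity
  linarith

theorem criticalIndex_le {f : 𝕜 × 𝕜 → 𝕜} (hf : AnalyticAt 𝕜 f 0)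
    (h0 : taylorCoeff f 0 0 = 0) {i j : ℕ} (hij : taylorCoeff f i j ≠ 0) :
    criticalIndex f ≤ ENNReal.ofReal (Module.finrank ℝ 𝕜 * newtonDist f) := by
  rw [criticalIndex_eq]
  refine iSup₂_le fun c hc => ENNReal.ofReal_le_ofReal ?_
  rw [newtonDist, ← div_eq_mul_inv, le_div_iff₀ (newtonDistInv_pos h0 hij)]
  exact mul_newtonDistInv_le hf h0 hij hc.1 hc.2

theorem le_criticalIndex {f : 𝕜 × 𝕜 → 𝕜} {b : ℝ}
    (h : ∀ c, 0 < c → c < b → NegPowIntegrable f c) : ENNReal.ofReal b ≤ criticalIndex f := by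
  rw [criticalIndex_eq]
  rcases le_or_gt b 0 with hb | hb
  · rw [ENNReal.ofReal_of_nonpos hb]; exact zero_le
  refine le_of_forall_lt fun x hx => ?_
  obtain ⟨y, hxy, hyb⟩ := exists_between hx
  have hyt : y ≠ ∞ := hyb.ne_top
  have hy0 : 0 < y := zero_le.trans_lt hxy
  rw [← ENNReal.ofReal_toReal hyt] at hxy hyb
  have hy : 0 < y.toReal := ENNReal.toReal_pos hy0.ne' hyt
  exact hxy.trans_le (le_iSup₂_of_le y.toReal
    ⟨hy, h _ hy ((ENNReal.ofReal_lt_ofReal_iff hb).1 hyb)⟩ le_rfl)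

end CriticalIndex

end PlaneGerm

namespace PlaneGerm

/-! ### Sublevel estimates from divided differences, uniform over ℝ and ℂ -/

section Sublevel

open MeasureTheory Measure

variable {𝕜 : Type*} [RCLike 𝕜]

/-- A system of divided differences of the function `y ↦ G [y]` on `Y`. -/
def IsDividedDifference (G : List 𝕜 → 𝕜) (Y : Set 𝕜) : Prop :=
  ∀ y z L, (∀ w ∈ y :: z :: L, w ∈ Y) → (y - z) * G (y :: z :: L) = G (y :: L) - G (z :: L)

theorem IsDividedDifference.norm_le {G : List 𝕜 → 𝕜} {Y : Set 𝕜} (hG : IsDividedDifference G Y) {σ t : ℝ}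
    (hσ : 0 < σ) : ∀ (n : ℕ) (L : List 𝕜), L.length = n + 1 →
      L.Pairwise (fun y z => σ ≤ dist y z) → (∀ y ∈ L, y ∈ Y ∧ ‖G [y]‖ ≤ t) → ‖G L‖ ≤ (2 / σ) ^ n * t := by
  intro n
  induction n with
  | zero =>
    intro L hL _ ht
    obtain ⟨y, rfl⟩ := List.length_eq_one_iff.1 hL
    simpa using (ht y (by simp)).2
  | succ n ih =>
    intro L hL hp ht
    match L, hL, hp, ht with
    | y :: z :: L, hL, hp, ht =>
      have hp' := hp
      rw [List.pairwise_cons, List.pairwise_cons] at hp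
      have h1 := ih (y :: L) (by simpa using hL)
        (List.pairwise_cons.2 ⟨fun w hw => hp.1 w (by simp [hw]), hp.2.2⟩)
        (fun w hw => ht w (by rcases List.mem_cons.1 hw with h | h <;> simp [h]))
      have h2 := ih (z :: L) (by simpa using hL) (List.pairwise_cons.2 hp.2)
        (fun w hw => ht w (List.mem_cons_of_mem _ hw))
      have h3 : σ ≤ ‖y - z‖ := by rw [← dist_eq_norm]; exact hp.1 z (by simp)
      have h4 : ‖y - z‖ * ‖G (y :: z :: L)‖ ≤ 2 * ((2 / σ) ^ n * t) := by
        rw [← norm_mul, hG y z L fun w hw => (ht w hw).1]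
        refine (norm_sub_le _ _).trans ?_
        linarith
      have h5 : σ * ‖G (y :: z :: L)‖ ≤ 2 * ((2 / σ) ^ n * t) :=
        le_trans (by gcongr) h4
      rw [pow_succ]
      calc ‖G (y :: z :: L)‖ = (σ * ‖G (y :: z :: L)‖) / σ := by field_simp
        _ ≤ 2 * ((2 / σ) ^ n * t) / σ := by gcongr
        _ = _ := by ring

/-- Greedy choice: the balls of radius σ around at most k chosen points have too little measure to
cover E. -/
theorem exists_separated {E : Set 𝕜} {σ : ℝ} {k : ℕ}
    (h : k * (addHaar : Measure 𝕜) (Metric.ball 0 σ) < (addHaar : Measure 𝕜) E) :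
    ∀ n ≤ k + 1, ∃ L : List 𝕜, L.length = n ∧ (∀ y ∈ L, y ∈ E) ∧
      L.Pairwise (fun y z => σ ≤ dist y z) := by
  intro n
  induction n with
  | zero => exact fun _ => ⟨[], by simp⟩
  | succ n ih =>
    intro hn
    obtain ⟨L, hL, hE, hp⟩ := ih (by omega)
    have hb : ∀ L : List 𝕜, (addHaar : Measure 𝕜) {y | ∃ z ∈ L, dist y z < σ} ≤
        L.length * (addHaar : Measure 𝕜) (Metric.ball 0 σ) := by
      intro L
      induction L with
      | nil => simp
      | cons z L ih =>
        have : {y | ∃ w ∈ z :: L, dist y w < σ} ⊆ Metric.ball z σ ∪ {y | ∃ z ∈ L, dist y z < σ} := by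
          rintro y ⟨w, hw, hd⟩
          rcases List.mem_cons.1 hw with rfl | hw
          · exact Or.inl hd
          · exact Or.inr ⟨w, hw, hd⟩
        refine (measure_mono this).trans ((measure_union_le _ _).trans ?_)
        rw [addHaar_ball_center, List.length_cons, Nat.cast_add, add_mul, Nat.cast_one, one_mul,
          add_comm]
        gcongr
    have : ∃ y ∈ E, ∀ z ∈ L, σ ≤ dist y z := by
      by_contra! hcon
      have h1 : E ⊆ {y | ∃ z ∈ L, dist y z < σ} := hcon
      have h2 := (measure_mono (μ := (addHaar : Measure 𝕜)) h1).trans (hb L)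
      refine absurd (h.trans_le h2) (not_lt.2 ?_)
      gcongr
      omega
    obtain ⟨y, hy, hy'⟩ := this
    exact ⟨y :: L, by simp [hL], by simpa using ⟨hy, hE⟩, List.pairwise_cons.2 ⟨hy', hp⟩⟩

/-- A larger sublevel set would contain k + 1 points that are σ-separated, where the divided
difference is at most (2/σ)^k t < η. No mean value theorem is involved, so real and complex
variables are treated alike. -/
theorem IsDividedDifference.measure_sublevel_le {G : List 𝕜 → 𝕜} {Y : Set 𝕜}
    (hG : IsDividedDifference G Y) {k : ℕ} {η : ℝ}
    (h : ∀ L : List 𝕜, L.length = k + 1 → (∀ y ∈ L, y ∈ Y) → η ≤ ‖G L‖) {σ t : ℝ} (hσ : 0 < σ)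
    (ht : (2 / σ) ^ k * t < η) :
    (addHaar : Measure 𝕜) {y | y ∈ Y ∧ ‖G [y]‖ ≤ t} ≤
      k * (addHaar : Measure 𝕜) (Metric.ball 0 σ) := by
  by_contra! hlt
  obtain ⟨L, hL, hE, hp⟩ := exists_separated hlt (k + 1) le_rfl
  exact absurd ((h L hL fun y hy => (hE y hy).1).trans
    (hG.norm_le hσ k L hL hp fun y hy => hE y hy)) (not_le.2 ht)

theorem enorm_rpow_neg_le_tsum (z : 𝕜) {c : ℝ} (hc : 0 < c) :
    ‖z‖ₑ ^ (-c) ≤ 1 + ∑' n : ℕ, if ‖z‖ ≤ (1 / 2) ^ n then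
      ENNReal.ofReal ((2 : ℝ) ^ (c * (n + 1))) else 0 := by
  have hone : ∀ w : 𝕜, 1 ≤ ‖w‖ → ‖w‖ₑ ^ (-c) ≤ 1 := by
    intro w hw
    rw [ENNReal.rpow_neg]
    refine ENNReal.inv_le_one.2 (ENNReal.one_le_rpow ?_ hc)
    rw [← ofReal_norm]
    exact ENNReal.one_le_ofReal.2 hw
  rcases le_or_gt 1 ‖z‖ with h1 | h1
  · exact (hone z h1).trans le_self_add
  refine le_trans ?_ le_add_self
  -- At z = 0 the left side is infinite; the series diverges there because all its terms are at
  -- least 1.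
  by_cases hz : z = 0
  · subst hz
    have : ∀ n : ℕ, (1 : ℝ≥0∞) ≤ if ‖(0 : 𝕜)‖ ≤ (1 / 2) ^ n then
        ENNReal.ofReal ((2 : ℝ) ^ (c * (n + 1))) else 0 := by
      intro n
      rw [if_pos (by rw [norm_zero]; positivity)]
      exact ENNReal.one_le_ofReal.2 (Real.one_le_rpow (by norm_num) (by positivity))
    refine le_trans le_top (le_of_eq_of_le ?_ (ENNReal.tsum_le_tsum this))
    exact (ENNReal.tsum_const_eq_top_of_ne_zero one_ne_zero).symm
  have hz0 : 0 < ‖z‖ := norm_pos_iff.2 hz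
  obtain ⟨n, hn, hn'⟩ := exists_nat_pow_near_of_lt_one (x := ‖z‖) (y := (1 / 2 : ℝ)) hz0 h1.le
    (by norm_num) (by norm_num)
  refine le_trans ?_ (ENNReal.le_tsum n)
  rw [if_pos hn', ← ofReal_norm, ENNReal.ofReal_rpow_of_pos hz0]
  refine ENNReal.ofReal_le_ofReal ?_
  have : (2 : ℝ) ^ (c * (n + 1)) = ((1 / 2 : ℝ) ^ (n + 1)) ^ (-c) := by
    rw [one_div, inv_pow, Real.inv_rpow (by positivity), ← Real.rpow_neg (by positivity), neg_neg,
      ← Real.rpow_natCast, ← Real.rpow_mul (by norm_num)]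
    push_cast
    ring_nf
  rw [this]
  exact Real.rpow_le_rpow_of_nonpos (by positivity) hn.le (by linarith)

theorem lintegral_enorm_rpow_neg_le {Y : Set 𝕜} (hY : MeasurableSet Y) {g : 𝕜 → 𝕜} {c : ℝ}
    (hc : 0 < c) :
    ∫⁻ y in Y, ‖g y‖ₑ ^ (-c) ∂(addHaar : Measure 𝕜) ≤ (addHaar : Measure 𝕜) Y +
      ∑' n : ℕ, ENNReal.ofReal ((2 : ℝ) ^ (c * (n + 1))) *
        (addHaar : Measure 𝕜) {y | y ∈ Y ∧ ‖g y‖ ≤ (1 / 2) ^ n} := by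
  -- No measurability of g is assumed, so the sublevel sets are replaced by measurable hulls.
  set E : ℕ → Set 𝕜 := fun n => toMeasurable (addHaar : Measure 𝕜) {y | y ∈ Y ∧ ‖g y‖ ≤ (1 / 2) ^ n} with hE
  have hEm : ∀ n, MeasurableSet (E n) := fun n => measurableSet_toMeasurable (addHaar : Measure 𝕜) _
  calc ∫⁻ y in Y, ‖g y‖ₑ ^ (-c) ∂(addHaar : Measure 𝕜)
      ≤ ∫⁻ y in Y, (1 + ∑' n : ℕ, (E n).indicator
          (fun _ => ENNReal.ofReal ((2 : ℝ) ^ (c * (n + 1)))) y) ∂(addHaar : Measure 𝕜) := by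
        refine setLIntegral_mono' hY fun y hy => (enorm_rpow_neg_le_tsum (g y) hc).trans ?_
        gcongr with n
        split_ifs with hn
        · rw [Set.indicator_of_mem]
          exact subset_toMeasurable _ _ ⟨hy, hn⟩
        · exact zero_le
    _ = (addHaar : Measure 𝕜) Y + ∑' n : ℕ, ENNReal.ofReal ((2 : ℝ) ^ (c * (n + 1))) *
          ((addHaar : Measure 𝕜).restrict Y) (E n) := by
        rw [lintegral_add_left measurable_const, setLIntegral_const, one_mul,
          lintegral_tsum fun n => (measurable_const.indicator (hEm n)).aemeasurable]
        congr 1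
        refine tsum_congr fun n => ?_
        rw [lintegral_indicator_const (hEm n)]
    _ ≤ _ := by
        refine add_le_add le_rfl (ENNReal.tsum_le_tsum fun n => mul_le_mul_right ?_ _)
        exact (Measure.restrict_apply_le _ _).trans_eq (measure_toMeasurable _)

/-- Uniform integrability of `|g| ^ (-c)` for all functions with a divided difference of order `k`
bounded below, if `c * k` is less than the real dimension. -/
theorem exists_lintegral_le_of_dividedDifference (k : ℕ) {η c : ℝ} (hη : 0 < η) (hc : 0 < c)
    (hck : c * k < Module.finrank ℝ 𝕜) {Y : Set 𝕜} (hY : MeasurableSet Y)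
    (hYf : (addHaar : Measure 𝕜) Y < ∞) :
    ∃ D < ∞, ∀ G : List 𝕜 → 𝕜, IsDividedDifference G Y →
      (∀ L : List 𝕜, L.length = k + 1 → (∀ y ∈ L, y ∈ Y) → η ≤ ‖G L‖) →
      ∫⁻ y in Y, ‖G [y]‖ₑ ^ (-c) ∂(addHaar : Measure 𝕜) ≤ D := by
  -- A uniform sublevel bound C t^τ with τ > c makes the dyadic sum geometric. For k > 0 the
  -- exponent is τ = K / k. For k = 0 the sublevel sets are empty below η, and τ = c + 1 serves.
  obtain ⟨τ, hcτ, C, hC, hτ⟩ : ∃ τ : ℝ, c < τ ∧ ∃ C : ℝ≥0∞, C < ∞ ∧ ∀ G : List 𝕜 → 𝕜,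
      IsDividedDifference G Y →
      (∀ L : List 𝕜, L.length = k + 1 → (∀ y ∈ L, y ∈ Y) → η ≤ ‖G L‖) → ∀ t : ℝ, 0 < t →
      (addHaar : Measure 𝕜) {y | y ∈ Y ∧ ‖G [y]‖ ≤ t} ≤ C * ENNReal.ofReal (t ^ τ) := by
    rcases Nat.eq_zero_or_pos k with rfl | hk
    · refine ⟨c + 1, by linarith, (addHaar : Measure 𝕜) Y * ENNReal.ofReal ((η ^ (c + 1))⁻¹),
        ENNReal.mul_lt_top hYf ENNReal.ofReal_lt_top, fun G _ h t ht => ?_⟩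
      rcases lt_or_ge t η with hlt | hge
      · have : {y | y ∈ Y ∧ ‖G [y]‖ ≤ t} = ∅ := by
          ext y
          simp only [Set.mem_ofPred_eq, Set.mem_empty_iff_false, iff_false, not_and]
          intro hy hle
          have := h [y] rfl (by simpa using hy)
          linarith
        rw [this]; simp
      · refine (measure_mono (fun y hy => hy.1)).trans ?_
        rw [mul_assoc, ← ENNReal.ofReal_mul (by positivity)]
        refine le_mul_of_one_le_right' (ENNReal.one_le_ofReal.2 ?_)
        rw [← Real.inv_rpow hη.le, ← Real.mul_rpow (by positivity) ht.le]
        refine Real.one_le_rpow ?_ (by linarith)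
        rw [inv_mul_eq_div, one_le_div hη]; exact hge
    · have hk0 : (0 : ℝ) < k := by exact_mod_cast hk
      set K := Module.finrank ℝ 𝕜 with hK
      refine ⟨K / k, by rwa [lt_div_iff₀ hk0], k * (ENNReal.ofReal (2 ^ K * (2 / η) ^ ((K : ℝ) / k)) *
        (addHaar : Measure 𝕜) (Metric.ball 0 1)), ?_, fun G hG h t ht => ?_⟩
      · exact ENNReal.mul_lt_top (ENNReal.natCast_lt_top _)
          (ENNReal.mul_lt_top ENNReal.ofReal_lt_top measure_ball_lt_top)
      · set u : ℝ := 2 / η * t with hu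
        have hu0 : 0 < u := by positivity
        -- The separation is chosen so that (2 / σ)^k * t is exactly η / 2.
        set σ : ℝ := 2 * u ^ ((1 : ℝ) / k) with hσ
        have hσ0 : 0 < σ := by positivity
        have e1 : (2 / σ) ^ k * t = η / 2 := by
          have : (2 / σ) ^ k = u⁻¹ := by
            rw [hσ, ← div_div, div_self two_ne_zero, one_div, inv_pow, ← Real.rpow_natCast,
              ← Real.rpow_mul hu0.le, one_div, inv_mul_cancel₀ hk0.ne', Real.rpow_one]
          rw [this, hu]; field_simp
        refine (hG.measure_sublevel_le h hσ0 (by rw [e1]; linarith)).trans_eq ?_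
        rw [addHaar_ball_pow _ hσ0.le, ← hK]
        have e2 : σ ^ K = 2 ^ K * (2 / η) ^ ((K : ℝ) / k) * t ^ ((K : ℝ) / k) := by
          rw [hσ, mul_pow, ← Real.rpow_natCast (u ^ _), ← Real.rpow_mul hu0.le, hu,
            Real.mul_rpow (by positivity) ht.le]
          rw [show (1 : ℝ) / k * K = K / k by ring]; ring
        rw [e2, ENNReal.ofReal_mul (by positivity)]
        ring
  refine ⟨(addHaar : Measure 𝕜) Y + C * ∑' n : ℕ, ENNReal.ofReal ((2 : ℝ) ^ c * ((2 : ℝ) ^ (c - τ)) ^ n),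
    ENNReal.add_lt_top.2 ⟨hYf, ENNReal.mul_lt_top hC ?_⟩, fun G hG h =>
      (lintegral_enorm_rpow_neg_le hY hc).trans ?_⟩
  · have hs : Summable fun n : ℕ => (2 : ℝ) ^ c * ((2 : ℝ) ^ (c - τ)) ^ n :=
      (summable_geometric_of_lt_one (by positivity)
        (Real.rpow_lt_one_of_one_lt_of_neg (by norm_num) (by linarith))).mul_left _
    rw [← ENNReal.ofReal_tsum_of_nonneg (fun n => by positivity) hs]
    exact ENNReal.ofReal_lt_top
  · rw [← ENNReal.tsum_mul_left]
    refine add_le_add le_rfl (ENNReal.tsum_le_tsum fun n => ?_)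
    refine (mul_le_mul_right (hτ G hG h _ (by positivity)) _).trans_eq ?_
    rw [mul_left_comm, ← ENNReal.ofReal_mul (by positivity)]
    congr 2
    rw [one_div, inv_pow, Real.inv_rpow (by positivity), ← Real.rpow_neg (by positivity),
      ← Real.rpow_natCast, ← Real.rpow_mul (by norm_num), ← Real.rpow_add (by norm_num),
      ← Real.rpow_natCast, ← Real.rpow_mul (by norm_num), ← Real.rpow_add (by norm_num)]
    ring_nf

end Sublevel

end PlaneGerm

namespace PlaneGerm

/-! ### The rescaled family and its local integrability -/

section WeightedFamily

open MeasureTheory Measure Polynomial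

variable {𝕜 : Type*} [RCLike 𝕜]

/-- The divided difference of `y ^ j` at the points of a list. -/
def monomialDividedDifference : ℕ → List 𝕜 → 𝕜
  | 0, [_] => 1
  | 0, [] => 0
  | 0, _ :: _ :: _ => 0
  | _ + 1, [] => 0
  -- The Leibniz rule for the product of y and y^j.
  | j + 1, y :: L => y * monomialDividedDifference j (y :: L) + monomialDividedDifference j L

theorem monomialDividedDifference_nil (j : ℕ) :
    monomialDividedDifference j ([] : List 𝕜) = 0 := by
  cases j <;> rfl

theorem monomialDividedDifference_succ (j : ℕ) (y : 𝕜) (L : List 𝕜) :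
    monomialDividedDifference (j + 1) (y :: L) =
      y * monomialDividedDifference j (y :: L) + monomialDividedDifference j L := rfl

theorem isDividedDifference_monomial (j : ℕ) :
    IsDividedDifference (monomialDividedDifference (𝕜 := 𝕜) j) Set.univ := by
  induction j with
  | zero =>
    intro y z L _
    cases L <;> simp [monomialDividedDifference]
  | succ j ih =>
    intro y z L _
    have := ih y z L (by simp)
    rw [monomialDividedDifference_succ, monomialDividedDifference_succ,
      monomialDividedDifference_succ]
    linear_combination y * this

theorem monomialDividedDifference_singleton (j : ℕ) (y : 𝕜) :
    monomialDividedDifference j [y] = y ^ j := by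
  induction j with
  | zero => simp [monomialDividedDifference]
  | succ j ih =>
    rw [monomialDividedDifference_succ, ih, monomialDividedDifference_nil]; ring

/-- This recursion never divides, so coincident points are allowed; there it gives Hasse
derivatives, which detect root multiplicities. -/
theorem monomialDividedDifference_replicate (j k : ℕ) (y : 𝕜) :
    monomialDividedDifference j (List.replicate (k + 1) y) = j.choose k * y ^ (j - k) := by
  induction j generalizing k with
  | zero => cases k <;> simp [monomialDividedDifference, List.replicate_succ]
  | succ j ih =>
    rw [List.replicate_succ, monomialDividedDifference_succ, ← List.replicate_succ, ih]
    cases k with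
    | zero => simp [monomialDividedDifference_nil, pow_succ, mul_comm]
    | succ k =>
      rw [ih, Nat.choose_succ_succ, Nat.add_sub_add_right]
      rcases lt_trichotomy j k with h | rfl | h
      · simp [Nat.choose_eq_zero_of_lt h, Nat.choose_eq_zero_of_lt (h.trans (Nat.lt_succ_self k))]
      · simp
      · rw [show j - k = (j - (k + 1)) + 1 by omega]
        push_cast
        ring

/-- In the recursion, shortening the list loses a factor M while a power of y is worth a factor s.
The condition 1 ≤ s * M makes the second exchange no worse than the first. -/
theorem norm_monomialDividedDifference_le {s M : ℝ} (hM : 1 ≤ M) (hsM : 1 ≤ s * M) (hs : 0 < s)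
    (j : ℕ) (L : List 𝕜) (hL : ∀ y ∈ L, ‖y‖ ≤ s) :
    ‖monomialDividedDifference j L‖ ≤ M ^ L.length * (2 * s) ^ j := by
  have hM0 : 0 < M := by linarith
  induction j generalizing L with
  | zero =>
    match L with
    | [] => simp [monomialDividedDifference]
    | [y] => simpa [monomialDividedDifference] using hM
    | y :: z :: L =>
      simp only [monomialDividedDifference, norm_zero]
      positivity
  | succ j ih =>
    match L with
    | [] =>
      rw [monomialDividedDifference_nil, norm_zero]
      positivity
    | y :: L =>
      rw [monomialDividedDifference_succ]
      have h1 := ih (y :: L) hL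
      have h2 := ih L fun z hz => hL z (List.mem_cons_of_mem _ hz)
      have h3 := hL y List.mem_cons_self
      rw [List.length_cons] at h1 ⊢
      have h4 : M ^ L.length * (2 * s) ^ j ≤ s * (M ^ (L.length + 1) * (2 * s) ^ j) := by
        calc M ^ L.length * (2 * s) ^ j = 1 * (M ^ L.length * (2 * s) ^ j) := by ring
          _ ≤ (s * M) * (M ^ L.length * (2 * s) ^ j) := by gcongr
          _ = _ := by ring
      calc ‖y * monomialDividedDifference j (y :: L) + monomialDividedDifference j L‖
          ≤ ‖y‖ * ‖monomialDividedDifference j (y :: L)‖ + ‖monomialDividedDifference j L‖ := by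
            refine (norm_add_le _ _).trans ?_
            rw [norm_mul]
        _ ≤ s * (M ^ (L.length + 1) * (2 * s) ^ j) + s * (M ^ (L.length + 1) * (2 * s) ^ j) := by
            gcongr
            exact h2.trans h4
        _ = _ := by ring

theorem continuous_monomialDividedDifference_ofFn (j n : ℕ) :
    Continuous fun y : Fin n → 𝕜 => monomialDividedDifference j (List.ofFn y) := by
  induction j generalizing n with
  | zero =>
    rcases n with _ | _ | n
    · simp only [List.ofFn_zero]; exact continuous_const
    · simp only [List.ofFn_succ, List.ofFn_zero, monomialDividedDifference]
      exact continuous_const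
    · simp only [List.ofFn_succ, monomialDividedDifference]
      exact continuous_const
  | succ j ih =>
    rcases n with _ | n
    · simp only [List.ofFn_zero]; exact continuous_const
    · have h1 := ih (n + 1)
      have h2 := (ih n).comp (f := fun (y : Fin (n + 1) → 𝕜) (i : Fin n) => y i.succ) (by fun_prop)
      have h3 : (fun y : Fin (n + 1) → 𝕜 => monomialDividedDifference (j + 1) (List.ofFn y)) =
          fun y => y 0 * monomialDividedDifference j (List.ofFn y) +
            monomialDividedDifference j (List.ofFn fun i : Fin n => y i.succ) := by
        funext y
        rw [List.ofFn_succ, monomialDividedDifference_succ]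
      rw [h3]
      exact ((continuous_apply 0).mul h1).add h2

/-- The divided difference with respect to `y` of the series `∑ A i j * r ^ e i j * x ^ i * y ^ j`
at the points of `L`. -/
noncomputable def weightedSeries (A : ℕ → ℕ → 𝕜) (e : ℕ → ℕ → ℝ) (r : ℝ) (x : 𝕜) (L : List 𝕜) : 𝕜 :=
  ∑' p : ℕ × ℕ, A p.1 p.2 * ((r ^ e p.1 p.2 : ℝ) : 𝕜) * x ^ p.1 * monomialDividedDifference p.2 L

variable {A : ℕ → ℕ → 𝕜} {e : ℕ → ℕ → ℝ} {ρ C : ℝ}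

theorem norm_weightedSeries_term_le (hρ : 0 < ρ) (hA : ∀ i j, ‖A i j‖ * ρ ^ (i + j) ≤ C)
    (he : ∀ i j, 0 ≤ e i j) {r : ℝ} (hr : 0 ≤ r) (hr1 : r ≤ 1) {x : 𝕜} (hx : ‖x‖ ≤ ρ / 4)
    {L : List 𝕜} (hL : ∀ y ∈ L, ‖y‖ ≤ ρ / 4) (p : ℕ × ℕ) :
    ‖A p.1 p.2 * ((r ^ e p.1 p.2 : ℝ) : 𝕜) * x ^ p.1 * monomialDividedDifference p.2 L‖ ≤
      C * max 1 (4 / ρ) ^ L.length * ((1 / 4) ^ p.1 * (1 / 2) ^ p.2) := by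
  set M := max 1 (4 / ρ)
  have hM : 1 ≤ M := le_max_left _ _
  have hsM : 1 ≤ ρ / 4 * M := by
    calc (1 : ℝ) = ρ / 4 * (4 / ρ) := by field_simp
      _ ≤ _ := by gcongr; exact le_max_right _ _
  have h1 := norm_monomialDividedDifference_le hM hsM (by positivity) p.2 L hL
  have h2 : ‖A p.1 p.2‖ ≤ C / ρ ^ (p.1 + p.2) := by
    rw [le_div_iff₀ (by positivity)]; exact hA _ _
  have hC : 0 ≤ C := le_trans (by positivity) (hA 0 0)
  have h3 : ‖((r ^ e p.1 p.2 : ℝ) : 𝕜)‖ ≤ 1 := by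
    rw [RCLike.norm_ofReal, abs_of_nonneg (by positivity)]
    exact Real.rpow_le_one hr hr1 (he _ _)
  have hM0 : 0 ≤ M := by linarith
  rw [norm_mul, norm_mul, norm_mul, norm_pow]
  calc ‖A p.1 p.2‖ * ‖((r ^ e p.1 p.2 : ℝ) : 𝕜)‖ * ‖x‖ ^ p.1 * ‖monomialDividedDifference p.2 L‖
      ≤ C / ρ ^ (p.1 + p.2) * 1 * (ρ / 4) ^ p.1 * (M ^ L.length * (2 * (ρ / 4)) ^ p.2) := by
        gcongr
    _ = _ := by
        rw [show 2 * (ρ / 4) = ρ * (1 / 2) by ring, show ρ / 4 = ρ * (1 / 4) by ring, mul_pow,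
          mul_pow, pow_add]
        field_simp

theorem summable_weightedSeries_bound (B : ℝ) :
    Summable fun p : ℕ × ℕ => B * (((1 : ℝ) / 4) ^ p.1 * (1 / 2) ^ p.2) :=
  (summable_double_geometric (by norm_num) (by norm_num) (by norm_num) (by norm_num)).mul_left _

theorem isDividedDifference_weightedSeries (hρ : 0 < ρ) (hA : ∀ i j, ‖A i j‖ * ρ ^ (i + j) ≤ C)
    (he : ∀ i j, 0 ≤ e i j) {r : ℝ} (hr : 0 ≤ r) (hr1 : r ≤ 1) {x : 𝕜} (hx : ‖x‖ ≤ ρ / 4) :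
    IsDividedDifference (weightedSeries A e r x) (Metric.closedBall 0 (ρ / 4)) := by
  intro y z L hL
  simp only [mem_closedBall_zero_iff] at hL
  have hs : ∀ L : List 𝕜, (∀ w ∈ L, ‖w‖ ≤ ρ / 4) → Summable fun p : ℕ × ℕ =>
      A p.1 p.2 * ((r ^ e p.1 p.2 : ℝ) : 𝕜) * x ^ p.1 * monomialDividedDifference p.2 L :=
    fun L hL => Summable.of_norm_bounded (summable_weightedSeries_bound _)
      fun p => norm_weightedSeries_term_le hρ hA he hr hr1 hx hL p
  simp only [weightedSeries]
  rw [← tsum_mul_left, ← Summable.tsum_sub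
    (hs _ fun w hw => hL w (by rcases List.mem_cons.1 hw with h | h <;> simp [h]))
    (hs _ fun w hw => hL w (List.mem_cons_of_mem _ hw))]
  refine tsum_congr fun p => ?_
  have := isDividedDifference_monomial p.2 y z L (by simp)
  linear_combination (A p.1 p.2 * ((r ^ e p.1 p.2 : ℝ) : 𝕜) * x ^ p.1) * this

/-- Joint continuity down to r = 0 and at coincident points: a lower bound for the edge polynomial
at one point spreads to nearby x, nearby lists and small r. -/
theorem continuousOn_weightedSeries (hρ : 0 < ρ) (hA : ∀ i j, ‖A i j‖ * ρ ^ (i + j) ≤ C)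
    (he : ∀ i j, 0 ≤ e i j) (n : ℕ) :
    ContinuousOn (fun w : ℝ × 𝕜 × (Fin n → 𝕜) => weightedSeries A e w.1 w.2.1 (List.ofFn w.2.2))
      {w | 0 ≤ w.1 ∧ w.1 ≤ 1 ∧ ‖w.2.1‖ ≤ ρ / 4 ∧ ∀ l, ‖w.2.2 l‖ ≤ ρ / 4} := by
  refine continuousOn_tsum (u := fun p : ℕ × ℕ =>
    C * max 1 (4 / ρ) ^ n * ((1 / 4) ^ p.1 * (1 / 2) ^ p.2)) ?_ (summable_weightedSeries_bound _) ?_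
  · intro p
    refine Continuous.continuousOn ?_
    have h1 : Continuous fun w : ℝ × 𝕜 × (Fin n → 𝕜) => ((w.1 ^ e p.1 p.2 : ℝ) : 𝕜) :=
      RCLike.continuous_ofReal.comp ((Real.continuous_rpow_const (he _ _)).comp continuous_fst)
    have h2 : Continuous fun w : ℝ × 𝕜 × (Fin n → 𝕜) =>
        monomialDividedDifference p.2 (List.ofFn w.2.2) :=
      (continuous_monomialDividedDifference_ofFn p.2 n).comp (by fun_prop)
    exact ((continuous_const.mul h1).mul (by fun_prop)).mul h2
  · intro p w hw
    have := norm_weightedSeries_term_le hρ hA he hw.1 hw.2.1 hw.2.2.1 (L := List.ofFn w.2.2)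
      (by rw [List.forall_mem_ofFn_iff]; exact hw.2.2.2) p
    rwa [List.length_ofFn] at this

/-- At `r = 0` only the terms on the line `i + a * j = N` survive. -/
theorem weightedSeries_zero_replicate {a N : ℝ} (ha : 0 < a)
    (he0 : ∀ i j, A i j ≠ 0 → (e i j = 0 ↔ (i : ℝ) + a * j = N)) (x y : 𝕜) (k : ℕ) :
    weightedSeries A e 0 x (List.replicate (k + 1) y) =
      (hasseDeriv k (edgePoly A a N x)).eval y := by
  classical
  set J := Finset.range (⌊N / a⌋₊ + 1)
  have h1 : ∀ i j : ℕ, (i : ℝ) + a * j = N → ⌊N - a * j⌋₊ = i := fun i j h => by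
    rw [show N - a * j = i by linarith]; exact Nat.floor_natCast i
  rw [weightedSeries, tsum_eq_sum (s := J.image fun j : ℕ => (⌊N - a * j⌋₊, j)), Finset.sum_image
    (fun j _ j' _ h => (Prod.ext_iff.1 h).2), edgePoly, _root_.map_sum, eval_finsetSum]
  · refine Finset.sum_congr rfl fun j _ => ?_
    rw [hasseDeriv_monomial, eval_monomial, monomialDividedDifference_replicate]
    by_cases hA : A ⌊N - a * j⌋₊ j = 0
    · simp [hA]
    · by_cases h : (⌊N - a * j⌋₊ : ℝ) + a * j = N
      · rw [if_pos h, (he0 _ _ hA).2 h, Real.rpow_zero]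
        push_cast
        ring
      · rw [if_neg h, Real.zero_rpow (fun h0 => h ((he0 _ _ hA).1 h0))]
        simp
  · rintro ⟨i, j⟩ hp
    by_cases hA : A i j = 0
    · simp [hA]
    · dsimp only
      rw [Real.zero_rpow]
      · simp
      · intro h0
        have h := (he0 i j hA).1 h0
        refine hp (Finset.mem_image.2 ⟨j, Finset.mem_range.2 ?_, by rw [h1 i j h]⟩)
        have hi : (0 : ℝ) ≤ i := by positivity
        rw [Nat.lt_add_one_iff]
        refine Nat.le_floor ?_
        rw [le_div_iff₀ ha]
        linarith

theorem eval_hasseDeriv_rootMultiplicity_ne_zero {P : 𝕜[X]} (hP : P ≠ 0) (y : 𝕜) :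
    (hasseDeriv (P.rootMultiplicity y) P).eval y ≠ 0 := by
  rw [← taylor_coeff, rootMultiplicity_eq_natTrailingDegree]
  have h : taylor y P ≠ 0 := fun h => hP (taylor_injective y (by rw [h, map_zero]))
  exact trailingCoeff_nonzero_iff_nonzero.2 h

/-- Integrability of `|F_r| ^ (-c)` near a point, uniformly for small `r`. -/
theorem exists_local_bound (hρ : 0 < ρ) (hA : ∀ i j, ‖A i j‖ * ρ ^ (i + j) ≤ C)
    (he : ∀ i j, 0 ≤ e i j) {a N : ℝ} (ha : 0 < a)
    (he0 : ∀ i j, A i j ≠ 0 → (e i j = 0 ↔ (i : ℝ) + a * j = N)) {x₀ y₀ : 𝕜}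
    (hx₀ : ‖x₀‖ ≤ ρ / 4) (hy₀ : ‖y₀‖ ≤ ρ / 4) (hP : edgePoly A a N x₀ ≠ 0) {c : ℝ} (hc : 0 < c)
    (hck : c * (edgePoly A a N x₀).rootMultiplicity y₀ < Module.finrank ℝ 𝕜) :
    ∃ ε > 0, ∃ D < ∞, ∀ r, 0 ≤ r → r ≤ 1 → r < ε →
      ∫⁻ v in (Metric.ball x₀ ε ∩ Metric.closedBall 0 (ρ / 4)) ×ˢ
        (Metric.ball y₀ ε ∩ Metric.closedBall 0 (ρ / 4)),
        ‖weightedSeries A e r v.1 [v.2]‖ₑ ^ (-c)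
        ∂((addHaar : Measure 𝕜).prod (addHaar : Measure 𝕜)) ≤ D := by
  set k := (edgePoly A a N x₀).rootMultiplicity y₀ with hk
  -- This is the k-th Hasse derivative of the edge polynomial at a root of multiplicity k, hence
  -- nonzero.
  set v₀ := weightedSeries A e 0 x₀ (List.replicate (k + 1) y₀) with hv₀
  have hv₀0 : v₀ ≠ 0 := by
    rw [hv₀, weightedSeries_zero_replicate ha he0]
    exact eval_hasseDeriv_rootMultiplicity_ne_zero hP y₀
  have hpos : 0 < ‖v₀‖ / 2 := by positivity
  have hcont := continuousOn_weightedSeries hρ hA he (k + 1) ((0 : ℝ), x₀, fun _ => y₀)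
    ⟨le_rfl, zero_le_one, hx₀, fun _ => hy₀⟩
  have h1 := Metric.continuousWithinAt_iff.1 hcont (‖v₀‖ / 2) hpos
  obtain ⟨ε, hε, h2⟩ := h1
  set Y := Metric.ball y₀ ε ∩ Metric.closedBall (0 : 𝕜) (ρ / 4) with hY
  set Z := Metric.ball x₀ ε ∩ Metric.closedBall (0 : 𝕜) (ρ / 4) with hZ
  have hYm : MeasurableSet Y := Metric.isOpen_ball.measurableSet.inter
    Metric.isClosed_closedBall.measurableSet
  have hYf : (addHaar : Measure 𝕜) Y < ∞ :=
    (measure_mono Set.inter_subset_left).trans_lt measure_ball_lt_top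
  have hZf : (addHaar : Measure 𝕜) Z < ∞ :=
    (measure_mono Set.inter_subset_left).trans_lt measure_ball_lt_top
  have hZm : MeasurableSet Z := Metric.isOpen_ball.measurableSet.inter
    Metric.isClosed_closedBall.measurableSet
  obtain ⟨D, hD, hDle⟩ := exists_lintegral_le_of_dividedDifference k hpos hc hck hYm hYf
  refine ⟨ε, hε, D * (addHaar : Measure 𝕜) Z, ENNReal.mul_lt_top hD hZf,
    fun r hr hr1 hrε => ?_⟩
  have hlow : ∀ x ∈ Z, ∀ L : List 𝕜, L.length = k + 1 → (∀ y ∈ L, y ∈ Y) →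
      ‖v₀‖ / 2 ≤ ‖weightedSeries A e r x L‖ := by
    intro x hx L hL hLY
    obtain ⟨w, rfl⟩ : ∃ w : Fin (k + 1) → 𝕜, List.ofFn w = L := by
      rw [← hL]
      exact ⟨L.get, List.ofFn_get L⟩
    rw [List.forall_mem_ofFn_iff] at hLY
    have h3 := h2 (x := (r, x, w)) ⟨hr, hr1, by simpa using hx.2, fun l => by simpa using (hLY l).2⟩ (by
      rw [Prod.dist_eq, Prod.dist_eq]
      refine max_lt ?_ (max_lt hx.1 ?_)
      · rw [Real.dist_eq, sub_zero, abs_of_nonneg hr]; exact hrε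
      · exact (dist_pi_lt_iff hε).2 fun l => (hLY l).1)
    dsimp only at h3
    rw [List.ofFn_const, ← hv₀, dist_eq_norm] at h3
    have h4 := norm_sub_norm_le v₀ (weightedSeries A e r x (List.ofFn w))
    rw [norm_sub_rev] at h4
    linarith
  rw [← Measure.prod_restrict]
  refine (lintegral_prod_le _).trans ?_
  calc ∫⁻ x in Z, ∫⁻ y in Y, ‖weightedSeries A e r x [y]‖ₑ ^ (-c) ∂(addHaar : Measure 𝕜)
        ∂(addHaar : Measure 𝕜) ≤ ∫⁻ _ in Z, D ∂(addHaar : Measure 𝕜) := by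
        refine setLIntegral_mono' hZm fun x hx => ?_
        refine hDle (weightedSeries A e r x) (fun y z L hL => ?_) (hlow x hx)
        exact isDividedDifference_weightedSeries hρ hA he hr hr1 (by simpa using hx.2) y z L
          fun w hw => (hL w hw).2
    _ = D * (addHaar : Measure 𝕜) Z := setLIntegral_const _ _

end WeightedFamily

end PlaneGerm

namespace PlaneGerm

/-! ### Weighted dyadic decomposition and the lower bound for the index -/

section Annuli

open MeasureTheory Measure Polynomial

variable {𝕜 : Type*} [RCLike 𝕜]

theorem weightedSeries_swap (A : ℕ → ℕ → 𝕜) (e : ℕ → ℕ → ℝ) (r : ℝ) (x y : 𝕜) :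
    weightedSeries (fun i j => A j i) (fun i j => e j i) r y [x] = weightedSeries A e r x [y] := by
  simp only [weightedSeries, monomialDividedDifference_singleton]
  rw [← (Equiv.prodComm ℕ ℕ).tsum_eq]
  refine tsum_congr fun p => ?_
  simp only [Equiv.prodComm_apply, Prod.fst_swap, Prod.snd_swap]
  ring

theorem rootMultiplicity_zero_le {P : 𝕜[X]} {n : ℕ} (h : P.coeff n ≠ 0) :
    P.rootMultiplicity 0 ≤ n := by
  by_contra! hlt
  have h1 := pow_rootMultiplicity_dvd P 0
  rw [C_0, sub_zero, X_pow_dvd_iff] at h1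
  exact h (h1 n hlt)

/-- The part of the bidisc of radius `s` outside of its image under the weighted dilation by
`1 / 2`. -/
def weightedAnnulus (𝕜 : Type*) [RCLike 𝕜] (s a : ℝ) : Set (𝕜 × 𝕜) :=
  (Metric.closedBall 0 s ×ˢ Metric.closedBall 0 s) ∩
    ({v | s * (1 / 2) ≤ ‖v.1‖} ∪ {v | s * (1 / 2) ^ a ≤ ‖v.2‖})

theorem isCompact_weightedAnnulus (s a : ℝ) : IsCompact (weightedAnnulus 𝕜 s a) :=
  ((isCompact_closedBall 0 s).prod (isCompact_closedBall 0 s)).inter_right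
    ((isClosed_le (by fun_prop) (by fun_prop)).union (isClosed_le (by fun_prop) (by fun_prop)))

/-- By compactness a local bound at each point suffices. Off the axes it comes from the multiplicity
hypothesis. On the axis y = 0 the multiplicity is at most the ordinate j' of a monomial on the line,
and on x = 0, with the variables exchanged, at most the abscissa i of one. -/
theorem exists_annulus_bound {A : ℕ → ℕ → 𝕜} {e : ℕ → ℕ → ℝ} {ρ C : ℝ} (hρ : 0 < ρ)
    (hA : ∀ i j, ‖A i j‖ * ρ ^ (i + j) ≤ C) (he : ∀ i j, 0 ≤ e i j) {a N : ℝ} (ha : 0 < a)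
    (he0 : ∀ i j, A i j ≠ 0 → (e i j = 0 ↔ (i : ℝ) + a * j = N)) {c : ℝ} (hc : 0 < c)
    {i j i' j' : ℕ} (hij : A i j ≠ 0) (hijN : (i : ℝ) + a * j = N)
    (hi : c * i < Module.finrank ℝ 𝕜) (hij' : A i' j' ≠ 0) (hijN' : (i' : ℝ) + a * j' = N)
    (hj' : c * j' < Module.finrank ℝ 𝕜)
    (hmult : ∀ x₀ y₀ : 𝕜, x₀ ≠ 0 → y₀ ≠ 0 →
      c * (edgePoly A a N x₀).rootMultiplicity y₀ < Module.finrank ℝ 𝕜) :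
    ∃ ε > 0, ∃ D < ∞, ∀ r, 0 ≤ r → r ≤ 1 → r < ε →
      ∫⁻ v in weightedAnnulus 𝕜 (ρ / 4) a, ‖weightedSeries A e r v.1 [v.2]‖ₑ ^ (-c)
        ∂((addHaar : Measure 𝕜).prod (addHaar : Measure 𝕜)) ≤ D := by
  refine (isCompact_weightedAnnulus (ρ / 4) a).induction_on (p := fun S =>
    ∃ ε > 0, ∃ D < ∞, ∀ r, 0 ≤ r → r ≤ 1 → r < ε →
      ∫⁻ v in S, ‖weightedSeries A e r v.1 [v.2]‖ₑ ^ (-c)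
        ∂((addHaar : Measure 𝕜).prod (addHaar : Measure 𝕜)) ≤ D) ?_ ?_ ?_ ?_
  · exact ⟨1, one_pos, 0, ENNReal.zero_lt_top, fun r _ _ _ => by simp⟩
  · rintro S T hST ⟨ε, hε, D, hD, h⟩
    exact ⟨ε, hε, D, hD, fun r h0 h1 h2 => (lintegral_mono_set hST).trans (h r h0 h1 h2)⟩
  · rintro S T ⟨ε, hε, D, hD, h⟩ ⟨ε', hε', D', hD', h'⟩
    refine ⟨min ε ε', lt_min hε hε', D + D', ENNReal.add_lt_top.2 ⟨hD, hD'⟩, fun r h0 h1 h2 =>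
      (lintegral_union_le _ _ _).trans (add_le_add (h r h0 h1 (h2.trans_le (min_le_left _ _)))
        (h' r h0 h1 (h2.trans_le (min_le_right _ _))))⟩
  · rintro ⟨x₀, y₀⟩ ⟨⟨hx₀, hy₀⟩, hxy⟩
    rw [mem_closedBall_zero_iff] at hx₀ hy₀
    dsimp only at hx₀ hy₀
    have hnhds : ∀ ε > 0, ((Metric.ball x₀ ε ∩ Metric.closedBall 0 (ρ / 4)) ×ˢ
        (Metric.ball y₀ ε ∩ Metric.closedBall 0 (ρ / 4))) ∈
        𝓝[weightedAnnulus 𝕜 (ρ / 4) a] (x₀, y₀) := by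
      intro ε hε
      refine mem_nhdsWithin.2 ⟨Metric.ball x₀ ε ×ˢ Metric.ball y₀ ε,
        Metric.isOpen_ball.prod Metric.isOpen_ball, ⟨Metric.mem_ball_self hε,
          Metric.mem_ball_self hε⟩, ?_⟩
      rintro v ⟨hv, hv'⟩
      exact ⟨⟨hv.1, hv'.1.1⟩, hv.2, hv'.1.2⟩
    by_cases hx : x₀ = 0
    · have hy : y₀ ≠ 0 := by
        rintro rfl
        rcases hxy with h | h
        · have h' : ρ / 4 * (1 / 2) ≤ ‖x₀‖ := h
          rw [hx, norm_zero] at h'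
          linarith
        · have h' : ρ / 4 * (1 / 2) ^ a ≤ ‖(0 : 𝕜)‖ := h
          rw [norm_zero] at h'
          have : 0 < ρ / 4 * (1 / 2) ^ a := by positivity
          linarith
      -- With the variables exchanged, the same line has weight 1 / a and level N / a.
      have hline : ∀ i j : ℕ, (i : ℝ) + a * j = N ↔ (j : ℝ) + 1 / a * i = N / a := by
        intro i j
        rw [eq_div_iff ha.ne']
        constructor
        · intro h; rw [← h]; field_simp; ring
        · intro h; rw [← h]; field_simp; ring
      have hP : edgePoly (fun i j => A j i) (1 / a) (N / a) y₀ ≠ 0 :=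
        edgePoly_ne_zero (by positivity) hy ((hline i j).1 hijN) hij
      have hcoeff := coeff_edgePoly (fun i j => A j i) (by positivity) y₀ ((hline i j).1 hijN)
      have hmul := rootMultiplicity_zero_le (P := edgePoly (fun i j => A j i) (1 / a) (N / a) y₀)
        (n := i) (by rw [hcoeff]; exact mul_ne_zero hij (pow_ne_zero _ hy))
      obtain ⟨ε, hε, D, hD, h⟩ := exists_local_bound (A := fun i j => A j i)
        (e := fun i j => e j i) (a := 1 / a) (N := N / a) hρ
        (fun i j => by rw [add_comm]; exact hA j i) (fun i j => he j i) (by positivity)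
        (fun i j h => (he0 j i h).trans (hline j i)) hy₀ hx₀ hP hc (by
          rw [hx]
          refine lt_of_le_of_lt ?_ hi
          gcongr)
      refine ⟨_, hnhds ε hε, ε, hε, D, hD, fun r h0 h1 h2 => le_of_eq_of_le ?_ (h r h0 h1 h2)⟩
      rw [← (measurePreserving_swap (μ := (addHaar : Measure 𝕜))
        (ν := (addHaar : Measure 𝕜))).setLIntegral_comp_preimage_emb
        MeasurableEquiv.prodComm.measurableEmbedding]
      simp only [Prod.fst_swap, Prod.snd_swap, weightedSeries_swap, Set.preimage_swap_prod]
    · have hP : edgePoly A a N x₀ ≠ 0 := edgePoly_ne_zero ha hx hijN hij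
      have hck : c * (edgePoly A a N x₀).rootMultiplicity y₀ < Module.finrank ℝ 𝕜 := by
        by_cases hy : y₀ = 0
        · have hmul := rootMultiplicity_zero_le (P := edgePoly A a N x₀) (n := j')
            (by rw [coeff_edgePoly A ha x₀ hijN']; exact mul_ne_zero hij' (pow_ne_zero _ hx))
          rw [hy]
          refine lt_of_le_of_lt ?_ hj'
          gcongr
        · exact hmult x₀ y₀ hx hy
      obtain ⟨ε, hε, D, hD, h⟩ := exists_local_bound hρ hA he ha he0 hx₀ hy₀ hP hc hck
      exact ⟨_, hnhds ε hε, ε, hε, D, hD, h⟩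

/-- The dilation `(x, y) ↦ (r * x, t * y)`. -/
noncomputable def dilation (𝕜 : Type*) [RCLike 𝕜] {r t : ℝ} (hr : r ≠ 0) (ht : t ≠ 0) : 𝕜 × 𝕜 ≃ᵐ 𝕜 × 𝕜 :=
  (MeasurableEquiv.smul₀ r hr).prodCongr (MeasurableEquiv.smul₀ t ht)

theorem setLIntegral_dilation_image {r t : ℝ} (hr : 0 < r) (ht : 0 < t) (S : Set (𝕜 × 𝕜))
    (h : 𝕜 × 𝕜 → ℝ≥0∞) :
    ∫⁻ v in dilation 𝕜 hr.ne' ht.ne' '' S, h v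
        ∂((addHaar : Measure 𝕜).prod (addHaar : Measure 𝕜)) =
      ENNReal.ofReal (r ^ Module.finrank ℝ 𝕜 * t ^ Module.finrank ℝ 𝕜) *
        ∫⁻ v in S, h (r • v.1, t • v.2) ∂((addHaar : Measure 𝕜).prod (addHaar : Measure 𝕜)) := by
  set K := Module.finrank ℝ 𝕜
  set T := dilation 𝕜 hr.ne' ht.ne' with hT
  have hmap : ((addHaar : Measure 𝕜).prod (addHaar : Measure 𝕜)).map T =
      ENNReal.ofReal ((r ^ K * t ^ K)⁻¹) • (addHaar : Measure 𝕜).prod (addHaar : Measure 𝕜) := by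
    have h1 : ⇑T = Prod.map (fun x : 𝕜 => r • x) (fun y : 𝕜 => t • y) := rfl
    rw [h1, ← Measure.map_prod_map _ _ (measurable_const_smul r) (measurable_const_smul t),
      Measure.map_addHaar_smul _ hr.ne', Measure.map_addHaar_smul _ ht.ne',
      Measure.prod_smul_left, Measure.prod_smul_right, smul_smul, mul_inv,
      ENNReal.ofReal_mul (by positivity), abs_of_pos (by positivity), abs_of_pos (by positivity)]
  have hπ : (addHaar : Measure 𝕜).prod (addHaar : Measure 𝕜) =
      ENNReal.ofReal (r ^ K * t ^ K) •
        ((addHaar : Measure 𝕜).prod (addHaar : Measure 𝕜)).map T := by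
    rw [hmap, smul_smul, ← ENNReal.ofReal_mul (by positivity), mul_inv_cancel₀ (by positivity),
      ENNReal.ofReal_one, one_smul]
  conv_lhs => rw [hπ]
  rw [Measure.restrict_smul, lintegral_smul_measure, MeasurableEquiv.restrict_map,
    lintegral_map_equiv, T.injective.preimage_image, smul_eq_mul]
  rfl

theorem apply_dilation_eq {f : 𝕜 × 𝕜 → 𝕜} {A : ℕ → ℕ → 𝕜} {e : ℕ → ℕ → ℝ} {ρ C : ℝ}
    (hρ : 0 < ρ) (hf : HasDoubleSeriesOn f A ρ C) {a N : ℝ} (ha : 0 < a)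
    (he : ∀ i j, A i j ≠ 0 → e i j = i + a * j - N) {r : ℝ} (hr : 0 < r) (hr1 : r ≤ 1) {x y : 𝕜}
    (hx : ‖x‖ ≤ ρ / 4) (hy : ‖y‖ ≤ ρ / 4) :
    f (r • x, (r ^ a : ℝ) • y) = ((r ^ N : ℝ) : 𝕜) * weightedSeries A e r x [y] := by
  have hsmall : ∀ t : ℝ, 0 ≤ t → t ≤ 1 → ∀ z : 𝕜, ‖z‖ ≤ ρ / 4 → ‖t • z‖ < ρ := by
    intro t ht ht1 z hz
    rw [norm_smul, Real.norm_of_nonneg ht]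
    nlinarith [norm_nonneg z]
  have h := hf.2 (r • x) ((r ^ a : ℝ) • y) (hsmall r hr.le hr1 x hx)
    (hsmall _ (by positivity) (Real.rpow_le_one hr.le hr1 ha.le) y hy)
  rw [← h.tsum_eq, weightedSeries, ← tsum_mul_left]
  refine tsum_congr fun p => ?_
  by_cases hA : A p.1 p.2 = 0
  · simp [hA]
  have hexp : r ^ N * r ^ e p.1 p.2 = r ^ p.1 * (r ^ a) ^ p.2 := by
    rw [he _ _ hA, ← Real.rpow_add hr, ← Real.rpow_natCast, ← Real.rpow_natCast,
      ← Real.rpow_mul hr.le, ← Real.rpow_add hr]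
    ring_nf
  have hexp' : ((r ^ N : ℝ) : 𝕜) * ((r ^ e p.1 p.2 : ℝ) : 𝕜) = (r : 𝕜) ^ p.1 * ((r ^ a : ℝ) : 𝕜) ^ p.2 := by
    rw [← RCLike.ofReal_mul, hexp]
    push_cast
    rfl
  rw [monomialDividedDifference_singleton, RCLike.real_smul_eq_coe_mul, RCLike.real_smul_eq_coe_mul]
  linear_combination (-(A p.1 p.2 * x ^ p.1 * y ^ p.2)) * hexp'

/-- The scale is the last one whose dilated bidisc still contains the point. -/
theorem mem_image_annulus {s a : ℝ} (hs : 0 < s) (ha : 0 < a) {n₀ : ℕ} {x y : 𝕜}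
    (hxy : (x, y) ≠ 0) (hx : ‖x‖ ≤ s * (1 / 2) ^ n₀) (hy : ‖y‖ ≤ s * ((1 / 2) ^ a) ^ n₀) :
    ∃ n, ∃ v ∈ weightedAnnulus 𝕜 s a, (x, y) =
      (((1 / 2 : ℝ) ^ (n₀ + n)) • v.1, (((1 / 2 : ℝ) ^ (n₀ + n)) ^ a) • v.2) := by
  classical
  have hτ : (0 : ℝ) < (1 / 2) ^ a := by positivity
  have hτ1 : ((1 : ℝ) / 2) ^ a < 1 := Real.rpow_lt_one (by norm_num) (by norm_num) ha
  have hex : ∃ n, ¬ (‖x‖ ≤ s * (1 / 2) ^ (n₀ + n) ∧ ‖y‖ ≤ s * ((1 / 2) ^ a) ^ (n₀ + n)) := by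
    have haux : ∀ τ : ℝ, 0 < τ → τ < 1 → ∀ z : 𝕜, z ≠ 0 → ∃ n, s * τ ^ (n₀ + n) < ‖z‖ := by
      intro τ h0 h1 z hz
      obtain ⟨n, hn⟩ := exists_pow_lt_of_lt_one (div_pos (norm_pos_iff.2 hz) hs) h1
      refine ⟨n, ?_⟩
      rw [lt_div_iff₀' hs] at hn
      refine lt_of_le_of_lt ?_ hn
      gcongr ?_ * ?_
      exact pow_le_pow_of_le_one h0.le h1.le (by omega)
    by_cases hx0 : x = 0
    · have hy0 : y ≠ 0 := fun h => hxy (by rw [hx0, h]; rfl)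
      obtain ⟨n, hn⟩ := haux _ hτ hτ1 y hy0
      exact ⟨n, fun h => absurd h.2 (not_le.2 hn)⟩
    · obtain ⟨n, hn⟩ := haux (1 / 2) (by norm_num) (by norm_num) x hx0
      exact ⟨n, fun h => absurd h.1 (not_le.2 hn)⟩
  obtain ⟨m, hm⟩ : ∃ m, Nat.find hex = m + 1 := by
    refine Nat.exists_eq_succ_of_ne_zero fun h0 => ?_
    have := Nat.find_spec hex
    rw [h0] at this
    exact this ⟨hx, hy⟩
  have h1 := not_not.1 (Nat.find_min hex (m := m) (by omega))
  have h2 := Nat.find_spec hex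
  rw [hm] at h2
  set r : ℝ := (1 / 2) ^ (n₀ + m) with hr
  have hr0 : 0 < r := by positivity
  have hra : ((1 / 2 : ℝ) ^ a) ^ (n₀ + m) = r ^ a := by
    rw [hr, ← Real.rpow_natCast, ← Real.rpow_natCast, ← Real.rpow_mul (by norm_num),
      ← Real.rpow_mul (by norm_num), mul_comm]
  rw [hra] at h1
  have hra0 : 0 < r ^ a := by positivity
  refine ⟨m, (r⁻¹ • x, (r ^ a)⁻¹ • y), ⟨⟨?_, ?_⟩, ?_⟩, ?_⟩
  · rw [mem_closedBall_zero_iff, norm_smul, Real.norm_of_nonneg (by positivity),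
      inv_mul_le_iff₀ hr0]
    linarith [h1.1]
  · rw [mem_closedBall_zero_iff, norm_smul, Real.norm_of_nonneg (by positivity),
      inv_mul_le_iff₀ hra0]
    linarith [h1.2]
  · rw [← add_assoc, pow_succ, pow_succ, ← hr, hra, not_and_or, not_le, not_le] at h2
    rcases h2 with h2 | h2
    · refine Or.inl ?_
      rw [Set.mem_ofPred_eq, norm_smul, Real.norm_of_nonneg (by positivity), le_inv_mul_iff₀ hr0]
      linarith
    · refine Or.inr ?_
      rw [Set.mem_ofPred_eq, norm_smul, Real.norm_of_nonneg (by positivity), le_inv_mul_iff₀ hra0]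
      linarith
  · rw [smul_inv_smul₀ hr0.ne', smul_inv_smul₀ hra0.ne']

/-- Under (x, y) ↦ (r x, r^a y) the volume scales by r^(K(1 + a)) and f equals r^N times the
rescaled family. The annulus at scale r therefore contributes O(r^(K(1 + a) - cN)), a geometric
series over dyadic r. -/
theorem negPowIntegrable_of_weight {f : 𝕜 × 𝕜 → 𝕜} {A : ℕ → ℕ → 𝕜} (hf : HasDoubleSeries f A)
    {a N : ℝ} (ha : 0 < a) (hN : ∀ i j, A i j ≠ 0 → N ≤ i + a * j) {c : ℝ} (hc : 0 < c)
    (hcN : c * N < Module.finrank ℝ 𝕜 * (1 + a)) {i j i' j' : ℕ} (hij : A i j ≠ 0)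
    (hijN : (i : ℝ) + a * j = N) (hi : c * i < Module.finrank ℝ 𝕜) (hij' : A i' j' ≠ 0)
    (hijN' : (i' : ℝ) + a * j' = N) (hj' : c * j' < Module.finrank ℝ 𝕜)
    (hmult : ∀ x₀ y₀ : 𝕜, x₀ ≠ 0 → y₀ ≠ 0 →
      c * (edgePoly A a N x₀).rootMultiplicity y₀ < Module.finrank ℝ 𝕜) :
    NegPowIntegrable f c := by
  obtain ⟨ρ, hρ, C, hs⟩ := hf
  set K := Module.finrank ℝ 𝕜 with hK
  -- The maximum matters only where A vanishes; elsewhere i + a j - N is nonnegative because the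
  -- line is supporting.
  let e : ℕ → ℕ → ℝ := fun i j => max (i + a * j - N) 0
  have he : ∀ i j, A i j ≠ 0 → e i j = i + a * j - N := fun i j h =>
    max_eq_left (by linarith [hN i j h])
  obtain ⟨ε, hε, D, hD, hbound⟩ := exists_annulus_bound (e := e) hρ hs.1
    (fun i j => le_max_right _ _) ha
    (fun i j h => by rw [he i j h, sub_eq_zero]) hc hij hijN hi hij' hijN' hj' hmult
  obtain ⟨n₀, hn₀⟩ := exists_pow_lt_of_lt_one hε (show (1 / 2 : ℝ) < 1 by norm_num)
  set s := ρ / 4 with hs'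
  have hs0 : 0 < s := by positivity
  set R : ℕ → ℝ := fun n => (1 / 2) ^ (n₀ + n) with hR
  have hR0 : ∀ n, 0 < R n := fun n => by positivity
  have hRa0 : ∀ n, 0 < R n ^ a := fun n => Real.rpow_pos_of_pos (hR0 n) _
  have hR1 : ∀ n, R n ≤ 1 := fun n => pow_le_one₀ (by norm_num) (by norm_num)
  set θ : ℝ := K * (1 + a) - c * N with hθ
  have hθ0 : 0 < θ := by linarith
  have hpiece : ∀ n, ∫⁻ v in dilation 𝕜 (hR0 n).ne' (hRa0 n).ne' '' weightedAnnulus 𝕜 s a,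
      ‖f v‖ₑ ^ (-c) ∂((addHaar : Measure 𝕜).prod (addHaar : Measure 𝕜)) ≤
      ENNReal.ofReal (((1 / 2) ^ θ) ^ (n₀ + n)) * D := by
    intro n
    rw [setLIntegral_dilation_image (hR0 n) (hRa0 n), ← hK]
    have h1 : ∀ v ∈ weightedAnnulus 𝕜 s a, ‖f (R n • v.1, (R n ^ a) • v.2)‖ₑ ^ (-c) =
        ENNReal.ofReal ((R n ^ N) ^ (-c)) * ‖weightedSeries A e (R n) v.1 [v.2]‖ₑ ^ (-c) := by
      intro v hv
      have hRN : 0 < R n ^ N := Real.rpow_pos_of_pos (hR0 n) _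
      rw [apply_dilation_eq hρ hs ha he (hR0 n) (hR1 n) (by simpa using hv.1.1)
        (by simpa using hv.1.2), enorm_mul,
        ENNReal.mul_rpow_of_ne_top enorm_ne_top enorm_ne_top,
        ← ENNReal.ofReal_rpow_of_pos hRN]
      congr 2
      rw [← ofReal_norm, RCLike.norm_ofReal, abs_of_pos hRN]
    rw [setLIntegral_congr_fun (isCompact_weightedAnnulus s a).measurableSet h1,
      lintegral_const_mul' _ _ ENNReal.ofReal_ne_top, ← mul_assoc,
      ← ENNReal.ofReal_mul (mul_nonneg (pow_nonneg (hR0 n).le _) (pow_nonneg (hRa0 n).le _))]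
    refine mul_le_mul' (ENNReal.ofReal_le_ofReal (le_of_eq ?_)) (hbound (R n) (hR0 n).le (hR1 n) ?_)
    · rw [← Real.rpow_natCast (R n), ← Real.rpow_natCast (R n ^ a), ← Real.rpow_mul (hR0 n).le,
        ← Real.rpow_mul (hR0 n).le, ← Real.rpow_add (hR0 n), ← Real.rpow_add (hR0 n),
        ← Real.rpow_natCast, ← Real.rpow_mul (by norm_num), hR]
      dsimp only
      rw [← Real.rpow_natCast, ← Real.rpow_mul (by norm_num), hθ]
      ring_nf
    · refine lt_of_le_of_lt ?_ hn₀
      exact pow_le_pow_of_le_one (by norm_num) (by norm_num) (by omega)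
  refine ⟨s * min ((1 / 2) ^ n₀) (((1 / 2) ^ a) ^ n₀), by positivity, ?_⟩
  have hsub : Metric.ball (0 : 𝕜 × 𝕜) (s * min ((1 / 2) ^ n₀) (((1 / 2) ^ a) ^ n₀)) ⊆
      {0} ∪ ⋃ n, dilation 𝕜 (hR0 n).ne' (hRa0 n).ne' '' weightedAnnulus 𝕜 s a := by
    rintro ⟨x, y⟩ hv
    by_cases h0 : (x, y) = (0 : 𝕜 × 𝕜)
    · exact Or.inl h0
    rw [mem_ball_zero_iff, Prod.norm_def, max_lt_iff] at hv
    obtain ⟨n, v, hv1, hv2⟩ := mem_image_annulus hs0 ha h0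
      (hv.1.le.trans (by gcongr; exact min_le_left _ _))
      (hv.2.le.trans (by gcongr; exact min_le_right _ _))
    exact Or.inr (Set.mem_iUnion.2 ⟨n, v, hv1, hv2.symm⟩)
  refine lt_of_le_of_lt ((lintegral_mono_set hsub).trans ((lintegral_union_le _ _ _).trans
    (add_le_add le_rfl (lintegral_iUnion_le _ _)))) ?_
  have hzero : ((addHaar : Measure 𝕜).prod (addHaar : Measure 𝕜)) {0} = 0 := by
    have : ({0} : Set (𝕜 × 𝕜)) = {0} ×ˢ {0} := by ext v; simp [Prod.ext_iff]
    rw [this, Measure.prod_prod, measure_singleton, zero_mul]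
  rw [setLIntegral_measure_zero _ _ hzero, zero_add]
  refine lt_of_le_of_lt (ENNReal.tsum_le_tsum hpiece) ?_
  rw [ENNReal.tsum_mul_right]
  refine ENNReal.mul_lt_top ?_ hD
  have hsum : Summable fun n => (((1 : ℝ) / 2) ^ θ) ^ (n₀ + n) := by
    simp only [pow_add]
    exact (summable_geometric_of_lt_one (by positivity)
      (Real.rpow_lt_one (by norm_num) (by norm_num) hθ0)).mul_left _
  rw [← ENNReal.ofReal_tsum_of_nonneg (fun n => by positivity) hsum]
  exact ENNReal.ofReal_lt_top

/-- If the roots of the polynomial of a supporting line at the diagonal have multiplicity at most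
`δ⁻¹`, the critical index is the one of the Newton polyhedron. -/
theorem indexComputedBy_self {f : 𝕜 × 𝕜 → 𝕜} (hf : AnalyticAt 𝕜 f 0)
    (h0 : taylorCoeff f 0 0 = 0) {a N : ℝ} (ha : 0 < a)
    (hN : ∀ i j, taylorCoeff f i j ≠ 0 → N ≤ i + a * j) {i j i' j' : ℕ}
    (hij : taylorCoeff f i j ≠ 0) (hijN : (i : ℝ) + a * j = N) (hi : i ≤ newtonDistInv f)
    (hij' : taylorCoeff f i' j' ≠ 0) (hijN' : (i' : ℝ) + a * j' = N) (hj' : j' ≤ newtonDistInv f)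
    (hmult : ∀ x₀ y₀ : 𝕜, x₀ ≠ 0 → y₀ ≠ 0 →
      ((edgePoly (taylorCoeff f) a N x₀).rootMultiplicity y₀ : ℝ) ≤ newtonDistInv f) :
    IndexComputedBy f f := by
  have hd := newtonDistInv_pos h0 hij
  refine le_antisymm (criticalIndex_le hf h0 hij) (le_criticalIndex fun c hc hcb => ?_)
  rw [newtonDist, ← div_eq_mul_inv, lt_div_iff₀ hd] at hcb
  have hlt : ∀ t : ℝ, t ≤ newtonDistInv f → c * t < Module.finrank ℝ 𝕜 := fun t ht =>
    lt_of_le_of_lt (by gcongr) hcb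
  refine negPowIntegrable_of_weight (hasDoubleSeries_taylorCoeff hf) ha hN hc ?_ hij hijN
    (hlt _ hi) hij' hijN' (hlt _ hj') fun x₀ y₀ hx hy => hlt _ (hmult x₀ y₀ hx hy)
  have h1 := le_newtonDistInv (f := f) (α := 1) (β := a) (N := N) zero_le_one ha.le
    (by simpa using hN) hij
  calc c * N ≤ c * ((1 + a) * newtonDistInv f) := by gcongr
    _ = (c * newtonDistInv f) * (1 + a) := by ring
    _ < _ := by gcongr

end Annuli

end PlaneGerm

namespace PlaneGerm

/-! ### The substitution y ↦ x^p (b + y) and division by powers of x -/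

section Blowup

open Polynomial

variable {𝕜 : Type*} [RCLike 𝕜]

/-- The coefficients of `f (x, x ^ p * y)`. -/
def blowupCoeff (p : ℕ) (A : ℕ → ℕ → 𝕜) (k j : ℕ) : 𝕜 :=
  if p * j ≤ k then A (k - p * j) j else 0

theorem HasDoubleSeriesOn.hasSum_blowup {f : 𝕜 × 𝕜 → 𝕜} {A : ℕ → ℕ → 𝕜} {ρ C : ℝ}
    (h : HasDoubleSeriesOn f A ρ C) (p : ℕ) {x w : 𝕜} (hx : ‖x‖ < ρ) (hw : ‖x ^ p * w‖ < ρ) :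
    HasSum (fun q : ℕ × ℕ => blowupCoeff p A q.1 q.2 * x ^ q.1 * w ^ q.2) (f (x, x ^ p * w)) := by
  have hinj : Function.Injective fun q : ℕ × ℕ => (q.1 + p * q.2, q.2) := by
    rintro ⟨i, j⟩ ⟨i', j'⟩ h
    simp only [Prod.mk.injEq] at h
    obtain ⟨h1, rfl⟩ := h
    simpa using h1
  rw [← hinj.hasSum_iff]
  · refine (h.2 x _ hx hw).congr_fun fun q => ?_
    simp only [Function.comp, blowupCoeff]
    rw [if_pos (Nat.le_add_left _ _), Nat.add_sub_cancel, mul_pow, pow_add, pow_mul]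
    ring
  · rintro ⟨k, j⟩ hk
    have : ¬ p * j ≤ k := fun hle => hk ⟨(k - p * j, j), by simp [Nat.sub_add_cancel hle]⟩
    simp [blowupCoeff, this]

theorem HasDoubleSeries.exists_le_one {f : 𝕜 × 𝕜 → 𝕜} {A : ℕ → ℕ → 𝕜} (h : HasDoubleSeries f A) :
    ∃ ρ, 0 < ρ ∧ ρ ≤ 1 ∧ ∃ C, 0 ≤ C ∧ HasDoubleSeriesOn f A ρ C := by
  obtain ⟨ρ, hρ, C, h⟩ := h
  have h' := h.mono (lt_min hρ one_pos).le (min_le_left ρ 1)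
  exact ⟨min ρ 1, lt_min hρ one_pos, min_le_right _ _, C, le_trans (by positivity) (h.1 0 0), h'⟩

theorem HasDoubleSeries.blowup {f : 𝕜 × 𝕜 → 𝕜} {A : ℕ → ℕ → 𝕜} (h : HasDoubleSeries f A) (p : ℕ) :
    HasDoubleSeries (fun v => f (v.1, v.1 ^ p * v.2)) (blowupCoeff p A) := by
  obtain ⟨ρ, hρ, hρ1, C, hC, h⟩ := h.exists_le_one
  refine ⟨ρ, hρ, C, fun k j => ?_, fun x y hx hy => h.hasSum_blowup p hx ?_⟩
  · rw [blowupCoeff]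
    split_ifs with hle
    · refine le_trans ?_ (h.1 (k - p * j) j)
      gcongr ?_ * ?_
      exact pow_le_pow_of_le_one hρ.le hρ1 (by omega)
    · simpa using hC
  · rw [norm_mul, norm_pow]
    refine lt_of_le_of_lt ?_ hy
    exact mul_le_of_le_one_left (norm_nonneg _) (pow_le_one₀ (norm_nonneg _) (hx.le.trans hρ1))

theorem HasDoubleSeries.pow_mul {f : 𝕜 × 𝕜 → 𝕜} {A : ℕ → ℕ → 𝕜} (h : HasDoubleSeries f A) (N : ℕ) :
    HasDoubleSeries (fun v => v.1 ^ N * f v) (fun k j => if N ≤ k then A (k - N) j else 0) := by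
  obtain ⟨ρ, hρ, hρ1, C, hC, h⟩ := h.exists_le_one
  refine ⟨ρ, hρ, C, fun k j => ?_, fun x y hx hy => ?_⟩
  · dsimp only
    split_ifs with hle
    · refine le_trans ?_ (h.1 (k - N) j)
      gcongr ?_ * ?_
      exact pow_le_pow_of_le_one hρ.le hρ1 (by omega)
    · simpa using hC
  · have hinj : Function.Injective fun q : ℕ × ℕ => (q.1 + N, q.2) := by
      rintro ⟨i, j⟩ ⟨i', j'⟩ h
      simpa using h
    rw [← hinj.hasSum_iff]
    · refine ((h.2 x y hx hy).mul_left (x ^ N)).congr_fun fun q => ?_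
      simp only [Function.comp]
      rw [if_pos (Nat.le_add_left _ _), Nat.add_sub_cancel, pow_add]
      ring
    · rintro ⟨k, j⟩ hk
      have : ¬ N ≤ k := fun hle => hk ⟨(k - N, j), by simp [Nat.sub_add_cancel hle]⟩
      simp [this]

theorem HasDoubleSeries.unique {f g : 𝕜 × 𝕜 → 𝕜} {A : ℕ → ℕ → 𝕜} (hf : HasDoubleSeries f A)
    (hg : HasDoubleSeries g A) : ∀ᶠ v in 𝓝 0, f v = g v := by
  obtain ⟨ρ, hρ, C, hf⟩ := hf
  obtain ⟨ρ', hρ', C', hg⟩ := hg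
  filter_upwards [Metric.ball_mem_nhds (0 : 𝕜 × 𝕜) hρ, Metric.ball_mem_nhds (0 : 𝕜 × 𝕜) hρ']
    with v h1 h2
  rw [mem_ball_zero_iff, Prod.norm_def, max_lt_iff] at h1 h2
  exact (hf.2 v.1 v.2 h1.1 h1.2).unique (hg.2 v.1 v.2 h2.1 h2.2)

theorem HasDoubleSeries.exists_eq_pow_mul {f : 𝕜 × 𝕜 → 𝕜} {A : ℕ → ℕ → 𝕜}
    (h : HasDoubleSeries f A) {N : ℕ} (hN : ∀ k < N, ∀ j, A k j = 0) :
    ∃ g, HasDoubleSeries g (fun k j => A (k + N) j) ∧ ∀ᶠ v in 𝓝 0, f v = v.1 ^ N * g v := by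
  have hg : HasDoubleSeries
      (fun v => ∑' q : ℕ × ℕ, A (q.1 + N) q.2 * v.1 ^ q.1 * v.2 ^ q.2)
      (fun k j => A (k + N) j) := by
    obtain ⟨ρ, hρ, C, h⟩ := h
    have hb : ∀ i j, ‖A (i + N) j‖ * ρ ^ (i + j) ≤ C / ρ ^ N := by
      intro i j
      rw [le_div_iff₀ (by positivity)]
      refine le_of_eq_of_le ?_ (h.1 (i + N) j)
      ring
    exact ⟨ρ, hρ, C / ρ ^ N, hb, fun x y hx hy => (summable_of_bound hρ hb hx hy).hasSum⟩
  refine ⟨_, hg, h.unique ?_⟩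
  convert hg.pow_mul N using 1
  funext k j
  split_ifs with hle
  · rw [Nat.sub_add_cancel hle]
  · exact hN k (by omega) j

theorem hasSum_eval (P : 𝕜[X]) (x : 𝕜) : HasSum (fun n => P.coeff n * x ^ n) (P.eval x) := by
  rw [eval_eq_sum_range]
  refine hasSum_sum_of_ne_finset_zero fun n hn => ?_
  rw [coeff_eq_zero_of_natDegree_lt, zero_mul]
  simpa using hn

theorem coeff_edgePoly_natCast (A : ℕ → ℕ → 𝕜) {p : ℕ} (hp : 0 < p) (k j : ℕ) :
    (edgePoly A (p : ℝ) (k : ℝ) 1).coeff j = blowupCoeff p A k j := by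
  have hp' : (0 : ℝ) < p := by exact_mod_cast hp
  rw [blowupCoeff]
  split_ifs with hle
  · rw [coeff_edgePoly A hp' 1 (i := k - p * j), one_pow, mul_one]
    rw [Nat.cast_sub hle]
    push_cast
    ring
  · by_contra hne
    obtain ⟨i, hi, -⟩ := exists_of_coeff_edgePoly_ne_zero hne
    have : i + p * j = k := by exact_mod_cast hi
    omega

theorem analyticAt_blowup {f : 𝕜 × 𝕜 → 𝕜} (hf : AnalyticAt 𝕜 f 0) {p : ℕ} (hp : 0 < p) (b : 𝕜) :
    AnalyticAt 𝕜 (fun v : 𝕜 × 𝕜 => f (v.1, v.1 ^ p * (b + v.2))) 0 := by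
  have h1 : AnalyticAt 𝕜 (fun v : 𝕜 × 𝕜 => (v.1, v.1 ^ p * (b + v.2))) 0 :=
    analyticAt_fst.prod ((analyticAt_fst.pow p).mul (analyticAt_const.add analyticAt_snd))
  refine AnalyticAt.comp (g := f) (f := fun v : 𝕜 × 𝕜 => (v.1, v.1 ^ p * (b + v.2))) ?_ h1
  simp only [Prod.fst_zero, zero_pow hp.ne', zero_mul]
  exact hf

/-- The coefficient of x^k in f(x, x^p w) is the edge polynomial of level k at w, and w = b + y is a
Taylor shift. Differentiating in x before y makes this an identity of polynomials valid for all w,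
hence the preliminary swap. -/
theorem taylorCoeff_blowup {f : 𝕜 × 𝕜 → 𝕜} (hf : AnalyticAt 𝕜 f 0) {p : ℕ} (hp : 0 < p) (b : 𝕜)
    (k l : ℕ) : taylorCoeff (fun v => f (v.1, v.1 ^ p * (b + v.2))) k l =
      (taylor b (edgePoly (taylorCoeff f) (p : ℝ) (k : ℝ) 1)).coeff l := by
  set P := edgePoly (taylorCoeff f) (p : ℝ) (k : ℝ) 1
  rw [← taylorCoeff_swap (analyticAt_blowup hf hp b), taylorCoeff]
  have h1 : ∀ w : 𝕜, iteratedDeriv k (fun x => f (x, x ^ p * w)) 0 = k.factorial * P.eval w := by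
    intro w
    obtain ⟨ρ, hρ, C, h⟩ := hasDoubleSeries_taylorCoeff hf
    refine iteratedDeriv_of_hasSum
      (c := fun k => (edgePoly (taylorCoeff f) (p : ℝ) (k : ℝ) 1).eval w) ?_ k
    have hcont : Tendsto (fun x : 𝕜 => x ^ p * w) (𝓝 0) (𝓝 0) :=
      Continuous.tendsto' (by fun_prop) _ _ (by simp [hp.ne'])
    filter_upwards [eventually_norm_lt hρ, hcont.eventually (eventually_norm_lt hρ)] with x hx hw
    refine (h.hasSum_blowup p hx hw).prod_fiberwise fun k => ?_
    refine ((hasSum_eval (edgePoly (taylorCoeff f) (p : ℝ) (k : ℝ) 1) w).mul_right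
      (x ^ k)).congr_fun fun j => ?_
    rw [coeff_edgePoly_natCast _ hp]
    ring
  have h2 : iteratedDeriv l (fun x : 𝕜 => iteratedDeriv k (fun y => f (y, y ^ p * (b + x))) 0) 0 =
      l.factorial * (k.factorial * (taylor b P).coeff l) := by
    refine iteratedDeriv_of_hasSum (c := fun l => k.factorial * (taylor b P).coeff l) ?_ l
    refine Eventually.of_forall fun x => ?_
    rw [h1]
    have := (hasSum_eval (taylor b P) x).mul_left (k.factorial : 𝕜)
    rw [taylor_eval, add_comm x b] at this
    exact this.congr_fun fun n => by ring
  dsimp only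
  rw [h2]
  have := Nat.factorial_ne_zero l
  have := Nat.factorial_ne_zero k
  field_simp

end Blowup

/-! ### The implicit function theorem and the Tschirnhaus shear -/

section Implicit

variable {𝕜 : Type*} [RCLike 𝕜]

/-- The partial derivative with respect to the second variable. -/
noncomputable def derivSnd (g : 𝕜 × 𝕜 → 𝕜) : 𝕜 × 𝕜 → 𝕜 := fun u => fderiv 𝕜 g u (0, 1)

theorem analyticAt_derivSnd {g : 𝕜 × 𝕜 → 𝕜} {u : 𝕜 × 𝕜} (hg : AnalyticAt 𝕜 g u) :
    AnalyticAt 𝕜 (derivSnd g) u :=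
  ((ContinuousLinearMap.apply 𝕜 𝕜 ((0, 1) : 𝕜 × 𝕜)).analyticAt _).comp hg.fderiv

theorem analyticAt_iterate_derivSnd {g : 𝕜 × 𝕜 → 𝕜} {u : 𝕜 × 𝕜} (hg : AnalyticAt 𝕜 g u) (n : ℕ) :
    AnalyticAt 𝕜 (derivSnd^[n] g) u := by
  induction n with
  | zero => exact hg
  | succ n ih =>
    rw [Function.iterate_succ_apply']
    exact analyticAt_derivSnd ih

/-- Taylor coefficients are iterated derivatives in one variable, whereas the implicit function
theorem needs an analytic function on the plane; this links the two. -/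
theorem eventually_iteratedDeriv_eq {g : 𝕜 × 𝕜 → 𝕜} (hg : AnalyticAt 𝕜 g 0) (n : ℕ) :
    ∀ᶠ u in 𝓝 (0 : 𝕜 × 𝕜), iteratedDeriv n (fun y => g (u.1, y)) u.2 = (derivSnd^[n] g) u := by
  induction n with
  | zero => exact Eventually.of_forall fun u => by simp
  | succ n ih =>
    filter_upwards [eventually_eventually_nhds.2 ih,
      (analyticAt_iterate_derivSnd hg n).eventually_analyticAt] with u h1 h2
    rw [iteratedDeriv_succ, Function.iterate_succ_apply']
    have hc : Tendsto (fun y : 𝕜 => (u.1, y)) (𝓝 u.2) (𝓝 u) :=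
      Continuous.tendsto' (by fun_prop) _ _ rfl
    have h3 : iteratedDeriv n (fun y => g (u.1, y)) =ᶠ[𝓝 u.2] fun y => (derivSnd^[n] g) (u.1, y) :=
      hc.eventually h1
    rw [h3.deriv_eq]
    have h4 : HasDerivAt (fun y : 𝕜 => (u.1, y)) ((0, 1) : 𝕜 × 𝕜) u.2 :=
      (hasDerivAt_const _ _).prodMk (hasDerivAt_id _)
    have h5 : HasFDerivAt (derivSnd^[n] g) (fderiv 𝕜 (derivSnd^[n] g) u) ((fun y : 𝕜 => (u.1, y)) u.2) :=
      h2.differentiableAt.hasFDerivAt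
    exact (h5.comp_hasDerivAt u.2 h4).deriv

theorem exists_implicit {φ : 𝕜 × 𝕜 → 𝕜} (hφ : AnalyticAt 𝕜 φ 0) (h0 : φ 0 = 0)
    (h1 : derivSnd φ 0 ≠ 0) :
    ∃ ψ : 𝕜 → 𝕜, AnalyticAt 𝕜 ψ 0 ∧ ψ 0 = 0 ∧ ∀ᶠ x in 𝓝 0, φ (x, ψ x) = 0 := by
  have hcd : ContDiffAt 𝕜 ⊤ φ 0 := hφ.contDiffAt
  have hinv : (fderiv 𝕜 φ 0 ∘L .inr 𝕜 𝕜 𝕜).IsInvertible := by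
    refine ⟨ContinuousLinearEquiv.unitsEquivAut 𝕜 (Units.mk0 _ h1), ?_⟩
    ext
    simp [derivSnd]
  refine ⟨hcd.implicitFunction (by simp) hinv, ?_, hcd.implicitFunction_apply_self _ _, ?_⟩
  · exact (hcd.contDiffAt_implicitFunction (by simp) hinv).analyticAt
  · have := hcd.eventually_apply_implicitFunction (by simp) hinv
    rwa [h0] at this

theorem taylorCoeff_zero_left (g : 𝕜 × 𝕜 → 𝕜) (l : ℕ) :
    taylorCoeff g 0 l = iteratedDeriv l (fun y => g (0, y)) 0 / l.factorial := by
  simp [taylorCoeff]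

/-- Completing the power: a shear that removes all terms of degree `n` in `y`, if `n + 1` is the
order of `g (0, y)`. -/
theorem exists_tschirnhaus {g : 𝕜 × 𝕜 → 𝕜} (hg : AnalyticAt 𝕜 g 0) {n : ℕ}
    (h0 : taylorCoeff g 0 n = 0) (h1 : taylorCoeff g 0 (n + 1) ≠ 0) :
    ∃ ψ : 𝕜 → 𝕜, AnalyticAt 𝕜 ψ 0 ∧ ψ 0 = 0 ∧ ∀ i, taylorCoeff (inShearY ψ g) i n = 0 := by
  have hn := (eventually_iteratedDeriv_eq hg n).self_of_nhds
  have hn1 := (eventually_iteratedDeriv_eq hg (n + 1)).self_of_nhds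
  rw [taylorCoeff_zero_left] at h0 h1
  -- The curve y = ψ(x) is the zero set of the n-th y-derivative, whose own y-derivative at 0 is a
  -- nonzero multiple of the coefficient of y^(n+1).
  obtain ⟨ψ, hψ, hψ0, hz⟩ := exists_implicit (analyticAt_iterate_derivSnd hg n)
    (by
      rw [← hn]
      rw [div_eq_zero_iff] at h0
      exact h0.resolve_right (by exact_mod_cast n.factorial_ne_zero))
    (by
      rw [Function.iterate_succ_apply'] at hn1
      rw [← hn1]
      exact fun h => h1 (div_eq_zero_iff.2 (Or.inl h)))
  refine ⟨ψ, hψ, hψ0, fun i => ?_⟩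
  have hev : (fun x => iteratedDeriv n (fun y => inShearY ψ g (x, y)) 0) =ᶠ[𝓝 0] fun _ => 0 := by
    have hc : Tendsto (fun x : 𝕜 => (x, ψ x)) (𝓝 0) (𝓝 (0 : 𝕜 × 𝕜)) := by
      have := (continuousAt_id.prodMk hψ.continuousAt).tendsto
      rw [id, hψ0] at this
      exact this
    filter_upwards [hz, hc.eventually (eventually_iteratedDeriv_eq hg n)] with x hx hx'
    rw [hx] at hx'
    simp only [inShearY]
    rw [iteratedDeriv_comp_add_const n (fun y => g (x, y)) (ψ x)]
    simpa using hx'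
  rw [taylorCoeff, hev.iteratedDeriv_eq]
  simp

end Implicit

end PlaneGerm

namespace PlaneGerm

/-! ### Iterated shears and descent on the multiplicity -/

section Core

open Polynomial

variable {𝕜 : Type*} [RCLike 𝕜]

theorem analyticAt_inShearY {f : 𝕜 × 𝕜 → 𝕜} (hf : AnalyticAt 𝕜 f 0) {Q : 𝕜 → 𝕜}
    (hQ : AnalyticAt 𝕜 Q 0) (hQ0 : Q 0 = 0) : AnalyticAt 𝕜 (inShearY Q f) 0 := by
  have hQ' : AnalyticAt 𝕜 (fun v : 𝕜 × 𝕜 => Q v.1) 0 :=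
    AnalyticAt.comp (g := Q) (f := fun v : 𝕜 × 𝕜 => v.1) hQ analyticAt_fst
  refine AnalyticAt.comp (g := f) (f := fun v : 𝕜 × 𝕜 => (v.1, v.2 + Q v.1)) ?_
    (analyticAt_fst.prod (analyticAt_snd.add hQ'))
  simp only [Prod.fst_zero, Prod.snd_zero, hQ0, add_zero]
  exact hf

/-- A shear along a multiple root of an edge polynomial with integral slope. -/
theorem exists_adapted_shear {f : 𝕜 × 𝕜 → 𝕜} (hf : AnalyticAt 𝕜 f 0) {p : ℕ} (hp : 0 < p) {N : ℕ}
    (hmin : ∀ i j, taylorCoeff f i j ≠ 0 → N ≤ i + p * j) (b : 𝕜) {n : ℕ}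
    (hP : edgePoly (taylorCoeff f) (p : ℝ) (N : ℝ) 1 ≠ 0)
    (hn : (edgePoly (taylorCoeff f) (p : ℝ) (N : ℝ) 1).rootMultiplicity b = n + 1) :
    ∃ Q : 𝕜 → 𝕜, AnalyticAt 𝕜 Q 0 ∧ Q 0 = 0 ∧
      (∀ i j, taylorCoeff (inShearY Q f) i j ≠ 0 → N ≤ i + p * j) ∧
      (∃ A, taylorCoeff (inShearY Q f) A (n + 1) ≠ 0 ∧ A + p * (n + 1) = N) ∧
      (∀ i j, i + p * j = N → j < n + 1 → taylorCoeff (inShearY Q f) i j = 0) ∧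
      ∀ i, taylorCoeff (inShearY Q f) i n = 0 := by
  set P := edgePoly (taylorCoeff f) (p : ℝ) (N : ℝ) 1 with hPdef
  set h : 𝕜 × 𝕜 → 𝕜 := fun v => f (v.1, v.1 ^ p * (b + v.2)) with hh
  have hzero : ∀ k < N, ∀ j, taylorCoeff h k j = 0 := by
    intro k hk j
    rw [hh, taylorCoeff_blowup hf hp b]
    have : edgePoly (taylorCoeff f) (p : ℝ) (k : ℝ) 1 = 0 := by
      ext j
      rw [coeff_edgePoly_natCast _ hp, coeff_zero, blowupCoeff]
      split_ifs with hle
      · by_contra hne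
        have := hmin _ _ hne
        omega
      · rfl
    rw [this, map_zero, coeff_zero]
  -- All levels below N vanish, so f(x, x^p (b + y)) = x^N g, and g(0, y) = P(b + y) has order
  -- exactly n + 1.
  obtain ⟨g, hg, hhg⟩ :=
    (hasDoubleSeries_taylorCoeff (analyticAt_blowup hf hp b)).exists_eq_pow_mul hzero
  have hgc : ∀ l, taylorCoeff g 0 l = (taylor b P).coeff l := by
    intro l
    rw [hg.taylorCoeff_eq]
    dsimp only
    rw [zero_add, taylorCoeff_blowup hf hp b]
  have htr : (taylor b P).natTrailingDegree = n + 1 := by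
    rw [← hn, rootMultiplicity_eq_natTrailingDegree]; rfl
  have hg_lt : ∀ l < n + 1, taylorCoeff g 0 l = 0 := fun l hl => by
    rw [hgc]; exact coeff_eq_zero_of_lt_natTrailingDegree (by omega)
  have hg_eq : taylorCoeff g 0 (n + 1) ≠ 0 := by
    have h0 : taylor b P ≠ 0 := fun h => hP (taylor_injective b (by rw [h, map_zero]))
    rw [hgc, ← htr]
    exact trailingCoeff_nonzero_iff_nonzero.2 h0
  obtain ⟨ψ, hψ, hψ0, hψn⟩ := exists_tschirnhaus hg.analyticAt (hg_lt n n.lt_succ_self) hg_eq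
  set G := inShearY ψ g with hG
  have hG0 : ∀ l, taylorCoeff G 0 l = taylorCoeff g 0 l := by
    intro l
    rw [taylorCoeff_zero_left, taylorCoeff_zero_left]
    simp only [hG, inShearY, hψ0, add_zero]
  -- The shear of g by ψ corresponds to this shear of f, and blowing up the sheared f gives x^N G.
  set Q : 𝕜 → 𝕜 := fun x => x ^ p * (b + ψ x) with hQdef
  have hQ : AnalyticAt 𝕜 Q 0 := (analyticAt_id.pow p).mul (analyticAt_const.add hψ)
  have hQ0 : Q 0 = 0 := by simp [hQdef, hp.ne']
  have hev : ∀ᶠ v in 𝓝 (0 : 𝕜 × 𝕜),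
      inShearY Q f (v.1, v.1 ^ p * v.2) = v.1 ^ N * G v := by
    have hc : Tendsto (fun v : 𝕜 × 𝕜 => (v.1, v.2 + ψ v.1)) (𝓝 0) (𝓝 0) := by
      have h1 : ContinuousAt (fun v : 𝕜 × 𝕜 => ψ v.1) 0 :=
        ContinuousAt.comp (g := ψ) (f := Prod.fst) (x := (0 : 𝕜 × 𝕜)) hψ.continuousAt continuousAt_fst
      have h2 : ContinuousAt (fun v : 𝕜 × 𝕜 => (v.1, v.2 + ψ v.1)) 0 :=
        continuousAt_fst.prodMk (continuousAt_snd.add h1)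
      have h3 := h2.tendsto
      simp only [Prod.fst_zero, Prod.snd_zero, hψ0, add_zero] at h3
      exact h3
    filter_upwards [hc.eventually hhg] with v hv
    simp only [hG, inShearY]
    rw [← hv]
    simp only [hQdef]
    congr 2
    ring
  have hcoef : blowupCoeff p (taylorCoeff (inShearY Q f)) =
      fun k j => if N ≤ k then taylorCoeff G (k - N) j else 0 := by
    have h1 := (hasDoubleSeries_taylorCoeff (analyticAt_inShearY hf hQ hQ0)).blowup p
    have h2 := (hasDoubleSeries_taylorCoeff (analyticAt_inShearY hg.analyticAt hψ hψ0)).pow_mul N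
    rw [← h1.taylorCoeff_eq, ← (h2.eventuallyEq hev).taylorCoeff_eq]
  have hval : ∀ i j, taylorCoeff (inShearY Q f) i j =
      if N ≤ i + p * j then taylorCoeff G (i + p * j - N) j else 0 := by
    intro i j
    have := congrFun (congrFun hcoef (i + p * j)) j
    rwa [blowupCoeff, if_pos (Nat.le_add_left _ _), Nat.add_sub_cancel] at this
  refine ⟨Q, hQ, hQ0, fun i j hij => ?_, ?_, fun i j hij hj => ?_, fun i => ?_⟩
  · by_contra hlt
    exact hij (by rw [hval, if_neg hlt])
  · have h1 := congrFun (congrFun hcoef N) (n + 1)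
    rw [if_pos le_rfl, Nat.sub_self, hG0, blowupCoeff] at h1
    split_ifs at h1 with hle
    · exact ⟨N - p * (n + 1), by rw [h1]; exact hg_eq, Nat.sub_add_cancel hle⟩
    · exact absurd h1.symm hg_eq
  · rw [hval, if_pos hij.ge, hij, Nat.sub_self, hG0, hg_lt j hj]
  · rw [hval]
    split_ifs
    · exact hψn _
    · rfl

theorem inShearY_inShearY (Q₁ Q₂ : 𝕜 → 𝕜) (f : 𝕜 × 𝕜 → 𝕜) :
    inShearY Q₂ (inShearY Q₁ f) = inShearY (Q₁ + Q₂) f := by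
  funext v
  simp only [inShearY, Pi.add_apply]
  congr 2
  ring

/-- The edge polynomials at different values of `x` are related by dilation. -/
theorem pow_dvd_edgePoly_one {A : ℕ → ℕ → 𝕜} {p : ℕ} (hp : 0 < p) {N : ℕ} {x y : 𝕜} (hx : x ≠ 0)
    {k : ℕ} (h : (X - C y) ^ k ∣ edgePoly A (p : ℝ) (N : ℝ) x) :
    (X - C (y / x ^ p)) ^ k ∣ edgePoly A (p : ℝ) (N : ℝ) 1 := by
  have hp' : (0 : ℝ) < p := by exact_mod_cast hp
  have hxp : x ^ p ≠ 0 := pow_ne_zero _ hx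
  have h1 : (edgePoly A (p : ℝ) (N : ℝ) x).comp (C (x ^ p) * X) =
      C (x ^ N) * edgePoly A (p : ℝ) (N : ℝ) 1 := by
    ext j
    rw [comp_C_mul_X_coeff, coeff_C_mul]
    by_cases hj : ∃ i : ℕ, (i : ℝ) + (p : ℝ) * j = N
    · obtain ⟨i, hi⟩ := hj
      rw [coeff_edgePoly A hp' x hi, coeff_edgePoly A hp' 1 hi, one_pow, mul_one]
      have : i + p * j = N := by exact_mod_cast hi
      rw [← this, pow_add, pow_mul]
      ring
    · have hz : ∀ z : 𝕜, (edgePoly A (p : ℝ) (N : ℝ) z).coeff j = 0 := by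
        intro z
        by_contra hne
        obtain ⟨i, hi, -⟩ := exists_of_coeff_edgePoly_ne_zero hne
        exact hj ⟨i, hi⟩
      rw [hz, hz]; ring
  obtain ⟨R, hR⟩ := h
  have h2 : (X - C y).comp (C (x ^ p) * X) = C (x ^ p) * (X - C (y / x ^ p)) := by
    rw [sub_comp, X_comp, C_comp, mul_sub, ← C_mul, mul_div_cancel₀ _ hxp]
  rw [hR, mul_comp, pow_comp, h2, mul_pow] at h1
  have hu : IsUnit (C (x ^ N)) := isUnit_C.2 (pow_ne_zero N hx).isUnit
  rw [← hu.dvd_mul_left, ← h1]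
  exact Dvd.dvd.mul_right (Dvd.intro_left _ rfl) _

theorem eq_C_mul_of_pow_dvd {K : Type*} [Field K] {P : K[X]} {y : K} {n : ℕ}
    (h : (X - C y) ^ n ∣ P) (hdeg : P.natDegree ≤ n) : ∃ c, P = C c * (X - C y) ^ n := by
  obtain ⟨R, rfl⟩ := h
  by_cases hR : R = 0
  · exact ⟨0, by rw [hR]; simp⟩
  rw [((monic_X_sub_C y).pow n).natDegree_mul' hR, natDegree_pow, natDegree_X_sub_C] at hdeg
  rw [natDegree_eq_zero.1 (show R.natDegree = 0 by omega) |>.choose_spec.symm]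
  exact ⟨_, mul_comm _ _⟩

/-- A polynomial of degree at most `n + 1` without term of degree `n` has no root of multiplicity
`n + 1` except `0`. -/
theorem not_pow_dvd_of_coeff_eq_zero {K : Type*} [Field K] [CharZero K] {P : K[X]} (hP : P ≠ 0)
    {y : K} (hy : y ≠ 0) {n : ℕ} (hdeg : P.natDegree ≤ n + 1) (hn : P.coeff n = 0) :
    ¬ (X - C y) ^ (n + 1) ∣ P := by
  intro h
  obtain ⟨c, rfl⟩ := eq_C_mul_of_pow_dvd h hdeg
  have hc : c ≠ 0 := by
    rintro rfl
    simp at hP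
  rw [coeff_C_mul, sub_eq_add_neg, ← C_neg, coeff_X_add_C_pow] at hn
  simp only [Nat.add_sub_cancel_left, pow_one, Nat.choose_succ_self_right] at hn
  have : ((n + 1 : ℕ) : K) ≠ 0 := by exact_mod_cast n.succ_ne_zero
  simp_all

/-- Shear along the multiple root. Either the multiplicities of the new function F are small enough
for its index to be read off, or F has an offending root again, on an edge with a larger integral
exponent and of strictly smaller multiplicity. The shears add up, so strong induction on M applies.
-/
theorem exists_shear_indexComputedBy (M : ℕ) : ∀ (f : 𝕜 × 𝕜 → 𝕜), AnalyticAt 𝕜 f 0 → f 0 = 0 →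
    ∀ (p : ℕ), 0 < p → ∀ (N : ℕ), (∀ i j, taylorCoeff f i j ≠ 0 → N ≤ i + p * j) →
    ∀ b : 𝕜, b ≠ 0 → edgePoly (taylorCoeff f) (p : ℝ) (N : ℝ) 1 ≠ 0 →
    (edgePoly (taylorCoeff f) (p : ℝ) (N : ℝ) 1).rootMultiplicity b = M → newtonDistInv f < M →
    ∃ Q : 𝕜 → 𝕜, AnalyticAt 𝕜 Q 0 ∧ Q 0 = 0 ∧ IndexComputedBy f (inShearY Q f) := by
  induction M using Nat.strong_induction_on with
  | _ M ih =>
  intro f hf hf0 p hp N hmin b hb hP hM hdM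
  have hp' : (0 : ℝ) < p := by exact_mod_cast hp
  have hp1 : (1 : ℝ) ≤ p := by exact_mod_cast hp
  have hd0 := newtonDistInv_nonneg f
  set d := newtonDistInv f with hd
  obtain ⟨n, rfl⟩ : ∃ n, M = n + 1 := Nat.exists_eq_succ_of_ne_zero (by
    rintro rfl
    rw [Nat.cast_zero] at hdM
    linarith)
  have hNd : (N : ℝ) = (1 + p) * d := by
    obtain ⟨_, _, _, _, _, _, _, h, _⟩ := edge_of_lt_multiplicity hp'
      (fun i j h => by exact_mod_cast hmin i j h) hP
      (fun _ h => exists_of_coeff_edgePoly_ne_zero h) hb (pow_rootMultiplicity_dvd _ b)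
      (by rw [hM]; exact hdM)
    exact h
  obtain ⟨Q, hQ, hQ0, hmin', ⟨A, hA, hAN⟩, hlow, hgap⟩ := exists_adapted_shear hf hp hmin b hP hM
  set F := inShearY Q f with hF
  have hFan : AnalyticAt 𝕜 F 0 := analyticAt_inShearY hf hQ hQ0
  have hF0 : F 0 = 0 := by
    change f (0, 0 + Q 0) = 0
    rw [hQ0, add_zero]
    exact hf0
  have hT0 : taylorCoeff F 0 0 = 0 := by rw [taylorCoeff_zero_zero, hF0]
  have hindex : criticalIndex F = criticalIndex f := criticalIndex_inShearY f hQ hQ0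
  set d' := newtonDistInv F with hd'
  have hdd' : d ≤ d' := by
    have h1 := le_newtonDistInv (f := F) (α := 1) (β := p) (N := N) zero_le_one hp'.le
      (fun i j h => by rw [one_mul]; exact_mod_cast hmin' i j h) hA
    rw [hNd] at h1
    exact le_of_mul_le_mul_left h1 (by positivity)
  obtain ⟨a, N', ha, hw, ⟨A₁, B₁, h1, e1, l1⟩, A₂, B₂, h2, e2, l2⟩ := exists_main_weight hT0 hA
  by_cases hmult : ∀ x₀ y₀ : 𝕜, x₀ ≠ 0 → y₀ ≠ 0 →
      ((edgePoly (taylorCoeff F) a N' x₀).rootMultiplicity y₀ : ℝ) ≤ d'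
  · refine ⟨Q, hQ, hQ0, ?_⟩
    have := indexComputedBy_self hFan hT0 ha hw h1 e1 l1 h2 e2 l2 hmult
    rw [IndexComputedBy, hindex] at this
    exact this
  push Not at hmult
  obtain ⟨x₀, y₀, hx₀, hy₀, hk⟩ := hmult
  have hAN' : (A : ℝ) + p * (n + 1 : ℕ) = N := by exact_mod_cast hAN
  have hAw := hw _ _ hA
  obtain ⟨p', q', hp'0, hq'0, -, hapq, hor, hN'd, -, A', -, -, hA', eA', -, -, -, hB'⟩ :=
    edge_of_lt_multiplicity ha hw (edgePoly_ne_zero ha hx₀ e1 h1)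
      (fun _ h => exists_of_coeff_edgePoly_ne_zero h) hy₀ (pow_rootMultiplicity_dvd _ y₀) hk
  -- The old line passes through (A, n + 1), and n + 1 > d. A supporting weight a < p would then
  -- give d' < d, against d ≤ d'. If a = p the two lines coincide, but the old line carries no
  -- monomial below height n + 1, whereas the new edge has one below d.
  have hap : (p : ℝ) < a := by
    by_contra! hle
    have hineq : (1 + a) * d' ≤ (1 + p) * d - (p - a) * (n + 1 : ℕ) := by
      rw [← hN'd, ← hNd]; linarith
    rcases hle.eq_or_lt with rfl | hlt
    · have hdeq : d' = d := by
        refine le_antisymm ?_ hdd'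
        rw [sub_self, zero_mul, sub_zero] at hineq
        exact le_of_mul_le_mul_left hineq (by positivity)
      refine hA' (hlow _ _ ?_ ?_)
      · have : N' = N := by rw [hN'd, hNd, ← hd', hdeq]
        exact_mod_cast eA'.trans this
      · have : ((edgePoly (taylorCoeff F) p N' x₀).natTrailingDegree : ℝ) < (n + 1 : ℕ) :=
          hB'.trans_le (by rw [← hd', hdeq]; exact hdM.le)
        exact_mod_cast this
    · have h3 : (p - a) * d < (p - a) * (n + 1 : ℕ) :=
        mul_lt_mul_of_pos_left hdM (by linarith)
      have h4 : (1 + a) * d ≤ (1 + a) * d' := by gcongr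
      linarith
  -- The alternative p' = 1 gives a ≤ 1 ≤ p.
  obtain rfl : q' = 1 := by
    rcases hor with rfl | h
    · exfalso
      have hq1 : (1 : ℝ) ≤ q' := by exact_mod_cast hq'0
      have : a ≤ 1 := by
        rw [hapq, Nat.cast_one]
        exact (div_le_one (by linarith)).2 hq1
      linarith
    · exact h
  have hap' : a = p' := by rw [hapq]; simp
  subst hap'
  obtain ⟨N₁, rfl⟩ : ∃ N₁ : ℕ, N' = N₁ := ⟨A₁ + p' * B₁, by rw [← e1]; push_cast; ring⟩
  have hP1 : edgePoly (taylorCoeff F) (p' : ℝ) (N₁ : ℝ) 1 ≠ 0 :=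
    edgePoly_ne_zero ha one_ne_zero e1 h1
  set P₁ := edgePoly (taylorCoeff F) (p' : ℝ) (N₁ : ℝ) 1 with hP₁
  set b' := y₀ / x₀ ^ p' with hb'
  have hb'0 : b' ≠ 0 := div_ne_zero hy₀ (pow_ne_zero _ hx₀)
  have hk' : d' < P₁.rootMultiplicity b' := by
    refine hk.trans_le ?_
    have := (le_rootMultiplicity_iff hP1).2
      (pow_dvd_edgePoly_one hp'0 hx₀ (pow_rootMultiplicity_dvd _ y₀))
    exact_mod_cast this
  obtain ⟨_, _, -, -, -, -, -, -, A₃, -, hA₃, eA₃, -⟩ :=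
    edge_of_lt_multiplicity ha hw hP1 (fun _ h => exists_of_coeff_edgePoly_ne_zero h) hb'0 (pow_rootMultiplicity_dvd _ b') hk'
  -- All monomials lie on or above the line of weight p through (A, n + 1), and this point is on or
  -- above the new line. As p' > p, the new edge cannot rise above height n + 1.
  have hdeg : P₁.natDegree ≤ n + 1 := by
    have h3 : (N : ℝ) ≤ A₃ + p * P₁.natDegree := by exact_mod_cast hmin' _ _ hA₃
    have h4 : ((p' : ℝ) - p) * P₁.natDegree ≤ ((p' : ℝ) - p) * (n + 1 : ℕ) := by linarith
    exact_mod_cast le_of_mul_le_mul_left h4 (by linarith)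
  have hle : P₁.rootMultiplicity b' ≤ n + 1 := by
    have := natDegree_le_of_dvd (pow_rootMultiplicity_dvd P₁ b') hP1
    rw [natDegree_pow, natDegree_X_sub_C, mul_one] at this
    omega
  -- A nonzero root of multiplicity n + 1 would make P₁ a multiple of (X - b')^(n+1), whose
  -- coefficient of X^n is nonzero; the shear has removed that coefficient.
  have hne : P₁.rootMultiplicity b' ≠ n + 1 := by
    intro heq
    have hdvd := pow_rootMultiplicity_dvd P₁ b'
    rw [heq] at hdvd
    refine not_pow_dvd_of_coeff_eq_zero hP1 hb'0 hdeg ?_ hdvd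
    rw [hP₁, coeff_edgePoly_natCast _ hp'0, blowupCoeff]
    split_ifs
    · exact hgap _
    · rfl
  obtain ⟨Q', hQ', hQ'0, hI⟩ := ih _ (lt_of_le_of_ne hle hne) F hFan hF0 p' hp'0 N₁
    (fun i j h => by exact_mod_cast hw i j h) b' hb'0 hP1 rfl hk'
  refine ⟨Q + Q', hQ.add hQ', by simp [hQ0, hQ'0], ?_⟩
  rw [IndexComputedBy, hindex, hF, inShearY_inShearY] at hI
  exact hI

end Core

end PlaneGerm

namespace PlaneGerm

/-! ### Complex roots, exchange of variables and the conclusion -/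

section Main

open Polynomial

variable {𝕜 : Type*} [RCLike 𝕜]

theorem newtonDistInv_swap {f : 𝕜 × 𝕜 → 𝕜} (hf : AnalyticAt 𝕜 f 0) :
    (newtonDistInv fun v => f (v.2, v.1)) = newtonDistInv f := by
  have h1 : newtonPolyhedron (fun v => f (v.2, v.1)) =
      LinearEquiv.prodComm ℝ ℝ ℝ '' newtonPolyhedron f := by
    refine Eq.trans ?_ (LinearMap.image_convexHull
      (LinearEquiv.prodComm ℝ ℝ ℝ).toLinearMap _).symm
    rw [newtonPolyhedron]
    congr 1
    ext v
    simp only [Set.mem_image, Set.mem_ofPred_eq, taylorCoeff_swap hf]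
    constructor
    · rintro ⟨p, q, h, hp, hq⟩
      exact ⟨(v.2, v.1), ⟨q, p, h, hq, hp⟩, rfl⟩
    · rintro ⟨w, ⟨p, q, h, hp, hq⟩, rfl⟩
      exact ⟨q, p, h, hq, hp⟩
  rw [newtonDistInv, newtonDistInv, h1]
  congr 1
  ext t
  simp only [Set.mem_ofPred_eq, Set.mem_image]
  refine and_congr_right fun _ => ⟨?_, fun h => ⟨(t, t), h, rfl⟩⟩
  rintro ⟨w, hw, he⟩
  have hw' : w = (t, t) := by
    have := Prod.ext_iff.1 he
    exact Prod.ext this.2 this.1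
  rwa [← hw']

/-- The two cases are 𝕜 = ℂ and 𝕜 = ℝ, separated by whether the abstract imaginary unit is zero. -/
theorem mem_range_toComplex_or (𝕜 : Type*) [RCLike 𝕜] :
    Function.Surjective (toComplex 𝕜) ∨ ∀ z, starRingEnd ℂ (toComplex 𝕜 z) = toComplex 𝕜 z := by
  rcases RCLike.I_mul_I_ax (K := 𝕜) with h | h
  · right
    intro z
    have him : RCLike.im z = 0 := by
      have := RCLike.I_im z
      rw [h, map_zero, mul_zero] at this
      exact this.symm
    apply Complex.ext
    · simp
    · simp [toComplex, him]
  · left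
    intro b
    have hI : RCLike.im (RCLike.I : 𝕜) = 1 := by
      have h1 := RCLike.I_im (RCLike.I : 𝕜)
      have h2 : RCLike.im (RCLike.I : 𝕜) ≠ 0 := by
        intro h0
        have := congrArg RCLike.re h
        rw [RCLike.mul_re, h0, RCLike.I_re] at this
        simp at this
      exact mul_right_cancel₀ h2 (by rw [h1, one_mul])
    refine ⟨(b.re : 𝕜) + (b.im : 𝕜) * RCLike.I, ?_⟩
    apply Complex.ext
    · simp [toComplex]
    · simp [toComplex, hI]

theorem toComplex_ofReal (t : ℝ) : toComplex 𝕜 (t : 𝕜) = t := by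
  apply Complex.ext <;> simp [toComplex]

/-- A root of a real polynomial is real, or its conjugate is a root of the same multiplicity. -/
theorem exists_root_or_two_mul_le {P : 𝕜[X]} (hP : P ≠ 0) {b : ℂ} {m : ℕ}
    (h : (X - C b) ^ m ∣ P.map (toComplex 𝕜)) :
    (∃ β : 𝕜, toComplex 𝕜 β = b ∧ (X - C β) ^ m ∣ P) ∨ 2 * m ≤ P.natDegree := by
  by_cases hb : ∃ β, toComplex 𝕜 β = b
  · obtain ⟨β, rfl⟩ := hb
    refine Or.inl ⟨β, rfl, ?_⟩
    rw [← map_dvd_map' (toComplex 𝕜)]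
    simpa using h
  right
  have hconj : ∀ z, starRingEnd ℂ (toComplex 𝕜 z) = toComplex 𝕜 z :=
    (mem_range_toComplex_or 𝕜).resolve_left fun hs => hb (hs b)
  have hne : b ≠ starRingEnd ℂ b := by
    intro he
    refine hb ⟨(b.re : 𝕜), ?_⟩
    rw [toComplex_ofReal]
    exact Complex.conj_eq_iff_re.1 he.symm
  have h2 : (X - C (starRingEnd ℂ b)) ^ m ∣ P.map (toComplex 𝕜) := by
    have h3 := Polynomial.map_dvd (starRingEnd ℂ) h
    rw [Polynomial.map_map, Polynomial.map_pow, Polynomial.map_sub, map_X, map_C] at h3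
    have : (starRingEnd ℂ).comp (toComplex 𝕜) = toComplex 𝕜 := RingHom.ext hconj
    rwa [this] at h3
  have hcop : IsCoprime ((X - C b) ^ m) ((X - C (starRingEnd ℂ b)) ^ m) :=
    (isCoprime_X_sub_C_of_isUnit_sub (sub_ne_zero.2 hne).isUnit).pow
  have hP' : P.map (toComplex 𝕜) ≠ 0 := (Polynomial.map_ne_zero_iff toComplex_injective).2 hP
  have := natDegree_le_of_dvd (hcop.mul_dvd h h2) hP'
  rw [natDegree_mul (pow_ne_zero _ (X_sub_C_ne_zero _)) (pow_ne_zero _ (X_sub_C_ne_zero _)),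
    natDegree_pow, natDegree_pow, natDegree_X_sub_C, natDegree_X_sub_C, natDegree_map] at this
  omega

theorem exists_of_coeff_map_edgePoly_ne_zero {f : 𝕜 × 𝕜 → 𝕜} {a N : ℝ} (j : ℕ)
    (h : ((edgePoly (taylorCoeff f) a N 1).map (toComplex 𝕜)).coeff j ≠ 0) :
    ∃ i : ℕ, (i : ℝ) + a * j = N ∧ taylorCoeff f i j ≠ 0 := by
  refine exists_of_coeff_edgePoly_ne_zero (x := (1 : 𝕜)) (R := 𝕜) fun h0 => h ?_
  rw [coeff_map, h0, map_zero]

/-- The root must lie in 𝕜. Otherwise its conjugate has the same multiplicity and 2pm ≤ N = (1 + p)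
d < (1 + p) m, impossible for p ≥ 1. -/
theorem exists_shear_of_complex_root {f : 𝕜 × 𝕜 → 𝕜} (hf : AnalyticAt 𝕜 f 0) (hf0 : f 0 = 0)
    {p : ℕ} (hp : 0 < p) {N : ℕ} (hmin : ∀ i j, taylorCoeff f i j ≠ 0 → N ≤ i + p * j) {b : ℂ}
    (hb : b ≠ 0) (hP : edgePoly (taylorCoeff f) (p : ℝ) (N : ℝ) 1 ≠ 0) {m : ℕ}
    (hdvd : (X - C b) ^ m ∣ (edgePoly (taylorCoeff f) (p : ℝ) (N : ℝ) 1).map (toComplex 𝕜))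
    (hm : newtonDistInv f < m) :
    ∃ Q : 𝕜 → 𝕜, AnalyticAt 𝕜 Q 0 ∧ Q 0 = 0 ∧ IndexComputedBy f (inShearY Q f) := by
  have hp' : (0 : ℝ) < p := by exact_mod_cast hp
  have hp1 : (1 : ℝ) ≤ p := by exact_mod_cast hp
  have hmin' : ∀ i j, taylorCoeff f i j ≠ 0 → (N : ℝ) ≤ i + (p : ℝ) * j :=
    fun i j h => by exact_mod_cast hmin i j h
  rcases exists_root_or_two_mul_le hP hdvd with ⟨β, rfl, hβ⟩ | hdeg
  · have hβ0 : β ≠ 0 := fun h => hb (by rw [h, map_zero])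
    refine exists_shear_indexComputedBy _ f hf hf0 p hp N hmin β hβ0 hP rfl (hm.trans_le ?_)
    exact_mod_cast (le_rootMultiplicity_iff hP).2 hβ
  · exfalso
    have hP' : (edgePoly (taylorCoeff f) (p : ℝ) (N : ℝ) 1).map (toComplex 𝕜) ≠ 0 :=
      (Polynomial.map_ne_zero_iff toComplex_injective).2 hP
    obtain ⟨_, _, -, -, -, -, -, hN, A, -, -, eA, -⟩ := edge_of_lt_multiplicity hp' hmin' hP'
      exists_of_coeff_map_edgePoly_ne_zero hb hdvd hm
    rw [natDegree_map] at eA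
    have h1 : (2 : ℝ) * m ≤ (edgePoly (taylorCoeff f) (p : ℝ) (N : ℝ) 1).natDegree := by
      exact_mod_cast hdeg
    have h2 := newtonDistInv_nonneg f
    have h3 : (0 : ℝ) ≤ A := by positivity
    have h4 : (p : ℝ) * (2 * m) ≤ (1 + p) * newtonDistInv f := by
      rw [← hN, ← eA]
      have := mul_le_mul_of_nonneg_left h1 hp'.le
      linarith
    have h5 : (1 + (p : ℝ)) * newtonDistInv f < (1 + p) * m := by gcongr
    have h6 : (0 : ℝ) ≤ (p - 1) * m := mul_nonneg (by linarith) (by linarith)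
    linarith

/-- Exchanging the variables turns the weight 1/q into the integer q and the root b into b^(-q), of
no smaller multiplicity. The Newton distance and the index are symmetric. -/
theorem exists_shearX_of_complex_root {f : 𝕜 × 𝕜 → 𝕜} (hf : AnalyticAt 𝕜 f 0) (hf0 : f 0 = 0)
    {q : ℕ} (hq : 0 < q) {N : ℝ}
    (hmin : ∀ i j, taylorCoeff f i j ≠ 0 → N ≤ i + (1 / q : ℝ) * j) {i j : ℕ}
    (hij : (i : ℝ) + (1 / q : ℝ) * j = N) (hne : taylorCoeff f i j ≠ 0) {b : ℂ} (hb : b ≠ 0)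
    {m : ℕ} (hdvd : (X - C b) ^ m ∣
      (edgePoly (taylorCoeff f) (1 / q : ℝ) N 1).map (toComplex 𝕜)) (hm : newtonDistInv f < m) :
    ∃ Q : 𝕜 → 𝕜, AnalyticAt 𝕜 Q 0 ∧ Q 0 = 0 ∧ IndexComputedBy f (inShearX Q f) := by
  have hq' : (0 : ℝ) < q := by exact_mod_cast hq
  have hq1 : (0 : ℝ) < 1 / q := by positivity
  set g : 𝕜 × 𝕜 → 𝕜 := fun v => f (v.2, v.1) with hg
  have hgan : AnalyticAt 𝕜 g 0 :=
    AnalyticAt.comp (g := f) (f := fun v : 𝕜 × 𝕜 => (v.2, v.1)) hf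
      (analyticAt_snd.prod analyticAt_fst)
  have hgc : ∀ i j, taylorCoeff g i j = taylorCoeff f j i := taylorCoeff_swap hf
  have hscale : ∀ i j : ℕ, (q : ℝ) * (i + (1 / q : ℝ) * j) = j + q * i := by
    intro i j
    field_simp
    ring
  have hN' : ((j + q * i : ℕ) : ℝ) = q * N := by
    rw [← hij, hscale]; push_cast; ring
  set N' := j + q * i with hN'def
  have hline : ∀ i j : ℕ, (i : ℝ) + (1 / q : ℝ) * j = N → (j : ℝ) + (q : ℝ) * i = N' := by
    intro i j h
    rw [hN', ← h, hscale]
  have hgmin : ∀ i j, taylorCoeff g i j ≠ 0 → N' ≤ i + q * j := by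
    intro i j h
    rw [hgc] at h
    have h1 := mul_le_mul_of_nonneg_left (hmin _ _ h) hq'.le
    rw [hscale, ← hN'] at h1
    exact_mod_cast h1
  have hgP : edgePoly (taylorCoeff g) (q : ℝ) (N' : ℝ) 1 ≠ 0 :=
    edgePoly_ne_zero hq' one_ne_zero (hline i j hij) (by rw [hgc]; exact hne)
  have hP0 : (edgePoly (taylorCoeff f) (1 / q : ℝ) N 1).map (toComplex 𝕜) ≠ 0 :=
    (Polynomial.map_ne_zero_iff toComplex_injective).2 (edgePoly_ne_zero hq1 one_ne_zero hij hne)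
  have hdvd' := pow_dvd_of_exchange hq hN' (P := (edgePoly (taylorCoeff f) (1 / q : ℝ) N 1).map
      (toComplex 𝕜)) (P' := (edgePoly (taylorCoeff g) (q : ℝ) (N' : ℝ) 1).map (toComplex 𝕜)) hP0
    (fun j h => (exists_of_coeff_map_edgePoly_ne_zero j h).imp fun _ h => h.1)
    (fun j h => (exists_of_coeff_map_edgePoly_ne_zero j h).imp fun _ h => h.1)
    (fun i j h => by
      rw [coeff_map, coeff_map, coeff_edgePoly _ hq1 1 h, coeff_edgePoly _ hq' 1 (hline i j h), hgc,
        one_pow, one_pow]) hb hdvd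
  obtain ⟨Q, hQ, hQ0, hI⟩ := exists_shear_of_complex_root hgan hf0 hq hgmin
    (inv_ne_zero (pow_ne_zero q hb)) hgP hdvd' (by rw [hg, newtonDistInv_swap hf]; exact hm)
  refine ⟨Q, hQ, hQ0, ?_⟩
  have hX : inShearX Q f = fun v => inShearY Q g (v.2, v.1) := rfl
  rw [IndexComputedBy] at hI ⊢
  rw [hX, newtonDist, newtonDistInv_swap (analyticAt_inShearY hgan hQ hQ0), ← newtonDist, ← hI, hg,
    criticalIndex_swap]

end Main

end PlaneGerm

theorem proposition3p5 {𝕜 : Type*} [RCLike 𝕜] (f : 𝕜 × 𝕜 → 𝕜)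
    (hf : AnalyticAt 𝕜 f 0) (hf0 : f 0 = 0) (hne : ¬ ∀ᶠ v in 𝓝 (0 : 𝕜 × 𝕜), f v = 0) :
    (∀ (a : ℚ) (b : ℂ), b ≠ 0 →
      PlaneGerm.newtonFace f (a : ℝ) ≠ PlaneGerm.mainFace f →
      (PlaneGerm.rootCount f a b : ℝ) ≤ PlaneGerm.newtonDistInv f) ∧
    (∀ (a : ℚ) (b : ℂ), b ≠ 0 →
      PlaneGerm.newtonDistInv f < (PlaneGerm.rootCount f a b : ℝ) →
      (a.den = 1 ∧ ∃ Q : 𝕜 → 𝕜, AnalyticAt 𝕜 Q 0 ∧ Q 0 = 0 ∧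
        PlaneGerm.IndexComputedBy f (PlaneGerm.inShearY Q f)) ∨
      (a.num = 1 ∧ ∃ Q : 𝕜 → 𝕜, AnalyticAt 𝕜 Q 0 ∧ Q 0 = 0 ∧
        PlaneGerm.IndexComputedBy f (PlaneGerm.inShearX Q f))) := by
  open PlaneGerm Polynomial in
  have key : ∀ (a : ℚ) (b : ℂ), b ≠ 0 → newtonDistInv f < (rootCount f a b : ℝ) →
      0 < a ∧ ∃ N : ℝ, (∀ i j, taylorCoeff f i j ≠ 0 → N ≤ i + (a : ℝ) * j) ∧
        (∃ i j : ℕ, (i : ℝ) + (a : ℝ) * j = N ∧ taylorCoeff f i j ≠ 0) ∧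
        (X - C b) ^ rootCount f a b ∣ (edgePoly (taylorCoeff f) (a : ℝ) N 1).map (toComplex 𝕜) ∧
        (edgePoly (taylorCoeff f) (a : ℝ) N 1).map (toComplex 𝕜) ≠ 0 := by
    intro a b hb hlt
    have hm : 0 < rootCount f a b := by
      have := (newtonDistInv_nonneg f).trans_lt hlt
      exact_mod_cast this
    obtain ⟨ha, N, hmin, ⟨i, j, hij, hc⟩, hdvd⟩ := pow_rootCount_dvd hb hm
    refine ⟨ha, N, hmin, ⟨i, j, hij, hc⟩, hdvd, ?_⟩
    exact (Polynomial.map_ne_zero_iff toComplex_injective).2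
      (edgePoly_ne_zero (by exact_mod_cast ha) one_ne_zero hij hc)
  open PlaneGerm in
  refine ⟨fun a b hb hface => ?_, fun a b hb hlt => ?_⟩
  · by_contra! hlt
    obtain ⟨ha, N, hmin, -, hdvd, hP⟩ := key a b hb hlt
    have ha' : (0 : ℝ) < a := by exact_mod_cast ha
    -- Too large a multiplicity makes the edge cross the diagonal in its relative interior, so it
    -- would be the main face.
    obtain ⟨_, _, -, -, -, -, -, -, A, A', hA, eA, hA', eA', l1, l2, l3, l4⟩ :=
      edge_of_lt_multiplicity ha' hmin hP exists_of_coeff_map_edgePoly_ne_zero hb hdvd hlt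
    exact hface (newtonFace_eq_mainFace ha' hmin hA hA' eA eA' l1 l2 l3 l4)
  · obtain ⟨ha, N, hmin, ⟨i, j, hij, hc⟩, hdvd, hP⟩ := key a b hb hlt
    have ha' : (0 : ℝ) < a := by exact_mod_cast ha
    obtain ⟨p, q, hp, hq, -, hapq, hor, -⟩ :=
      edge_of_lt_multiplicity ha' hmin hP exists_of_coeff_map_edgePoly_ne_zero hb hdvd hlt
    have haq : a = p / q := Rat.cast_injective (α := ℝ) (by rw [hapq]; push_cast; rfl)
    rcases hor with rfl | rfl
    · right
      have haR : (a : ℝ) = 1 / q := by rw [hapq, Nat.cast_one]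
      rw [haR] at hmin hij hdvd
      refine ⟨?_, exists_shearX_of_complex_root hf hf0 hq hmin hij hc hb hdvd hlt⟩
      rw [haq, Nat.cast_one, one_div]
      exact Rat.inv_natCast_num_of_pos hq
    · left
      have haR : (a : ℝ) = p := by rw [hapq, Nat.cast_one, div_one]
      rw [haR] at hmin hij hdvd hP
      obtain ⟨N₁, rfl⟩ : ∃ N₁ : ℕ, N = N₁ := ⟨i + p * j, by rw [← hij]; push_cast; ring⟩
      refine ⟨?_, exists_shear_of_complex_root hf hf0 hp
        (fun i j h => by exact_mod_cast hmin i j h) hb ?_ hdvd hlt⟩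
      · rw [haq, Nat.cast_one, div_one]
        exact Rat.den_natCast p
      · exact (Polynomial.map_ne_zero_iff toComplex_injective).1 hP
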